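/- Let $q\in(-1,1)$ and let $\nu$ be a compactly supported Borel probability measure on $\mathbb{R}$. **Fock space.** Let $\mathcal{H}=L^2(\mathbb{R}_+,dt)\otimes L^2(\mathbb{R},\nu)=L^2(\mathbb{R}_+\times\mathbb{R},dt\otimes\nu)$ (complex-valued functions; inner products are linear in the second variable). On the algebraic Fock space $\mathcal{F}_{\mathrm{alg}}(\mathcal{H})=\bigoplus_{n\ge0}\mathcal{H}^{\otimes n}$ (algebraic direct sum and tensor products, $\mathcal{H}^{\otimes0}=\mathbb{C}\Omega$) the $q$-inner product makes different degrees orthogonal and satisfies $$\langle\xi_1\otimes\dots\otimes\xi_n,\eta_1\otimes\dots\otimes\eta_n\rangle_q=\sum_{\sigma\in S_n}q^{i(\sigma)}\prod_{j=1}^n\langle\xi_j,\eta_{\sigma(j)}\rangle,$$ where $i(\sigma)$ is the number of inversions of $\sigma$ and $0^0=1$. The $q$-Fock space $\mathcal{F}_q(\mathcal{H})$ is its completion. For $\zeta\in\mathcal{H}$ and a bounded operator $T$ on $\mathcal{H}$, the operators $$a^*(\zeta)\,\eta_1\otimes\dots\otimes\eta_n=\zeta\otimes\eta_1\otimes\dots\otimes\eta_n,\qquad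 a(\zeta)\,\eta_1\otimes\dots\otimes\eta_n=\sum_{i=1}^nq^{i-1}\langle\zeta,\eta_i\rangle\,\eta_1\otimes\dots\check\eta_i\dots\otimes\eta_n,$$ $$p(T)\,\eta_1\otimes\dots\otimes\eta_n=\sum_{i=1}^nq^{i-1}(T\eta_i)\otimes\eta_1\otimes\dots\check\eta_i\dots\otimes\eta_n$$ (with $a^*(\zeta)\Omega=\zeta$, $a(\zeta)\Omega=0$, $p(T)\Omega=0$; $\check\eta_i$ means that $\eta_i$ is omitted) extend to bounded operators on $\mathcal{F}_q(\mathcal{H})$. **Process and algebras.** Let $\mathcal{D}\subset\mathcal{H}$ be the complex span of the functions $\chi_{[a,b)}(t)\,x^k$ with $0\le a\le b$ and $k\ge0$. For $d\in\mathcal{D}$ let $T_d$ be multiplication by $x\,d(t,x)$, which is bounded and maps $\mathcal{D}$ into itself, and let $X(d)=a(\bar d)+a^*(d)+p(T_d)$, which is complex linear in $d$. The $q$-Lévy process of $\nu$ is $X(t)=X(\chi_{[0,t)}\otimes1)$, $t\ge0$. Let $\mathcal{A}^{\mathrm{alg}}_X$ be the unital complex algebra (no closure) generated by $\{X(t):t\ge0\}$,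 and $\mathcal{A}^{\mathrm{alg}}_{X,\Delta}\supset\mathcal{A}^{\mathrm{alg}}_X$ the one generated by $\{X(d):d\in\mathcal{D}\}$. Let $\varphi(A)=\langle\Omega,A\Omega\rangle$, and for either algebra $\mathcal{A}$ let $L^2(\mathcal{A},\varphi)$ be the completion of $\mathcal{A}$ for $\langle A,B\rangle_\varphi=\varphi(A^*B)=\langle A\Omega,B\Omega\rangle_q$. **Wick map.** $W:\mathcal{F}_{\mathrm{alg}}(\mathcal{D})\to\mathcal{A}^{\mathrm{alg}}_{X,\Delta}$ is the linear map determined by $W(\Omega)=\mathrm{Id}$, $W(d)=X(d)$ and, for $n\ge1$ and $d_0,\dots,d_n\in\mathcal{D}$, $$W(d_0\otimes\dots\otimes d_n)=X(d_0)W(d_1\otimes\dots\otimes d_n)-\sum_{i=1}^nq^{i-1}\langle\bar d_0,d_i\rangle\,W(d_1\otimes\dots\check d_i\dots\otimes d_n)-\sum_{i=1}^nq^{i-1}W(T_{d_0}d_i\otimes d_1\otimes\dots\check d_i\dots\otimes d_n).$$ **Statement.** 1. The vacuum $\Omega$ is cyclic and separating for $\mathcal{A}^{\mathrm{alg}}_X$: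 the space $\mathcal{A}^{\mathrm{alg}}_X\Omega$ is dense in $\mathcal{F}_q(\mathcal{H})$, and $A\Omega=0$ with $A\in\mathcal{A}^{\mathrm{alg}}_X$ implies $A=0$. 2. The map $A\mapsto A\Omega$ on $\mathcal{A}^{\mathrm{alg}}_X$ is injective, and the GNS representation of $\mathcal{A}^{\mathrm{alg}}_X$ on $L^2(\mathcal{A}^{\mathrm{alg}}_X,\varphi)$ by left multiplication is faithful. 3. The map $A\mapsto A\Omega$ extends to a unitary isomorphism $U$ of $L^2(\mathcal{A}^{\mathrm{alg}}_X,\varphi)$ onto $\mathcal{F}_q(\mathcal{H})$. 4. The inclusion $\mathcal{A}^{\mathrm{alg}}_X\subset\mathcal{A}^{\mathrm{alg}}_{X,\Delta}$ extends to a unitary isomorphism $J$ of $L^2(\mathcal{A}^{\mathrm{alg}}_X,\varphi)$ onto $L^2(\mathcal{A}^{\mathrm{alg}}_{X,\Delta},\varphi)$, by which the elements of $\mathcal{A}^{\mathrm{alg}}_{X,\Delta}$ are regarded as elements of $L^2(\mathcal{A}^{\mathrm{alg}}_X,\varphi)$. The image of $\mathcal{F}_{\mathrm{alg}}(\mathcal{D})$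 is dense in $\mathcal{F}_q(\mathcal{H})$, and the Wick map extends to the inverse of $U$: $U^{-1}w=J^{-1}W(w)$ for all $w\in\mathcal{F}_{\mathrm{alg}}(\mathcal{D})$. -/

import Mathlib

open scoped TensorProduct DirectSum InnerProductSpace

noncomputable section

namespace QLevy

/-! ### The algebraic Fock space and its operators -/

/-- The algebraic Fock space `⨁ₙ V^{⊗n}` of a complex vector space. -/
abbrev AlgFock (V : Type*) [AddCommGroup V] [Module ℂ V] : Type _ :=
  DirectSum ℕ fun n => ⨂[ℂ]^n V

section Algebraic

variable {V : Type*} [AddCommGroup V] [Module ℂ V]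

/-- The elementary tensor `v₁ ⊗ ⋯ ⊗ vₙ`, as an element of the algebraic Fock space. -/
def pureTensor {n : ℕ} (v : Fin n → V) : AlgFock V :=
  DirectSum.lof ℂ ℕ (fun n => ⨂[ℂ]^n V) n (PiTensorProduct.tprod ℂ v)

/-- The vacuum vector. -/
def vac (V : Type*) [AddCommGroup V] [Module ℂ V] : AlgFock V :=
  pureTensor (fun i : Fin 0 => i.elim0)

/-- `η₁ ⊗ ⋯ ⊗ ηₙ ↦ ζ ⊗ η₁ ⊗ ⋯ ⊗ ηₙ`. -/
def createN (ζ : V) (n : ℕ) : (⨂[ℂ]^n V) →ₗ[ℂ] ⨂[ℂ]^(n + 1) V :=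
  PiTensorProduct.lift
    ((PiTensorProduct.tprod ℂ : MultilinearMap ℂ (fun _ : Fin (n + 1) => V) _).curryLeft ζ)

/-- `η₀ ⊗ ⋯ ⊗ ηₙ ↦ ∑ₖ qᵏ φ(ηₖ) η₀ ⊗ ⋯ ⊗ η̌ₖ ⊗ ⋯ ⊗ ηₙ` for a linear functional `φ`. -/
def annihN (q : ℝ) (φ : V →ₗ[ℂ] ℂ) (n : ℕ) : (⨂[ℂ]^(n + 1) V) →ₗ[ℂ] ⨂[ℂ]^n V :=
  ∑ k : Fin (n + 1), ((q : ℂ) ^ (k : ℕ)) •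
    PiTensorProduct.lift (LinearMap.uncurryMid k
      (φ.smulRight (PiTensorProduct.tprod ℂ : MultilinearMap ℂ (fun _ : Fin n => V) _)))

/-- `η₀ ⊗ ⋯ ⊗ ηₙ ↦ ∑ₖ qᵏ (T ηₖ) ⊗ η₀ ⊗ ⋯ ⊗ η̌ₖ ⊗ ⋯ ⊗ ηₙ` for a linear operator `T`. -/
def gaugeN (q : ℝ) (T : V →ₗ[ℂ] V) (n : ℕ) : (⨂[ℂ]^(n + 1) V) →ₗ[ℂ] ⨂[ℂ]^(n + 1) V :=
  ∑ k : Fin (n + 1), ((q : ℂ) ^ (k : ℕ)) •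
    PiTensorProduct.lift (LinearMap.uncurryMid k
      ((PiTensorProduct.tprod ℂ : MultilinearMap ℂ (fun _ : Fin (n + 1) => V) _).curryLeft ∘ₗ T))

/-- The creation operator `a*(ζ)` on the algebraic Fock space. -/
def create (ζ : V) : AlgFock V →ₗ[ℂ] AlgFock V :=
  DirectSum.toModule ℂ ℕ _ fun n =>
    DirectSum.lof ℂ ℕ (fun n => ⨂[ℂ]^n V) (n + 1) ∘ₗ createN ζ n

/-- The `q`-annihilation operator on the algebraic Fock space, contracting with the linear
functional `φ`; it vanishes on the vacuum. -/
def annih (q : ℝ) (φ : V →ₗ[ℂ] ℂ) : AlgFock V →ₗ[ℂ] AlgFock V :=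
  DirectSum.toModule ℂ ℕ _ fun n =>
    match n with
    | 0 => 0
    | n + 1 => DirectSum.lof ℂ ℕ (fun n => ⨂[ℂ]^n V) n ∘ₗ annihN q φ n

/-- The gauge operator `p(T)` on the algebraic Fock space; it vanishes on the vacuum. -/
def gauge (q : ℝ) (T : V →ₗ[ℂ] V) : AlgFock V →ₗ[ℂ] AlgFock V :=
  DirectSum.toModule ℂ ℕ _ fun n =>
    match n with
    | 0 => 0
    | n + 1 => DirectSum.lof ℂ ℕ (fun n => ⨂[ℂ]^n V) (n + 1) ∘ₗ gaugeN q T n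

lemma createN_tprod (ζ : V) {n : ℕ} (v : Fin n → V) :
    createN ζ n (PiTensorProduct.tprod ℂ v) = PiTensorProduct.tprod ℂ (Fin.cons ζ v) := by
  simp [createN]

lemma annihN_tprod (q : ℝ) (φ : V →ₗ[ℂ] ℂ) {n : ℕ} (v : Fin (n + 1) → V) :
    annihN q φ n (PiTensorProduct.tprod ℂ v) = ∑ k : Fin (n + 1),
      ((q : ℂ) ^ (k : ℕ)) • φ (v k) • PiTensorProduct.tprod ℂ (k.removeNth v) := by
  simp [annihN, LinearMap.sum_apply]

lemma gaugeN_tprod (q : ℝ) (T : V →ₗ[ℂ] V) {n : ℕ} (v : Fin (n + 1) → V) :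
    gaugeN q T n (PiTensorProduct.tprod ℂ v) = ∑ k : Fin (n + 1),
      ((q : ℂ) ^ (k : ℕ)) • PiTensorProduct.tprod ℂ (Fin.cons (T (v k)) (k.removeNth v)) := by
  simp [gaugeN, LinearMap.sum_apply]

lemma create_lof (ζ : V) (n : ℕ) (x : ⨂[ℂ]^n V) :
    create ζ (DirectSum.lof ℂ ℕ (fun n => ⨂[ℂ]^n V) n x) =
      DirectSum.lof ℂ ℕ (fun n => ⨂[ℂ]^n V) (n + 1) (createN ζ n x) := by
  rw [create, DirectSum.toModule_lof]; rfl

lemma annih_lof_zero (q : ℝ) (φ : V →ₗ[ℂ] ℂ) (x : ⨂[ℂ]^0 V) :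
    annih q φ (DirectSum.lof ℂ ℕ (fun n => ⨂[ℂ]^n V) 0 x) = 0 := by
  rw [annih, DirectSum.toModule_lof]; rfl

lemma annih_lof_succ (q : ℝ) (φ : V →ₗ[ℂ] ℂ) (n : ℕ) (x : ⨂[ℂ]^(n + 1) V) :
    annih q φ (DirectSum.lof ℂ ℕ (fun n => ⨂[ℂ]^n V) (n + 1) x) =
      DirectSum.lof ℂ ℕ (fun n => ⨂[ℂ]^n V) n (annihN q φ n x) := by
  rw [annih, DirectSum.toModule_lof]; rfl

lemma gauge_lof_zero (q : ℝ) (T : V →ₗ[ℂ] V) (x : ⨂[ℂ]^0 V) :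
    gauge q T (DirectSum.lof ℂ ℕ (fun n => ⨂[ℂ]^n V) 0 x) = 0 := by
  rw [gauge, DirectSum.toModule_lof]; rfl

lemma gauge_lof_succ (q : ℝ) (T : V →ₗ[ℂ] V) (n : ℕ) (x : ⨂[ℂ]^(n + 1) V) :
    gauge q T (DirectSum.lof ℂ ℕ (fun n => ⨂[ℂ]^n V) (n + 1) x) =
      DirectSum.lof ℂ ℕ (fun n => ⨂[ℂ]^n V) (n + 1) (gaugeN q T n x) := by
  rw [gauge, DirectSum.toModule_lof]; rfl

lemma create_pureTensor (ζ : V) {n : ℕ} (v : Fin n → V) :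
    create ζ (pureTensor v) = pureTensor (Fin.cons ζ v : Fin (n + 1) → V) := by
  simp [create, pureTensor, createN_tprod]

lemma annih_pureTensor_zero (q : ℝ) (φ : V →ₗ[ℂ] ℂ) (v : Fin 0 → V) : annih q φ (pureTensor v) = 0 := by
  simp [annih, pureTensor]

lemma annih_pureTensor_succ (q : ℝ) (φ : V →ₗ[ℂ] ℂ) {n : ℕ} (v : Fin (n + 1) → V) :
    annih q φ (pureTensor v) = ∑ k : Fin (n + 1),
      ((q : ℂ) ^ (k : ℕ)) • φ (v k) • pureTensor (k.removeNth v : Fin n → V) := by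
  simp [annih, pureTensor, annihN_tprod]

lemma gauge_pureTensor_zero (q : ℝ) (T : V →ₗ[ℂ] V) (v : Fin 0 → V) : gauge q T (pureTensor v) = 0 := by
  simp [gauge, pureTensor]

lemma gauge_pureTensor_succ (q : ℝ) (T : V →ₗ[ℂ] V) {n : ℕ} (v : Fin (n + 1) → V) :
    gauge q T (pureTensor v) = ∑ k : Fin (n + 1),
      ((q : ℂ) ^ (k : ℕ)) • pureTensor (Fin.cons (T (v k)) (k.removeNth v) : Fin (n + 1) → V) := by
  simp [gauge, pureTensor, gaugeN_tprod]

lemma algFock_induction {p : AlgFock V → Prop} (h0 : p 0) (hadd : ∀ x y, p x → p y → p (x + y))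
    (h : ∀ (c : ℂ) (n : ℕ) (v : Fin n → V), p (c • pureTensor v)) (x : AlgFock V) : p x := by
  refine DirectSum.induction_on x h0 ?_ hadd
  intro n y
  induction y using PiTensorProduct.induction_on with
  | smul_tprod c v =>
    have := h c n v
    rw [pureTensor, ← map_smul] at this
    exact this
  | add x y hx hy => rw [map_add]; exact hadd _ _ hx hy

lemma algFock_ext {W : Type*} [AddCommMonoid W] [Module ℂ W] {f g : AlgFock V →ₗ[ℂ] W}
    (h : ∀ (n : ℕ) (v : Fin n → V), f (pureTensor v) = g (pureTensor v)) : f = g := by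
  refine LinearMap.ext fun x => ?_
  induction x using algFock_induction with
  | h0 => simp
  | hadd x y hx hy => rw [map_add, map_add, hx, hy]
  | h c n v => rw [map_smul, map_smul, h]

end Algebraic

/-! ### The `q`-inner product -/

/-- The number of inversions of a permutation. -/
def inversions {n : ℕ} (σ : Equiv.Perm (Fin n)) : ℕ :=
  (Finset.univ.filter fun p : Fin n × Fin n => p.1 < p.2 ∧ σ p.2 < σ p.1).card

section Form

variable {H : Type*} [NormedAddCommGroup H] [InnerProductSpace ℂ H]

/-- The operator `Pₙ`,
`Pₙ (η₁ ⊗ ⋯ ⊗ ηₙ) = ∑_σ q^{i(σ)} η_{σ(1)} ⊗ ⋯ ⊗ η_{σ(n)}`. -/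
def symN (q : ℝ) (n : ℕ) : (⨂[ℂ]^n H) →ₗ[ℂ] ⨂[ℂ]^n H :=
  ∑ σ : Equiv.Perm (Fin n), ((q : ℂ) ^ inversions σ) •
    (PiTensorProduct.reindex ℂ (fun _ : Fin n => H) σ⁻¹).toLinearMap

/-- For fixed `v`, the multilinear map `w ↦ ∏ᵢ ⟨vᵢ, wᵢ⟩`. -/
def prodInner {n : ℕ} (v : Fin n → H) : MultilinearMap ℂ (fun _ : Fin n => H) ℂ :=
  (MultilinearMap.mkPiAlgebra ℂ (Fin n) ℂ).compLinearMap fun i => innerₛₗ ℂ (v i)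

lemma prodInner_apply {n : ℕ} (v w : Fin n → H) : prodInner v w = ∏ i, ⟪v i, w i⟫_ℂ := by
  simp [prodInner]

/-- For fixed `w`, the conjugate-linear functional `v₁ ⊗ ⋯ ⊗ vₙ ↦ ∏ᵢ ⟨vᵢ, wᵢ⟩`. -/
def conjFunctional {n : ℕ} (w : Fin n → H) : (⨂[ℂ]^n H) →ₗ⋆[ℂ] ℂ :=
  (starLinearEquiv ℂ : ℂ ≃ₗ⋆[ℂ] ℂ).toLinearMap.comp (PiTensorProduct.lift (prodInner w))

lemma conjFunctional_tprod {n : ℕ} (v w : Fin n → H) :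
    conjFunctional w (PiTensorProduct.tprod ℂ v) = ∏ i, ⟪v i, w i⟫_ℂ := by
  simp [conjFunctional, prodInner_apply]

lemma conjFunctional_ext {n : ℕ} {f g : (⨂[ℂ]^n H) →ₗ⋆[ℂ] ℂ}
    (h : ∀ v : Fin n → H, f (PiTensorProduct.tprod ℂ v) = g (PiTensorProduct.tprod ℂ v)) :
    f = g := by
  ext x
  induction x using PiTensorProduct.induction_on with
  | smul_tprod c v => rw [LinearMap.map_smulₛₗ, LinearMap.map_smulₛₗ, h]
  | add x y hx hy => rw [map_add, map_add, hx, hy]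

/-- The inner product `⟨x, y⟩₀` on the `n`-particle space, as `y ↦ (x ↦ ⟨x, y⟩₀)`. -/
def inner0 (n : ℕ) : (⨂[ℂ]^n H) →ₗ[ℂ] (⨂[ℂ]^n H) →ₗ⋆[ℂ] ℂ :=
  PiTensorProduct.lift
    (MultilinearMap.mk' (fun w => conjFunctional w)
      (fun w i x y => conjFunctional_ext fun v => by
        simp only [LinearMap.add_apply, conjFunctional_tprod, ← prodInner_apply,
          MultilinearMap.map_update_add])
      (fun w i c x => conjFunctional_ext fun v => by
        simp only [LinearMap.smul_apply, conjFunctional_tprod, ← prodInner_apply,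
          MultilinearMap.map_update_smul]))

/-- The `q`-inner product `⟨x, y⟩_q = ⟨x, P y⟩₀` on the algebraic Fock space, for which different
particle numbers are orthogonal, as `y ↦ (x ↦ ⟨x, y⟩_q)`. -/
def qInner (q : ℝ) : AlgFock H →ₗ[ℂ] AlgFock H →ₗ⋆[ℂ] ℂ :=
  DirectSum.toModule ℂ ℕ _ fun n =>
    { toFun := fun y => (inner0 n (symN q n y)).comp
        (DirectSum.component ℂ ℕ (fun n => ⨂[ℂ]^n H) n)
      map_add' := fun y y' => by ext x; simp
      map_smul' := fun c y => by ext x; simp }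

/-- `∑_σ q^{i(σ)} ∏ᵢ ⟨vᵢ, w_{σ(i)}⟩`. -/
def pairing (q : ℝ) {n : ℕ} (v w : Fin n → H) : ℂ :=
  ∑ σ : Equiv.Perm (Fin n), (q : ℂ) ^ inversions σ * ∏ i, ⟪v i, w (σ i)⟫_ℂ

lemma qInner_pureTensor (q : ℝ) {n : ℕ} (v w : Fin n → H) :
    qInner q (pureTensor w) (pureTensor v) = pairing q v w := by
  rw [qInner, pureTensor, DirectSum.toModule_lof, pureTensor]
  simp only [LinearMap.coe_mk, AddHom.coe_mk, LinearMap.comp_apply, DirectSum.component.lof_self]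
  simp [inner0, symN, pairing, LinearMap.sum_apply, conjFunctional_tprod, Equiv.Perm.inv_def]

lemma qInner_lof_ne (q : ℝ) {m n : ℕ} (h : m ≠ n) (x : ⨂[ℂ]^m H) (y : ⨂[ℂ]^n H) :
    qInner q (DirectSum.lof ℂ ℕ (fun n => ⨂[ℂ]^n H) n y)
      (DirectSum.lof ℂ ℕ (fun n => ⨂[ℂ]^n H) m x) = 0 := by
  rw [qInner, DirectSum.toModule_lof]
  simp only [LinearMap.coe_mk, AddHom.coe_mk, LinearMap.comp_apply, DirectSum.component.of,
    dif_neg h, map_zero]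

lemma qInner_pureTensor_ne (q : ℝ) {m n : ℕ} (h : m ≠ n) (v : Fin m → H) (w : Fin n → H) :
    qInner q (pureTensor w) (pureTensor v) = 0 :=
  qInner_lof_ne q h _ _

lemma inversions_inv {n : ℕ} (σ : Equiv.Perm (Fin n)) : inversions σ⁻¹ = inversions σ := by
  unfold inversions
  refine Finset.card_bij (fun p _ => (σ⁻¹ p.2, σ⁻¹ p.1)) ?_ ?_ ?_
  · rintro ⟨a, b⟩ h
    simpa [and_comm] using h
  · rintro ⟨a, b⟩ _ ⟨c, d⟩ _ h
    simpa [and_comm] using h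
  · rintro ⟨a, b⟩ h
    exact ⟨(σ b, σ a), by simpa [and_comm] using h, by simp⟩

lemma pairing_conj (q : ℝ) {n : ℕ} (v w : Fin n → H) :
    (starRingEnd ℂ) (pairing q w v) = pairing q v w := by
  unfold pairing
  rw [map_sum]
  refine Fintype.sum_equiv (Equiv.inv _) _ _ fun σ => ?_
  rw [map_mul, map_pow, Complex.conj_ofReal, map_prod, Equiv.inv_apply, inversions_inv]
  congr 1
  refine Fintype.prod_equiv σ _ _ fun i => ?_
  simp

lemma qInner_conj (q : ℝ) (x y : AlgFock H) :
    (starRingEnd ℂ) (qInner q x y) = qInner q y x := by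
  induction x using algFock_induction with
  | h0 => simp
  | hadd x x' hx hx' => simp only [map_add, LinearMap.add_apply, hx, hx']
  | h c n v =>
    rw [map_smul, LinearMap.smul_apply, LinearMap.map_smulₛₗ, smul_eq_mul, smul_eq_mul, map_mul]
    congr 1
    induction y using algFock_induction with
    | h0 => simp
    | hadd x x' hx hx' => simp only [map_add, LinearMap.add_apply, hx, hx']
    | h c m w =>
      rw [LinearMap.map_smulₛₗ, LinearMap.map_smul, LinearMap.smul_apply, smul_eq_mul,
        smul_eq_mul, map_mul, Complex.conj_conj]
      congr 1
      rcases eq_or_ne m n with rfl | h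
      · rw [qInner_pureTensor, qInner_pureTensor, pairing_conj]
      · rw [qInner_pureTensor_ne _ h, qInner_pureTensor_ne _ h.symm, map_zero]

open scoped ComplexOrder

lemma posSemidef_finset_prod {ι κ : Type*} [Finite ι] (s : Finset κ) (M : κ → Matrix ι ι ℂ)
    (h : ∀ k, (M k).PosSemidef) : (Matrix.of fun i j => ∏ k ∈ s, M k i j).PosSemidef := by
  classical
  induction s using Finset.induction_on with
  | empty =>
    have := Matrix.posSemidef_gram ℂ (fun _ : ι => (1 : ℂ))
    convert! this using 1
    ext i j
    simp
  | insert k s hk ih =>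
    convert! (h k).hadamard ih using 1
    ext i j
    simp [Finset.prod_insert hk]

lemma posSemidef_sign {ι : Type*} [Finite ι] {q : ℝ} (hq : |q| ≤ 1) (s : ι → Prop) [DecidablePred s] :
    (Matrix.of fun i j => if (s i ↔ s j) then (1 : ℂ) else (q : ℂ)).PosSemidef := by
  obtain ⟨h1, h2⟩ := abs_le.1 hq
  let ε : ι → ℂ := fun i => if s i then 1 else -1
  have A : (Matrix.gram ℂ (fun _ : ι => (1 : ℂ))).PosSemidef := Matrix.posSemidef_gram ℂ _
  have B : (Matrix.gram ℂ ε).PosSemidef := Matrix.posSemidef_gram ℂ _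
  have h3 : (0 : ℂ) ≤ (((1 + q) / 2 : ℝ) : ℂ) := by
    rw [← Complex.ofReal_zero, Complex.real_le_real]; linarith
  have h4 : (0 : ℂ) ≤ (((1 - q) / 2 : ℝ) : ℂ) := by
    rw [← Complex.ofReal_zero, Complex.real_le_real]; linarith
  convert! (A.smul h3).add (B.smul h4) using 1
  ext i j
  by_cases hi : s i <;> by_cases hj : s j <;> simp [ε, hi, hj] <;> ring

/-- The number of inversions of `τ σ⁻¹` is the number of pairs ordered differently by `σ`, `τ`. -/
lemma pow_inversions (q : ℂ) {n : ℕ} (σ τ : Equiv.Perm (Fin n)) :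
    q ^ inversions (τ * σ⁻¹) = ∏ p ∈ Finset.univ.filter (fun p : Fin n × Fin n => p.1 < p.2),
      if (σ p.1 < σ p.2 ↔ τ p.1 < τ p.2) then (1 : ℂ) else q := by
  rw [Finset.prod_ite, Finset.prod_const_one, one_mul, Finset.prod_const]
  congr 1
  have hmem : ∀ a b : Fin n, (a, b) ∈ (Finset.univ.filter fun p : Fin n × Fin n =>
      p.1 < p.2 ∧ (τ * σ⁻¹) p.2 < (τ * σ⁻¹) p.1) ↔
      a < b ∧ τ (σ.symm b) < τ (σ.symm a) := fun a b => by
    rw [Finset.mem_filter]; simp [Equiv.Perm.inv_def]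
  unfold inversions
  refine Finset.card_bij (fun p _ => if σ.symm p.1 < σ.symm p.2
    then (σ.symm p.1, σ.symm p.2) else (σ.symm p.2, σ.symm p.1)) ?_ ?_ ?_
  · rintro ⟨a, b⟩ h
    rw [hmem] at h
    simp only [Finset.mem_filter, Finset.mem_univ, true_and]
    have hne : σ.symm a ≠ σ.symm b := fun e => h.1.ne (σ.symm.injective e)
    split_ifs with h1
    · simp only [Equiv.apply_symm_apply]
      exact ⟨h1, fun e => absurd (e.1 h.1) (not_lt.2 h.2.le)⟩
    · simp only [Equiv.apply_symm_apply]
      exact ⟨lt_of_le_of_ne (not_lt.1 h1) hne.symm, fun e => absurd (e.2 h.2) (not_lt.2 h.1.le)⟩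
  · rintro ⟨a, b⟩ h ⟨c, d⟩ h' e
    rw [hmem] at h h'
    split_ifs at e <;> simp only [Prod.mk.injEq, EmbeddingLike.apply_eq_iff_eq] at e
    · ext <;> simp [e.1, e.2]
    · exact absurd h.1 (by rw [e.1, e.2]; exact not_lt.2 h'.1.le)
    · exact absurd h.1 (by rw [e.1, e.2]; exact not_lt.2 h'.1.le)
    · ext <;> simp [e.1, e.2]
  · rintro ⟨a, b⟩ h
    simp only [Finset.mem_filter, Finset.mem_univ, true_and] at h
    have hτ : τ a ≠ τ b := fun e => h.1.ne (τ.injective e)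
    have hσ : σ a ≠ σ b := fun e => h.1.ne (σ.injective e)
    by_cases h1 : σ a < σ b
    · refine ⟨(σ a, σ b), ?_, ?_⟩
      · rw [hmem, Equiv.symm_apply_apply, Equiv.symm_apply_apply]
        exact ⟨h1, lt_of_le_of_ne (not_lt.1 fun e => h.2 ⟨fun _ => e, fun _ => h1⟩) hτ.symm⟩
      · simp [h.1]
    · refine ⟨(σ b, σ a), ?_, ?_⟩
      · rw [hmem, Equiv.symm_apply_apply, Equiv.symm_apply_apply]
        refine ⟨lt_of_le_of_ne (not_lt.1 h1) hσ.symm, ?_⟩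
        by_contra e
        exact h.2 ⟨fun x => absurd x h1, fun x => absurd x e⟩
      · simp [not_lt.2 h.1.le]

lemma pairing_sum_nonneg {q : ℝ} (hq : |q| ≤ 1) {n : ℕ} {ι : Type*} [Fintype ι]
    (c : ι → ℂ) (v : ι → Fin n → H) :
    0 ≤ ∑ i, ∑ j, (starRingEnd ℂ) (c i) * c j * pairing q (v i) (v j) := by
  let M : Matrix (ι × Equiv.Perm (Fin n)) (ι × Equiv.Perm (Fin n)) ℂ :=
    Matrix.of fun a b => (q : ℂ) ^ inversions (b.2 * a.2⁻¹) *
      ∏ k, ⟪v a.1 (a.2 k), v b.1 (b.2 k)⟫_ℂ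
  have hM : M.PosSemidef := by
    have h1 := posSemidef_finset_prod (ι := ι × Equiv.Perm (Fin n))
      (Finset.univ.filter (fun p : Fin n × Fin n => p.1 < p.2))
      (fun p => Matrix.of fun a b =>
        if (a.2 p.1 < a.2 p.2 ↔ b.2 p.1 < b.2 p.2) then (1 : ℂ) else (q : ℂ))
      (fun p => posSemidef_sign hq _)
    have h2 := posSemidef_finset_prod (ι := ι × Equiv.Perm (Fin n)) (Finset.univ : Finset (Fin n))
      (fun k => Matrix.gram ℂ fun a => v a.1 (a.2 k)) (fun k => Matrix.posSemidef_gram ℂ _)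
    convert! h1.hadamard h2 using 1
    ext a b
    simp [M, pow_inversions]
  have h := hM.dotProduct_mulVec_nonneg (fun a => c a.1)
  have key : star (fun a : ι × Equiv.Perm (Fin n) => c a.1) ⬝ᵥ M.mulVec (fun a => c a.1)
      = (Fintype.card (Equiv.Perm (Fin n)) : ℂ) *
        ∑ i, ∑ j, (starRingEnd ℂ) (c i) * c j * pairing q (v i) (v j) := by
    simp only [dotProduct, Matrix.mulVec, Fintype.sum_prod_type, Pi.star_apply, Finset.mul_sum, M,
      Matrix.of_apply]
    refine Finset.sum_congr rfl fun i _ => ?_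
    rw [Finset.sum_comm]
    simp only [← Finset.mul_sum]
    have hσ : ∀ (σ : Equiv.Perm (Fin n)) (j : ι),
        ∑ τ : Equiv.Perm (Fin n), (q : ℂ) ^ inversions (τ * σ⁻¹) *
          (∏ k, ⟪v i (σ k), v j (τ k)⟫_ℂ) * c j = c j * pairing q (v i) (v j) := by
      intro σ j
      unfold pairing
      rw [Finset.mul_sum]
      refine Fintype.sum_equiv (Equiv.mulRight σ⁻¹) _ _ fun τ => ?_
      have : ∏ k, ⟪v i (σ k), v j (τ k)⟫_ℂ = ∏ k, ⟪v i k, v j ((τ * σ⁻¹) k)⟫_ℂ :=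
        Fintype.prod_equiv σ _ _ fun k => by simp
      rw [this, Equiv.coe_mulRight]
      ring
    simp only [hσ]
    simp [Finset.mul_sum, mul_assoc, mul_left_comm]
  rw [key] at h
  have hc : (0 : ℝ) < Fintype.card (Equiv.Perm (Fin n)) := by exact_mod_cast Fintype.card_pos
  have h2 := mul_nonneg (Complex.zero_le_real.2 (inv_nonneg.2 hc.le)) h
  rwa [← mul_assoc, Complex.ofReal_inv, Complex.ofReal_natCast, inv_mul_cancel₀, one_mul] at h2
  exact_mod_cast hc.ne'

lemma exists_tprod_sum {n : ℕ} (x : ⨂[ℂ]^n H) : ∃ (ι : Type) (_ : Fintype ι) (c : ι → ℂ)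
    (v : ι → Fin n → H), x = ∑ i, c i • PiTensorProduct.tprod ℂ (v i) := by
  induction x using PiTensorProduct.induction_on with
  | smul_tprod c v => exact ⟨Unit, inferInstance, fun _ => c, fun _ => v, by simp⟩
  | add x y hx hy =>
    obtain ⟨ι, _, c, v, rfl⟩ := hx
    obtain ⟨κ, _, d, w, rfl⟩ := hy
    exact ⟨ι ⊕ κ, inferInstance, Sum.elim c d, Sum.elim v w, by simp⟩

lemma exists_lof_sum (x : AlgFock H) : ∃ (s : Finset ℕ) (y : (n : ℕ) → ⨂[ℂ]^n H),
    x = ∑ n ∈ s, DirectSum.lof ℂ ℕ (fun n => ⨂[ℂ]^n H) n (y n) := by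
  classical
  exact ⟨DFinsupp.support x, fun n => x n, (DirectSum.sum_support_of x).symm⟩

lemma qInner_sum_nonneg {q : ℝ} (s : Finset ℕ) (f : ℕ → AlgFock H)
    (h : ∀ n, 0 ≤ qInner q (f n) (f n)) (h' : ∀ m n, m ≠ n → qInner q (f n) (f m) = 0) :
    0 ≤ qInner q (∑ n ∈ s, f n) (∑ n ∈ s, f n) := by
  rw [map_sum]
  refine Finset.sum_nonneg fun n hn => ?_
  rw [map_sum, LinearMap.sum_apply, Finset.sum_eq_single_of_mem n hn fun m _ hm => h' n m hm.symm]
  exact h n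

lemma qInner_self_nonneg {q : ℝ} (hq : |q| ≤ 1) (x : AlgFock H) : 0 ≤ qInner q x x := by
  have hlevel : ∀ (n : ℕ) (y : ⨂[ℂ]^n H),
      0 ≤ qInner q (DirectSum.lof ℂ ℕ (fun n => ⨂[ℂ]^n H) n y)
        (DirectSum.lof ℂ ℕ (fun n => ⨂[ℂ]^n H) n y) := by
    intro n y
    obtain ⟨ι, _, c, v, rfl⟩ := exists_tprod_sum y
    convert! pairing_sum_nonneg hq c v using 1
    simp only [map_sum, map_smul, LinearMap.sum_apply, LinearMap.smul_apply, LinearMap.map_smulₛₗ,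
      smul_eq_mul, Finset.mul_sum]
    refine Finset.sum_congr rfl fun i _ => Finset.sum_congr rfl fun j _ => ?_
    have := qInner_pureTensor q (v i) (v j)
    rw [pureTensor, pureTensor] at this
    rw [this]
    ring
  obtain ⟨s, y, rfl⟩ := exists_lof_sum x
  refine qInner_sum_nonneg s (fun n => DirectSum.lof ℂ ℕ (fun n => ⨂[ℂ]^n H) n (y n))
    (fun n => hlevel n _) fun m n hmn => qInner_lof_ne q hmn _ _

end Form

/-! ### The `q`-Fock space -/

/-- The algebraic Fock space of a complex inner product space, equipped with the `q`-inner
product. -/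
def PreFock (_q : Set.Ioo (-1 : ℝ) 1) (H : Type*) [NormedAddCommGroup H] [InnerProductSpace ℂ H] :
    Type _ :=
  AlgFock H

section Fock

variable {H : Type*} [NormedAddCommGroup H] [InnerProductSpace ℂ H] {q : Set.Ioo (-1 : ℝ) 1}

instance : AddCommGroup (PreFock q H) := inferInstanceAs (AddCommGroup (AlgFock H))

instance : Module ℂ (PreFock q H) := inferInstanceAs (Module ℂ (AlgFock H))

lemma abs_lt_one (q : Set.Ioo (-1 : ℝ) 1) : |(q : ℝ)| < 1 := abs_lt.2 q.2

/-- The `q`-inner product. -/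
@[reducible]
def preFockCore (q : Set.Ioo (-1 : ℝ) 1) (H : Type*) [NormedAddCommGroup H]
    [InnerProductSpace ℂ H] : PreInnerProductSpace.Core ℂ (PreFock q H) where
  inner x y := qInner (H := H) q y x
  conj_inner_symm x y := qInner_conj (H := H) q x y
  re_inner_nonneg x := (Complex.nonneg_iff.1 (qInner_self_nonneg (H := H) (abs_lt_one q).le x)).1
  add_left x y z := map_add (qInner (H := H) q z) x y
  smul_left x y r := LinearMap.map_smulₛₗ (qInner (H := H) q y) r x

instance : SeminormedAddCommGroup (PreFock q H) :=
  @InnerProductSpace.Core.toSeminormedAddCommGroup ℂ _ _ _ _ (preFockCore q H)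

instance : InnerProductSpace ℂ (PreFock q H) := InnerProductSpace.ofCore (preFockCore q H)

lemma preFock_inner (x y : PreFock q H) : ⟪x, y⟫_ℂ = qInner (H := H) q y x := rfl

/-- The `q`-Fock space: the completion of the algebraic Fock space for the `q`-inner product. -/
abbrev QFock (q : Set.Ioo (-1 : ℝ) 1) (H : Type*) [NormedAddCommGroup H]
    [InnerProductSpace ℂ H] : Type _ := UniformSpace.Completion (PreFock q H)

variable (q) in
/-- The canonical map of the algebraic Fock space into the `q`-Fock space. -/
def toFock : AlgFock H →ₗ[ℂ] QFock q H :=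
  (UniformSpace.Completion.toComplL (𝕜 := ℂ) (E := PreFock q H)).toLinearMap

/-- The vacuum vector of the `q`-Fock space. -/
def vacuum (q : Set.Ioo (-1 : ℝ) 1) (H : Type*) [NormedAddCommGroup H]
    [InnerProductSpace ℂ H] : QFock q H := toFock q (vac H)

/-- The extension by continuity to the `q`-Fock space of an operator on the algebraic Fock
space. -/
def extendOp (q : Set.Ioo (-1 : ℝ) 1) (L : AlgFock H →ₗ[ℂ] AlgFock H) : QFock q H →L[ℂ] QFock q H :=
  (toFock q ∘ₗ L).extendOfNorm (toFock q)

lemma denseRange_toFock : DenseRange (toFock q : AlgFock H →ₗ[ℂ] QFock q H) :=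
  UniformSpace.Completion.denseRange_coe (α := PreFock q H)

/-- Boundedness of an operator on the algebraic Fock space for the `q`-norm. -/
def IsQBounded (q : Set.Ioo (-1 : ℝ) 1) (L : AlgFock H →ₗ[ℂ] AlgFock H) : Prop :=
  ∃ C : ℝ, ∀ x, ‖toFock q (L x)‖ ≤ C * ‖toFock q x‖

lemma extendOp_toFock {L : AlgFock H →ₗ[ℂ] AlgFock H} (hL : IsQBounded q L) (x : AlgFock H) :
    extendOp q L (toFock q x) = toFock q (L x) :=
  LinearMap.extendOfNorm_eq (f := toFock q ∘ₗ L) (e := toFock q) denseRange_toFock hL x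

lemma inner_toFock (x y : AlgFock H) : ⟪toFock q x, toFock q y⟫_ℂ = qInner q y x :=
  UniformSpace.Completion.inner_coe (𝕜 := ℂ) (E := PreFock q H) x y

end Fock

/-! ### Adjoints and boundedness of the operators -/

section Bounded

variable {H : Type*} [NormedAddCommGroup H] [InnerProductSpace ℂ H]

/-- The permutation `0 ↦ k`, `i + 1 ↦ k.succAbove (τ i)`. -/
def consPerm {n : ℕ} (p : Fin (n + 1) × Equiv.Perm (Fin n)) : Equiv.Perm (Fin (n + 1)) :=
  Equiv.ofBijective (Fin.cons p.1 fun i => p.1.succAbove (p.2 i) : Fin (n + 1) → Fin (n + 1))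
    (Finite.injective_iff_bijective.1 (Fin.cons_injective_iff.2
      ⟨by rintro ⟨i, hi⟩; exact Fin.succAbove_ne _ _ hi,
        Fin.succAbove_right_injective.comp p.2.injective⟩))

lemma consPerm_zero {n : ℕ} (p : Fin (n + 1) × Equiv.Perm (Fin n)) : consPerm p 0 = p.1 := rfl

lemma consPerm_succ {n : ℕ} (p : Fin (n + 1) × Equiv.Perm (Fin n)) (i : Fin n) :
    consPerm p i.succ = p.1.succAbove (p.2 i) := rfl

lemma consPerm_bijective (n : ℕ) : Function.Bijective (consPerm (n := n)) := by
  rw [Fintype.bijective_iff_injective_and_card]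
  refine ⟨?_, by simp [Fintype.card_perm, Nat.factorial_succ]⟩
  rintro ⟨k, τ⟩ ⟨l, ρ⟩ h
  have hk : k = l := by simpa [consPerm_zero] using DFunLike.congr_fun h 0
  subst hk
  have : τ = ρ := by
    ext1 i
    have := DFunLike.congr_fun h i.succ
    rw [consPerm_succ, consPerm_succ] at this
    exact Fin.succAbove_right_injective this
  rw [this]

lemma inversions_eq_sum {n : ℕ} (σ : Equiv.Perm (Fin n)) :
    inversions σ = ∑ i, ∑ j, if i < j ∧ σ j < σ i then 1 else 0 := by
  rw [inversions, Finset.card_filter, ← Finset.univ_product_univ, Finset.sum_product]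

lemma card_succAbove_lt {n : ℕ} (k : Fin (n + 1)) :
    (∑ i : Fin n, if k.succAbove i < k then 1 else 0) = (k : ℕ) := by
  simp only [Fin.succAbove_lt_iff_castSucc_lt]
  rw [← Finset.card_filter]
  simp only [Fin.lt_def, Fin.val_castSucc]
  have := k.is_lt
  simp only [Fin.card_filter_val_lt]
  omega

lemma inversions_consPerm {n : ℕ} (k : Fin (n + 1)) (τ : Equiv.Perm (Fin n)) :
    inversions (consPerm (k, τ)) = k + inversions τ := by
  rw [inversions_eq_sum, inversions_eq_sum, Fin.sum_univ_succ]
  congr 1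
  · rw [Fin.sum_univ_succ]
    simp only [consPerm_zero, consPerm_succ, lt_self_iff_false, false_and, if_false, zero_add,
      Fin.succ_pos, true_and]
    rw [← card_succAbove_lt k]
    exact Fintype.sum_equiv τ _ _ fun i => rfl
  · refine Finset.sum_congr rfl fun i _ => ?_
    rw [Fin.sum_univ_succ]
    simp [consPerm_succ]

lemma pairing_succ (q : ℝ) {n : ℕ} (ζ : H) (v : Fin n → H) (w : Fin (n + 1) → H) :
    pairing q (Fin.cons ζ v : Fin (n + 1) → H) w = ∑ k : Fin (n + 1),
      (q : ℂ) ^ (k : ℕ) * (⟪ζ, w k⟫_ℂ * pairing q v (k.removeNth w)) := by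
  rw [pairing, ← Function.Bijective.sum_comp (consPerm_bijective n), Fintype.sum_prod_type]
  refine Finset.sum_congr rfl fun k _ => ?_
  rw [pairing, Finset.mul_sum, Finset.mul_sum]
  refine Finset.sum_congr rfl fun τ _ => ?_
  rw [inversions_consPerm, Fin.prod_univ_succ]
  simp only [consPerm_zero, consPerm_succ, Fin.cons_zero, Fin.cons_succ, Fin.removeNth]
  ring

/-- `a*(ζ)` and `a(ζ)` are adjoint for the `q`-inner product. -/
lemma qInner_create (q : ℝ) (ζ : H) (x y : AlgFock H) :
    qInner q y (create ζ x) = qInner q (annih q (innerₛₗ ℂ ζ) y) x := by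
  induction x using algFock_induction with
  | h0 => simp
  | hadd x x' hx hx' => simp only [map_add, hx, hx']
  | h c n v =>
    rw [map_smul, LinearMap.map_smulₛₗ, LinearMap.map_smulₛₗ]
    congr 1
    induction y using algFock_induction with
    | h0 => simp
    | hadd x x' hx hx' => simp only [map_add, LinearMap.add_apply, hx, hx']
    | h c m w =>
      rw [map_smul, map_smul, map_smul, LinearMap.smul_apply, LinearMap.smul_apply]
      congr 1
      rw [create_pureTensor]
      cases m with
      | zero =>
        rw [annih_pureTensor_zero, qInner_pureTensor_ne _ (Nat.succ_ne_zero n)]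
        simp
      | succ m =>
        rw [annih_pureTensor_succ, map_sum, LinearMap.sum_apply]
        rcases eq_or_ne n m with rfl | h
        · rw [qInner_pureTensor, pairing_succ]
          refine Finset.sum_congr rfl fun k _ => ?_
          rw [map_smul, map_smul, LinearMap.smul_apply, LinearMap.smul_apply, qInner_pureTensor]
          simp
        · rw [qInner_pureTensor_ne _ (by simpa using h), Finset.sum_eq_zero]
          intro k _
          rw [map_smul, map_smul, LinearMap.smul_apply, LinearMap.smul_apply, qInner_pureTensor_ne _ h]
          simp

/-- If `T'` is adjoint to `T`, then `p(T')` is adjoint to `p(T)` for the `q`-inner product. -/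
lemma qInner_gauge (q : ℝ) {T T' : H →ₗ[ℂ] H} (hT : ∀ u v, ⟪T' u, v⟫_ℂ = ⟪u, T v⟫_ℂ)
    (x y : AlgFock H) : qInner q (gauge q T y) x = qInner q y (gauge q T' x) := by
  induction x using algFock_induction with
  | h0 => simp
  | hadd x x' hx hx' => simp only [map_add, hx, hx']
  | h c n v =>
    rw [LinearMap.map_smulₛₗ, (gauge q T').map_smul, LinearMap.map_smulₛₗ]
    congr 1
    induction y using algFock_induction with
    | h0 => simp
    | hadd x x' hx hx' => simp only [map_add, LinearMap.add_apply, hx, hx']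
    | h c m w =>
      rw [map_smul, map_smul, map_smul, LinearMap.smul_apply, LinearMap.smul_apply]
      congr 1
      cases n with
      | zero =>
        rw [gauge_pureTensor_zero]
        cases m with
        | zero => rw [gauge_pureTensor_zero]; simp
        | succ m =>
          rw [gauge_pureTensor_succ, map_sum, LinearMap.sum_apply, map_zero, Finset.sum_eq_zero]
          intro k _
          rw [map_smul, LinearMap.smul_apply, qInner_pureTensor_ne _ (Nat.succ_ne_zero m).symm, smul_zero]
      | succ n =>
        cases m with
        | zero =>
          rw [gauge_pureTensor_zero, gauge_pureTensor_succ, map_sum, map_zero, LinearMap.zero_apply,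
            Finset.sum_eq_zero]
          intro k _
          rw [LinearMap.map_smulₛₗ, qInner_pureTensor_ne _ (Nat.succ_ne_zero n), smul_zero]
        | succ m =>
          rw [gauge_pureTensor_succ, gauge_pureTensor_succ, map_sum, map_sum, LinearMap.sum_apply]
          rcases eq_or_ne n m with rfl | h
          · have h1 : ∀ k : Fin (n + 1), (((q : ℂ) ^ (k : ℕ)) •
                qInner q (pureTensor (Fin.cons (T (w k)) (k.removeNth w) : Fin (n + 1) → H))) (pureTensor v)
                = ∑ j : Fin (n + 1), (q : ℂ) ^ (k : ℕ) * ((q : ℂ) ^ (j : ℕ) *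
                  (⟪v j, T (w k)⟫_ℂ * pairing q (j.removeNth v) (k.removeNth w))) := by
              intro k
              rw [LinearMap.smul_apply, qInner_pureTensor, ← pairing_conj, pairing_succ, map_sum,
                smul_eq_mul, Finset.mul_sum]
              refine Finset.sum_congr rfl fun j _ => ?_
              rw [map_mul, map_mul, map_pow, Complex.conj_ofReal, pairing_conj, inner_conj_symm]
            have h2 : ∀ j : Fin (n + 1), qInner q (pureTensor w) (((q : ℂ) ^ (j : ℕ)) •
                (pureTensor (Fin.cons (T' (v j)) (j.removeNth v) : Fin (n + 1) → H)))
                = ∑ k : Fin (n + 1), (q : ℂ) ^ (k : ℕ) * ((q : ℂ) ^ (j : ℕ) *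
                  (⟪v j, T (w k)⟫_ℂ * pairing q (j.removeNth v) (k.removeNth w))) := by
              intro j
              rw [LinearMap.map_smulₛₗ, qInner_pureTensor, pairing_succ, smul_eq_mul, Finset.mul_sum]
              refine Finset.sum_congr rfl fun k _ => ?_
              rw [map_pow, Complex.conj_ofReal, hT]
              ring
            simp only [map_smul, h1, h2]
            exact Finset.sum_comm
          · rw [Finset.sum_eq_zero, Finset.sum_eq_zero]
            · intro k _
              rw [LinearMap.map_smulₛₗ, qInner_pureTensor_ne _ (by simpa using h), smul_zero]
            · intro k _
              rw [map_smul, LinearMap.smul_apply, qInner_pureTensor_ne _ (by simpa using h), smul_zero]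

/-! Growth of iterates on elementary tensors. -/

/-- `p (v₁ ⊗ ⋯ ⊗ vₙ) ≤ C ‖v₁‖ ⋯ ‖vₙ‖`. -/
def LevelBound (p : Seminorm ℂ (AlgFock H)) (n : ℕ) (C : ℝ) : Prop :=
  ∀ v : Fin n → H, p (pureTensor v) ≤ C * ∏ i, ‖v i‖

lemma sum_abs_pow_le {q : ℝ} (hq : |q| < 1) (n : ℕ) :
    ∑ k : Fin n, |q| ^ (k : ℕ) ≤ (1 - |q|)⁻¹ := by
  rw [Fin.sum_univ_eq_sum_range (fun k => |q| ^ k) n, ← tsum_geometric_of_lt_one (abs_nonneg q) hq]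
  exact (summable_geometric_of_lt_one (abs_nonneg q) hq).sum_le_tsum _ fun i _ => by positivity

lemma levelBound_sum {q : ℝ} (hq : |q| < 1) {m n : ℕ} {p : Seminorm ℂ (AlgFock H)} {C M : ℝ}
    (hC : 0 ≤ C) (hM : 0 ≤ M) (v : Fin n → H) (x : Fin m → AlgFock H)
    (hx : ∀ k, p (x k) ≤ C * (M * ∏ i, ‖v i‖)) :
    p (∑ k : Fin m, ((q : ℂ) ^ (k : ℕ)) • x k) ≤ C * (M * (1 - |q|)⁻¹) * ∏ i, ‖v i‖ := by
  have hpos : 0 ≤ C * (M * ∏ i, ‖v i‖) := by positivity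
  calc p (∑ k : Fin m, ((q : ℂ) ^ (k : ℕ)) • x k)
      ≤ ∑ k : Fin m, p (((q : ℂ) ^ (k : ℕ)) • x k) :=
        Finset.le_sum_of_subadditive p (map_zero p).le (map_add_le_add p) _ _
    _ = ∑ k : Fin m, |q| ^ (k : ℕ) * p (x k) := by
        refine Finset.sum_congr rfl fun k _ => ?_
        rw [map_smul_eq_mul, norm_pow, Complex.norm_real, Real.norm_eq_abs]
    _ ≤ ∑ k : Fin m, |q| ^ (k : ℕ) * (C * (M * ∏ i, ‖v i‖)) := by
        gcongr with k
        exact hx k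
    _ ≤ (1 - |q|)⁻¹ * (C * (M * ∏ i, ‖v i‖)) := by
        rw [← Finset.sum_mul]
        gcongr
        exact sum_abs_pow_le hq m
    _ = _ := by ring

lemma levelBound_create {p : Seminorm ℂ (AlgFock H)} {n : ℕ} {C : ℝ} (h : LevelBound p (n + 1) C)
    (ζ : H) : LevelBound (p.comp (create ζ)) n (C * ‖ζ‖) := by
  intro v
  rw [Seminorm.comp_apply, create_pureTensor]
  refine (h _).trans_eq ?_
  rw [Fin.prod_univ_succ]
  simp [mul_assoc]

lemma levelBound_annih {q : ℝ} (hq : |q| < 1) {p : Seminorm ℂ (AlgFock H)} {n : ℕ} {C : ℝ}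
    (hC : 0 ≤ C) (h : LevelBound p n C) (ζ : H) :
    LevelBound (p.comp (annih q (innerₛₗ ℂ ζ))) (n + 1) (C * (‖ζ‖ * (1 - |q|)⁻¹)) := by
  intro v
  rw [Seminorm.comp_apply, annih_pureTensor_succ]
  refine levelBound_sum hq hC (norm_nonneg ζ) v _ fun k => ?_
  rw [map_smul_eq_mul, Fin.prod_univ_succAbove _ k]
  calc ‖(innerₛₗ ℂ ζ) (v k)‖ * p (pureTensor (k.removeNth v : Fin n → H))
      ≤ (‖ζ‖ * ‖v k‖) * (C * ∏ i, ‖v (k.succAbove i)‖) := by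
        gcongr
        · exact norm_inner_le_norm _ _
        · exact h _
    _ = _ := by ring

lemma levelBound_gauge {q : ℝ} (hq : |q| < 1) {p : Seminorm ℂ (AlgFock H)} {n : ℕ} {C : ℝ}
    (hC : 0 ≤ C) (h : LevelBound p n C) {T : H →ₗ[ℂ] H} {M : ℝ} (hM : 0 ≤ M)
    (hT : ∀ u, ‖T u‖ ≤ M * ‖u‖) :
    LevelBound (p.comp (gauge q T)) n (C * (M * (1 - |q|)⁻¹)) := by
  intro v
  rw [Seminorm.comp_apply]
  cases n with
  | zero =>
    rw [gauge_pureTensor_zero, map_zero]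
    have : 0 ≤ (1 - |q|)⁻¹ := inv_nonneg.2 (sub_nonneg.2 hq.le)
    positivity
  | succ n =>
    rw [gauge_pureTensor_succ]
    refine levelBound_sum hq hC hM v _ fun k => ?_
    rw [Fin.prod_univ_succAbove _ k]
    refine (h _).trans ?_
    rw [Fin.prod_univ_succ]
    simp only [Fin.cons_zero, Fin.cons_succ, Fin.removeNth]
    refine mul_le_mul_of_nonneg_left ?_ hC
    rw [← mul_assoc]
    gcongr
    exact hT _

lemma le_of_log_convex {s : ℕ → ℝ} (h0 : ∀ n, 0 ≤ s n) (hs : ∀ n, s (n + 1) ^ 2 ≤ s n * s (n + 2))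
    {C M : ℝ} (hM : 0 < M) (hC : ∀ n, s n ≤ C * M ^ n) : s 1 ≤ M * s 0 := by
  by_contra! hlt
  rcases (h0 0).eq_or_lt with h | h
  · have := hs 0
    rw [← h, zero_mul] at this
    rw [← h, mul_zero] at hlt
    simp only [zero_add] at this
    nlinarith
  · set r := s 1 / s 0 with hr
    have hrM : M < r := by rw [hr, lt_div_iff₀ h]; exact hlt
    have hr0 : 0 < r := hM.trans hrM
    have key : ∀ n, 0 < s n ∧ r * s n ≤ s (n + 1) := by
      intro n
      induction n with
      | zero => exact ⟨h, by rw [hr, div_mul_cancel₀ _ h.ne']⟩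
      | succ n ih =>
        obtain ⟨h1, h2⟩ := ih
        have h3 : 0 < s (n + 1) := lt_of_lt_of_le (by positivity) h2
        refine ⟨h3, ?_⟩
        have h4 := hs n
        have h5 : s n * (r * s (n + 1)) ≤ s n * s (n + 2) := by nlinarith
        exact le_of_mul_le_mul_left h5 h1
    have key2 : ∀ n, r ^ n * s 0 ≤ s n := by
      intro n
      induction n with
      | zero => simp
      | succ n ih =>
        calc r ^ (n + 1) * s 0 = r * (r ^ n * s 0) := by ring
          _ ≤ r * s n := by gcongr
          _ ≤ _ := (key n).2
    obtain ⟨n, hn⟩ := pow_unbounded_of_one_lt (C / s 0) ((one_lt_div hM).2 hrM)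
    rw [div_pow, div_lt_div_iff₀ h (by positivity)] at hn
    exact absurd ((key2 n).trans (hC n)) (not_le.2 hn)

variable {q : Set.Ioo (-1 : ℝ) 1}

/-- The `q`-norm as a seminorm on the algebraic Fock space. -/
def qSeminorm (q : Set.Ioo (-1 : ℝ) 1) (H : Type*) [NormedAddCommGroup H]
    [InnerProductSpace ℂ H] : Seminorm ℂ (AlgFock H) :=
  (normSeminorm ℂ (QFock q H)).comp (toFock q)

lemma qSeminorm_apply (x : AlgFock H) : qSeminorm q H x = ‖toFock q x‖ := rfl

lemma levelBound_qSeminorm (n : ℕ) : ∃ C, 0 ≤ C ∧ LevelBound (qSeminorm q H) n C := by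
  refine ⟨√(Fintype.card (Equiv.Perm (Fin n))), Real.sqrt_nonneg _, fun v => ?_⟩
  rw [qSeminorm_apply]
  refine le_of_sq_le_sq ?_ (by positivity)
  rw [mul_pow, Real.sq_sqrt (Nat.cast_nonneg _)]
  have h : (‖toFock q (pureTensor v)‖ : ℝ) ^ 2 = ‖pairing q v v‖ := by
    rw [← qInner_pureTensor, ← inner_toFock, inner_self_eq_norm_sq_to_K]
    simp
  rw [h, pairing]
  refine (norm_sum_le _ _).trans ?_
  rw [← nsmul_eq_mul, ← Finset.card_univ]
  refine Finset.sum_le_card_nsmul _ _ _ fun σ _ => ?_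
  rw [norm_mul, norm_pow, Complex.norm_real, Real.norm_eq_abs, norm_prod]
  calc |(q : ℝ)| ^ inversions σ * ∏ i, ‖⟪v i, v (σ i)⟫_ℂ‖
      ≤ 1 * ∏ i, (‖v i‖ * ‖v (σ i)‖) := by
        gcongr with i
        · exact pow_le_one₀ (abs_nonneg _) (abs_lt_one q).le
        · exact norm_inner_le_norm _ _
    _ = _ := by
        rw [one_mul, Finset.prod_mul_distrib, Equiv.prod_comp σ fun i => ‖v i‖, sq]

/-- A symmetric operator whose iterates grow geometrically is bounded. -/
lemma isQBounded_of_symmetric {B : AlgFock H →ₗ[ℂ] AlgFock H}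
    (hB : ∀ x y, qInner q (B y) x = qInner q y (B x)) {M : ℝ} (hM : 0 < M)
    (hgrow : ∀ (p : Seminorm ℂ (AlgFock H)) (n : ℕ) (C : ℝ), 0 ≤ C → LevelBound p n C →
      LevelBound (p.comp B) n (C * M)) (x : AlgFock H) :
    ‖toFock q (B x)‖ ≤ M * ‖toFock q x‖ := by
  have hpow : ∀ (N n : ℕ) (C : ℝ), 0 ≤ C → ∀ p : Seminorm ℂ (AlgFock H), LevelBound p n C →
      LevelBound (p.comp (B ^ N)) n (C * M ^ N) := by
    intro N
    induction N with
    | zero => intro n C _ p hp v; simpa using hp v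
    | succ N ih =>
      intro n C hC p hp v
      have := hgrow _ n _ (by positivity) (ih n C hC p hp) v
      rw [Seminorm.comp_apply, Seminorm.comp_apply] at this
      rw [Seminorm.comp_apply, pow_succ, pow_succ, ← mul_assoc]
      exact this
  have hC : ∃ C, ∀ N, ‖toFock q ((B ^ N) x)‖ ≤ C * M ^ N := by
    induction x using algFock_induction with
    | h0 => exact ⟨0, by simp⟩
    | hadd x y hx hy =>
      obtain ⟨C, hC⟩ := hx
      obtain ⟨D, hD⟩ := hy
      refine ⟨C + D, fun N => ?_⟩
      rw [map_add, map_add, add_mul]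
      exact (norm_add_le _ _).trans (add_le_add (hC N) (hD N))
    | h c n v =>
      obtain ⟨C, hC0, hC⟩ := levelBound_qSeminorm (q := q) (H := H) n
      refine ⟨‖c‖ * (C * ∏ i, ‖v i‖), fun N => ?_⟩
      rw [map_smul, map_smul, norm_smul, mul_assoc]
      gcongr
      refine (hpow N n C hC0 _ hC v).trans_eq ?_
      ring
  obtain ⟨C, hC⟩ := hC
  have := le_of_log_convex (s := fun N => ‖toFock q ((B ^ N) x)‖) (fun _ => norm_nonneg _)
    (fun N => ?_) hM hC
  · simpa using this
  · have h1 : ⟪toFock q ((B ^ (N + 1)) x), toFock q ((B ^ (N + 1)) x)⟫_ℂ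
        = ⟪toFock q ((B ^ N) x), toFock q ((B ^ (N + 2)) x)⟫_ℂ := by
      rw [inner_toFock, inner_toFock, pow_succ' B (N + 1), pow_succ' B N]
      exact (hB _ _).symm
    have h2 := norm_inner_le_norm (𝕜 := ℂ) (toFock q ((B ^ N) x)) (toFock q ((B ^ (N + 2)) x))
    rw [← h1, inner_self_eq_norm_sq_to_K] at h2
    simpa using h2

lemma norm_sq_toFock_le {L B : AlgFock H →ₗ[ℂ] AlgFock H} {M : ℝ}
    (hL : ∀ x, qInner q (L x) (L x) = qInner q (B x) x)
    (hB : ∀ x, ‖toFock q (B x)‖ ≤ M * ‖toFock q x‖) : IsQBounded q L := by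
  refine ⟨√|M|, fun x => le_of_sq_le_sq ?_ (by positivity)⟩
  have h : ‖toFock q (L x)‖ ^ 2 = ‖⟪toFock q x, toFock q (B x)⟫_ℂ‖ := by
    rw [inner_toFock, ← hL, ← inner_toFock, inner_self_eq_norm_sq_to_K]
    simp
  rw [h, mul_pow, Real.sq_sqrt (abs_nonneg _)]
  calc _ ≤ ‖toFock q x‖ * ‖toFock q (B x)‖ := norm_inner_le_norm _ _
    _ ≤ ‖toFock q x‖ * (|M| * ‖toFock q x‖) := by
        gcongr
        exact (hB x).trans (by gcongr; exact le_abs_self M)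
    _ = _ := by ring

lemma isQBounded_create (ζ : H) : IsQBounded q (create ζ) := by
  have hq := abs_lt_one q
  have hpos : 0 < (1 - |(q : ℝ)|)⁻¹ := inv_pos.2 (sub_pos.2 hq)
  refine norm_sq_toFock_le (B := annih q (innerₛₗ ℂ ζ) ∘ₗ create ζ)
    (fun x => qInner_create _ _ _ _) (isQBounded_of_symmetric (M := ‖ζ‖ * (1 - |(q : ℝ)|)⁻¹ * ‖ζ‖ + 1)
      (fun x y => ?_) (by positivity) fun p n C hC h v => ?_)
  · rw [LinearMap.comp_apply, LinearMap.comp_apply, ← qInner_create,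
      ← qInner_conj q (annih q (innerₛₗ ℂ ζ) (create ζ x)) y, ← qInner_create, qInner_conj]
  · have h1 := levelBound_create (levelBound_annih hq hC h ζ) ζ v
    refine h1.trans ?_
    have : 0 ≤ ∏ i, ‖v i‖ := by positivity
    have : 0 ≤ C * ∏ i, ‖v i‖ := by positivity
    linarith

lemma isQBounded_annih (ζ : H) : IsQBounded q (annih q (innerₛₗ ℂ ζ)) := by
  obtain ⟨C, hC⟩ := isQBounded_create (q := q) ζ
  refine ⟨C, fun y => ?_⟩
  set a := toFock q (annih q (innerₛₗ ℂ ζ) y) with ha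
  have h : ‖a‖ ^ 2 = ‖⟪toFock q (create ζ (annih q (innerₛₗ ℂ ζ) y)), toFock q y⟫_ℂ‖ := by
    rw [inner_toFock, qInner_create, ← inner_toFock, inner_self_eq_norm_sq_to_K]
    simp [ha]
  have h1 : ‖a‖ * ‖a‖ ≤ ‖a‖ * (C * ‖toFock q y‖) := by
    rw [← sq, h]
    calc _ ≤ ‖toFock q (create ζ (annih q (innerₛₗ ℂ ζ) y))‖ * ‖toFock q y‖ :=
          norm_inner_le_norm _ _
      _ ≤ C * ‖a‖ * ‖toFock q y‖ := by gcongr; exact hC _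
      _ = _ := by ring
  rcases (norm_nonneg a).eq_or_lt with h0 | h0
  · rw [← h0]
    by_contra! hneg
    have := hC y
    have h3 : 0 ≤ ‖toFock q y‖ := norm_nonneg _
    have h4 := (norm_nonneg _).trans (hC y)
    linarith
  · exact le_of_mul_le_mul_left h1 h0

lemma isQBounded_gauge [CompleteSpace H] (T : H →L[ℂ] H) : IsQBounded q (gauge q T.toLinearMap) := by
  have hq := abs_lt_one q
  have hpos : 0 < (1 - |(q : ℝ)|)⁻¹ := inv_pos.2 (sub_pos.2 hq)
  set T' := ContinuousLinearMap.adjoint T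
  have hT : ∀ u v, ⟪T'.toLinearMap u, v⟫_ℂ = ⟪u, T.toLinearMap v⟫_ℂ :=
    fun u v => ContinuousLinearMap.adjoint_inner_left _ _ _
  have hT' : ∀ u v, ⟪T.toLinearMap u, v⟫_ℂ = ⟪u, T'.toLinearMap v⟫_ℂ :=
    fun u v => (ContinuousLinearMap.adjoint_inner_right _ _ _).symm
  refine norm_sq_toFock_le (B := gauge q T'.toLinearMap ∘ₗ gauge q T.toLinearMap)
    (fun x => (qInner_gauge q hT' _ _).symm) (isQBounded_of_symmetric
      (M := ‖T'‖ * (1 - |(q : ℝ)|)⁻¹ * (‖T‖ * (1 - |(q : ℝ)|)⁻¹) + 1)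
      (fun x y => ?_) (by positivity) fun p n C hC h v => ?_)
  · rw [LinearMap.comp_apply, LinearMap.comp_apply, qInner_gauge q hT', qInner_gauge q hT]
  · have h1 := levelBound_gauge hq (by positivity) (levelBound_gauge hq hC h (norm_nonneg T')
      T'.le_opNorm) (norm_nonneg T) T.le_opNorm v
    refine h1.trans ?_
    have : 0 ≤ ∏ i, ‖v i‖ := by positivity
    have : 0 ≤ C * ∏ i, ‖v i‖ := by positivity
    linarith

end Bounded

/-! ### Creation, annihilation and gauge operators on the `q`-Fock space -/

section Operators

variable {H : Type*} [NormedAddCommGroup H] [InnerProductSpace ℂ H]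
  (q : Set.Ioo (-1 : ℝ) 1)

/-- The creation operator `a*(ζ)` on the `q`-Fock space. -/
def creation (ζ : H) : QFock q H →L[ℂ] QFock q H := extendOp q (create ζ)

/-- The annihilation operator `a(ζ)` on the `q`-Fock space. -/
def annihilation (ζ : H) : QFock q H →L[ℂ] QFock q H := extendOp q (annih q (innerₛₗ ℂ ζ))

/-- The gauge operator `p(T)` on the `q`-Fock space. -/
def gaugeOp (T : H →L[ℂ] H) : QFock q H →L[ℂ] QFock q H := extendOp q (gauge q T.toLinearMap)

lemma creation_toFock (ζ : H) (x : AlgFock H) :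
    creation q ζ (toFock q x) = toFock q (create ζ x) :=
  extendOp_toFock (isQBounded_create ζ) x

lemma annihilation_toFock (ζ : H) (x : AlgFock H) :
    annihilation q ζ (toFock q x) = toFock q (annih q (innerₛₗ ℂ ζ) x) :=
  extendOp_toFock (isQBounded_annih ζ) x

lemma gaugeOp_toFock [CompleteSpace H] (T : H →L[ℂ] H) (x : AlgFock H) :
    gaugeOp q T (toFock q x) = toFock q (gauge q T.toLinearMap x) :=
  extendOp_toFock (isQBounded_gauge T) x

lemma clm_ext_toFock {A B : QFock q H →L[ℂ] QFock q H}
    (h : ∀ x : AlgFock H, A (toFock q x) = B (toFock q x)) : A = B := by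
  apply DFunLike.coe_injective
  exact denseRange_toFock.equalizer A.continuous B.continuous (funext h)

/-! Linear dependence on the parameters. -/

variable {V : Type*} [AddCommGroup V] [Module ℂ V]

lemma createN_add (ζ ζ' : V) (n : ℕ) : createN (ζ + ζ') n = createN ζ n + createN ζ' n := by
  simp [createN]

lemma createN_smul (c : ℂ) (ζ : V) (n : ℕ) : createN (c • ζ) n = c • createN ζ n := by
  simp [createN]

lemma annihN_add (q : ℝ) (φ φ' : V →ₗ[ℂ] ℂ) (n : ℕ) :
    annihN q (φ + φ') n = annihN q φ n + annihN q φ' n := by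
  apply PiTensorProduct.ext
  ext v
  simp only [LinearMap.compMultilinearMap_apply, LinearMap.add_apply, annihN_tprod,
    ← Finset.sum_add_distrib, add_smul, smul_add]

lemma annihN_smul (q : ℝ) (c : ℂ) (φ : V →ₗ[ℂ] ℂ) (n : ℕ) :
    annihN q (c • φ) n = c • annihN q φ n := by
  apply PiTensorProduct.ext
  ext v
  simp only [LinearMap.compMultilinearMap_apply, LinearMap.smul_apply, annihN_tprod,
    Finset.smul_sum, smul_eq_mul, mul_smul, smul_comm c]

lemma gaugeN_add (q : ℝ) (T T' : V →ₗ[ℂ] V) (n : ℕ) :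
    gaugeN q (T + T') n = gaugeN q T n + gaugeN q T' n := by
  simp only [gaugeN, LinearMap.comp_add, ← Finset.sum_add_distrib, ← smul_add]
  refine Finset.sum_congr rfl fun k _ => ?_
  congr 1
  apply PiTensorProduct.ext
  ext v
  simp

lemma gaugeN_smul (q : ℝ) (c : ℂ) (T : V →ₗ[ℂ] V) (n : ℕ) :
    gaugeN q (c • T) n = c • gaugeN q T n := by
  simp only [gaugeN, LinearMap.comp_smul, Finset.smul_sum]
  refine Finset.sum_congr rfl fun k _ => ?_
  rw [smul_comm c]
  congr 1
  apply PiTensorProduct.ext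
  ext v
  simp

lemma create_add (ζ ζ' : V) : create (ζ + ζ') = create ζ + create ζ' :=
  DirectSum.linearMap_ext ℂ fun n => LinearMap.ext fun x => by
    simp only [LinearMap.comp_apply, LinearMap.add_apply, create_lof, createN_add, map_add]

lemma create_smul (c : ℂ) (ζ : V) : create (c • ζ) = c • create ζ :=
  DirectSum.linearMap_ext ℂ fun n => LinearMap.ext fun x => by
    simp only [LinearMap.comp_apply, LinearMap.smul_apply, create_lof, createN_smul, map_smul]

lemma annih_add (q : ℝ) (φ φ' : V →ₗ[ℂ] ℂ) : annih q (φ + φ') = annih q φ + annih q φ' :=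
  DirectSum.linearMap_ext ℂ fun n => LinearMap.ext fun x => by
    cases n <;> simp only [LinearMap.comp_apply, LinearMap.add_apply, annih_lof_zero,
      annih_lof_succ, annihN_add, map_add, add_zero]

lemma annih_smul (q : ℝ) (c : ℂ) (φ : V →ₗ[ℂ] ℂ) : annih q (c • φ) = c • annih q φ :=
  DirectSum.linearMap_ext ℂ fun n => LinearMap.ext fun x => by
    cases n <;> simp only [LinearMap.comp_apply, LinearMap.smul_apply, annih_lof_zero,
      annih_lof_succ, annihN_smul, map_smul, smul_zero]

lemma gauge_add (q : ℝ) (T T' : V →ₗ[ℂ] V) : gauge q (T + T') = gauge q T + gauge q T' :=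
  DirectSum.linearMap_ext ℂ fun n => LinearMap.ext fun x => by
    cases n <;> simp only [LinearMap.comp_apply, LinearMap.add_apply, gauge_lof_zero,
      gauge_lof_succ, gaugeN_add, map_add, add_zero]

lemma gauge_smul (q : ℝ) (c : ℂ) (T : V →ₗ[ℂ] V) : gauge q (c • T) = c • gauge q T :=
  DirectSum.linearMap_ext ℂ fun n => LinearMap.ext fun x => by
    cases n <;> simp only [LinearMap.comp_apply, LinearMap.smul_apply, gauge_lof_zero,
      gauge_lof_succ, gaugeN_smul, map_smul, smul_zero]

lemma creation_add (ζ ζ' : H) : creation q (ζ + ζ') = creation q ζ + creation q ζ' :=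
  clm_ext_toFock q fun x => by
    rw [add_apply, creation_toFock, creation_toFock, creation_toFock,
      create_add, LinearMap.add_apply, map_add]

lemma creation_smul (c : ℂ) (ζ : H) : creation q (c • ζ) = c • creation q ζ :=
  clm_ext_toFock q fun x => by
    rw [smul_apply, creation_toFock, creation_toFock,
      create_smul, LinearMap.smul_apply, map_smul]

lemma annihilation_add (ζ ζ' : H) :
    annihilation q (ζ + ζ') = annihilation q ζ + annihilation q ζ' :=
  clm_ext_toFock q fun x => by
    rw [add_apply, annihilation_toFock, annihilation_toFock,
      annihilation_toFock, map_add, annih_add, LinearMap.add_apply, map_add]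

lemma annihilation_smul (c : ℂ) (ζ : H) :
    annihilation q (c • ζ) = (starRingEnd ℂ) c • annihilation q ζ :=
  clm_ext_toFock q fun x => by
    rw [smul_apply, annihilation_toFock, annihilation_toFock,
      LinearMap.map_smulₛₗ, annih_smul, LinearMap.smul_apply, map_smul]

lemma gaugeOp_add [CompleteSpace H] (T T' : H →L[ℂ] H) :
    gaugeOp q (T + T') = gaugeOp q T + gaugeOp q T' :=
  clm_ext_toFock q fun x => by
    rw [add_apply, gaugeOp_toFock, gaugeOp_toFock, gaugeOp_toFock,
      ContinuousLinearMap.toLinearMap_add, gauge_add, LinearMap.add_apply, map_add]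

lemma gaugeOp_smul [CompleteSpace H] (c : ℂ) (T : H →L[ℂ] H) :
    gaugeOp q (c • T) = c • gaugeOp q T :=
  clm_ext_toFock q fun x => by
    rw [smul_apply, gaugeOp_toFock, gaugeOp_toFock,
      ContinuousLinearMap.toLinearMap_smul, gauge_smul, LinearMap.smul_apply, map_smul]

end Operators

/-! ### The Wick map -/

section LiftStep

variable {V W : Type*} [AddCommGroup V] [Module ℂ V] [AddCommGroup W] [Module ℂ W]

/-- The linear map `d ⊗ w ↦ K d w` on `V^{⊗(n+1)}`, for `d ∈ V` and `w ∈ V^{⊗n}`. -/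
def liftStep {n : ℕ} (K : V →ₗ[ℂ] (⨂[ℂ]^n V) →ₗ[ℂ] W) : (⨂[ℂ]^(n + 1) V) →ₗ[ℂ] W :=
  PiTensorProduct.lift (LinearMap.uncurryLeft (M := fun _ : Fin (n + 1) => V)
    ((PiTensorProduct.lift (R := ℂ) (s := fun _ : Fin n => V) (E := W)).symm.toLinearMap ∘ₗ K))

lemma liftStep_createN {n : ℕ} (K : V →ₗ[ℂ] (⨂[ℂ]^n V) →ₗ[ℂ] W) (d : V) (w : ⨂[ℂ]^n V) :
    liftStep K (createN d n w) = K d w := by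
  induction w using PiTensorProduct.induction_on with
  | smul_tprod c v => rw [map_smul, map_smul, map_smul, createN_tprod]; simp [liftStep]
  | add x y hx hy => simp only [map_add, hx, hy]

variable {A : Type*} [Ring A] [Algebra ℂ A]

/-- One step of the Wick recursion, from `W` on `V^{⊗n}` and `V^{⊗(n+1)}`, as a linear function of
`d ∈ V`: `w ↦ X(d) W(w) - W(a(d) w) - W(p(T_d) w)` on `V^{⊗(n+1)}`. -/
def wickStep (q : ℝ) (X : V →ₗ[ℂ] A) (β : V →ₗ[ℂ] V →ₗ[ℂ] ℂ) (T : V →ₗ[ℂ] V →ₗ[ℂ] V) (n : ℕ)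
    (W₀ : (⨂[ℂ]^n V) →ₗ[ℂ] A) (W₁ : (⨂[ℂ]^(n + 1) V) →ₗ[ℂ] A) :
    V →ₗ[ℂ] (⨂[ℂ]^(n + 1) V) →ₗ[ℂ] A where
  toFun d := LinearMap.mulLeft ℂ (X d) ∘ₗ W₁ - W₀ ∘ₗ annihN q (β d) n - W₁ ∘ₗ gaugeN q (T d) n
  map_add' d d' := by
    refine LinearMap.ext fun w => ?_
    simp only [map_add, annihN_add, gaugeN_add, LinearMap.sub_apply, LinearMap.add_apply,
      LinearMap.comp_apply, LinearMap.mulLeft_apply, add_mul]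
    abel
  map_smul' c d := by
    refine LinearMap.ext fun w => ?_
    simp only [map_smul, annihN_smul, gaugeN_smul, LinearMap.sub_apply, LinearMap.smul_apply,
      LinearMap.comp_apply, LinearMap.mulLeft_apply, smul_mul_assoc, smul_sub, RingHom.id_apply]

/-- The Wick map on `V^{⊗n}`: `W(Ω) = 1`, `W(d) = X(d)` and
`W(d ⊗ w) = X(d) W(w) - W(a(d) w) - W(p(T_d) w)`, where `a(d)` contracts with `β(d, ·)`. -/
def wickN (q : ℝ) (X : V →ₗ[ℂ] A) (β : V →ₗ[ℂ] V →ₗ[ℂ] ℂ) (T : V →ₗ[ℂ] V →ₗ[ℂ] V) :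
    (n : ℕ) → (⨂[ℂ]^n V) →ₗ[ℂ] A
  | 0 => PiTensorProduct.lift (MultilinearMap.constOfIsEmpty ℂ _ 1)
  | 1 => X ∘ₗ (PiTensorProduct.subsingletonEquiv (0 : Fin 1)).toLinearMap
  | n + 2 => liftStep (wickStep q X β T n (wickN q X β T n) (wickN q X β T (n + 1)))

/-- The Wick map on the algebraic Fock space. -/
def wickMap (q : ℝ) (X : V →ₗ[ℂ] A) (β : V →ₗ[ℂ] V →ₗ[ℂ] ℂ) (T : V →ₗ[ℂ] V →ₗ[ℂ] V) :
    AlgFock V →ₗ[ℂ] A :=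
  DirectSum.toModule ℂ ℕ _ (wickN q X β T)

section WickLemmas

variable (q : ℝ) (X : V →ₗ[ℂ] A) (β : V →ₗ[ℂ] V →ₗ[ℂ] ℂ) (T : V →ₗ[ℂ] V →ₗ[ℂ] V)

lemma wickMap_lof (n : ℕ) (x : ⨂[ℂ]^n V) :
    wickMap q X β T (DirectSum.lof ℂ ℕ (fun n => ⨂[ℂ]^n V) n x) = wickN q X β T n x := by
  rw [wickMap, DirectSum.toModule_lof]

lemma wickMap_vac : wickMap q X β T (vac V) = 1 := by
  rw [vac, pureTensor, wickMap_lof]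
  simp [wickN]

lemma wickMap_create (d : V) (w : AlgFock V) :
    wickMap q X β T (create d w) = X d * wickMap q X β T w - wickMap q X β T (annih q (β d) w) -
      wickMap q X β T (gauge q (T d) w) := by
  refine DirectSum.induction_on w (by simp) ?_
    fun x y hx hy => by simp only [map_add, hx, hy, mul_add]; abel
  intro n x
  change wickMap q X β T (create d (DirectSum.lof ℂ ℕ (fun n => ⨂[ℂ]^n V) n x)) =
    X d * wickMap q X β T (DirectSum.lof ℂ ℕ (fun n => ⨂[ℂ]^n V) n x) -
    wickMap q X β T (annih q (β d) (DirectSum.lof ℂ ℕ (fun n => ⨂[ℂ]^n V) n x)) -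
    wickMap q X β T (gauge q (T d) (DirectSum.lof ℂ ℕ (fun n => ⨂[ℂ]^n V) n x))
  cases n with
  | zero =>
    rw [create_lof, annih_lof_zero, gauge_lof_zero, map_zero, sub_zero, sub_zero, wickMap_lof,
      wickMap_lof]
    induction x using PiTensorProduct.induction_on with
    | smul_tprod c v =>
      rw [map_smul, map_smul, map_smul, mul_smul_comm, createN_tprod]
      simp [wickN]
    | add x y hx hy => simp only [map_add, hx, hy, mul_add]
  | succ n =>
    rw [create_lof, annih_lof_succ, gauge_lof_succ, wickMap_lof, wickMap_lof, wickMap_lof,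
      wickMap_lof, wickN, liftStep_createN]
    rfl

end WickLemmas

end LiftStep

/-! ### The one-particle space and the `q`-Lévy process of a compactly supported measure -/

open MeasureTheory

open scoped NNReal ENNReal

/-- The measure `ν` has compact support. -/
class HasCompactSupp (ν : Measure ℝ) : Prop where
  exists_compact : ∃ K : Set ℝ, IsCompact K ∧ ν Kᶜ = 0

/-- The measure `dt ⊗ ν` on `ℝ₊ × ℝ` (as a measure on `ℝ × ℝ` carried by `ℝ₊ × ℝ`). -/
def timeJump (ν : Measure ℝ) : Measure (ℝ × ℝ) :=
  (volume.restrict (Set.Ici (0 : ℝ))).prod ν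

/-- The one-particle space `ℋ = L²(ℝ₊ × ℝ, dt ⊗ ν) = L²(ℝ₊, dt) ⊗ L²(ℝ, ν)`. -/
abbrev OneParticle (ν : Measure ℝ) : Type := Lp ℂ 2 (timeJump ν)

/-- The function `χ_{[a, b)} ⊗ x^k`. -/
def stepMono (a b : ℝ) (k : ℕ) (z : ℝ × ℝ) : ℂ :=
  (Set.Ico a b).indicator 1 z.1 * (z.2 : ℂ) ^ k

section Conj

variable {ν : Measure ℝ}

lemma star_add_lp (f g : OneParticle ν) : star (f + g) = star f + star g := by
  apply Lp.ext
  filter_upwards [Lp.coeFn_star (f + g), Lp.coeFn_add f g, Lp.coeFn_add (star f) (star g),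
    Lp.coeFn_star f, Lp.coeFn_star g] with z h1 h2 h3 h4 h5
  rw [h1, h3, Pi.star_apply, h2, Pi.add_apply, Pi.add_apply, h4, h5, star_add]; rfl

lemma star_smul_lp (c : ℂ) (f : OneParticle ν) :
    star (c • f) = (starRingEnd ℂ) c • star f := by
  apply Lp.ext
  filter_upwards [Lp.coeFn_star (c • f), Lp.coeFn_smul c f,
    Lp.coeFn_smul ((starRingEnd ℂ) c) (star f), Lp.coeFn_star f] with z h1 h2 h3 h4
  rw [h1, h3, Pi.star_apply, h2, Pi.smul_apply, Pi.smul_apply, h4, star_smul]; rfl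

end Conj

section Model

variable (ν : Measure ℝ) [HasCompactSupp ν]

lemma stepMono_measurable (a b : ℝ) (k : ℕ) : Measurable (stepMono a b k) := by
  unfold stepMono
  refine Measurable.mul ?_ (by fun_prop)
  exact (measurable_one.indicator measurableSet_Ico).comp measurable_fst

lemma exists_ae_bound : ∃ R : ℝ, 0 ≤ R ∧ ∀ᵐ z ∂(timeJump ν), ‖(z.2 : ℂ)‖ ≤ R := by
  obtain ⟨K, hK, hν⟩ := HasCompactSupp.exists_compact (ν := ν)
  obtain ⟨R, hR⟩ := hK.isBounded.exists_norm_le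
  refine ⟨max R 0, le_max_right _ _, ?_⟩
  have h : ∀ᵐ x ∂ν, ‖((x : ℝ) : ℂ)‖ ≤ max R 0 := by
    filter_upwards [measure_eq_zero_iff_ae_notMem.1 hν] with x hx
    rw [Complex.norm_real]
    exact (hR x (by simpa using hx)).trans (le_max_left _ _)
  exact Measure.quasiMeasurePreserving_snd.ae h

lemma memLp_snd : MemLp (fun z : ℝ × ℝ => (z.2 : ℂ)) ∞ (timeJump ν) := by
  obtain ⟨R, -, hR⟩ := exists_ae_bound ν
  exact memLp_top_of_bound (by fun_prop) R hR

lemma stepMono_bound (a b : ℝ) (k : ℕ) :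
    ∃ R : ℝ, ∀ᵐ z ∂(timeJump ν), ‖stepMono a b k z‖ ≤ R := by
  obtain ⟨R, hR0, hR⟩ := exists_ae_bound ν
  refine ⟨R ^ k, ?_⟩
  filter_upwards [hR] with z hz
  rw [stepMono, norm_mul, norm_pow]
  have : ‖(Set.Ico a b).indicator (1 : ℝ → ℂ) z.1‖ ≤ 1 := by
    by_cases h : z.1 ∈ Set.Ico a b <;> simp [h]
  calc _ ≤ 1 * R ^ k := by gcongr
    _ = _ := one_mul _

lemma memLp_top_stepMono (a b : ℝ) (k : ℕ) : MemLp (stepMono a b k) ∞ (timeJump ν) := by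
  obtain ⟨R, hR⟩ := stepMono_bound ν a b k
  exact memLp_top_of_bound (stepMono_measurable a b k).aestronglyMeasurable R hR

variable [IsProbabilityMeasure ν]

lemma memLp_two_stepMono (a b : ℝ) (k : ℕ) : MemLp (stepMono a b k) 2 (timeJump ν) := by
  have hs : MeasurableSet (Set.Ico a b ×ˢ (Set.univ : Set ℝ)) := measurableSet_Ico.prod .univ
  have h : stepMono a b k = (Set.Ico a b ×ˢ (Set.univ : Set ℝ)).indicator (stepMono a b k) := by
    ext z
    by_cases hz : z.1 ∈ Set.Ico a b
    · rw [Set.indicator_of_mem]; exact ⟨hz, trivial⟩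
    · rw [Set.indicator_of_notMem (by simpa using hz)]
      simp [stepMono, hz]
  rw [h, memLp_indicator_iff_restrict hs]
  have : IsFiniteMeasure ((timeJump ν).restrict (Set.Ico a b ×ˢ (Set.univ : Set ℝ))) := by
    refine ⟨?_⟩
    rw [Measure.restrict_apply_univ, timeJump, Measure.prod_prod, measure_univ, mul_one]
    exact (Measure.restrict_apply_le _ _).trans_lt measure_Ico_lt_top
  obtain ⟨R, hR⟩ := stepMono_bound ν a b k
  exact MemLp.of_bound (stepMono_measurable a b k).aestronglyMeasurable R
    (ae_restrict_of_ae hR)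

/-- The vector `χ_{[a, b)} ⊗ x^k` of the one-particle space. -/
def stepVec (a b : ℝ) (k : ℕ) : OneParticle ν := (memLp_two_stepMono ν a b k).toLp _

/-- The dense subspace `𝒟`, spanned by the vectors `χ_{[a, b)} ⊗ x^k`, `0 ≤ a ≤ b`, `k ≥ 0`. -/
def stepSpace : Submodule ℂ (OneParticle ν) :=
  Submodule.span ℂ {d | ∃ (a b : ℝ) (k : ℕ), 0 ≤ a ∧ a ≤ b ∧ d = stepVec ν a b k}

variable {ν}

lemma stepVec_mem {a b : ℝ} (ha : 0 ≤ a) (hb : a ≤ b) (k : ℕ) : stepVec ν a b k ∈ stepSpace ν :=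
  Submodule.subset_span ⟨a, b, k, ha, hb, rfl⟩

lemma memLp_top_of_mem {d : OneParticle ν} (hd : d ∈ stepSpace ν) :
    MemLp d ∞ (timeJump ν) := by
  induction hd using Submodule.span_induction with
  | mem d h =>
    obtain ⟨a, b, k, -, -, rfl⟩ := h
    exact (memLp_top_stepMono ν a b k).ae_eq (MemLp.coeFn_toLp _).symm
  | zero => exact (MemLp.zero (ε := ℂ)).ae_eq (Lp.coeFn_zero ℂ 2 (timeJump ν)).symm
  | add x y _ _ hx hy => exact (hx.add hy).ae_eq (Lp.coeFn_add x y).symm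
  | smul c x _ hx => exact (hx.const_smul c).ae_eq (Lp.coeFn_smul c x).symm

/-- For `d ∈ 𝒟`, the essentially bounded function `(t, x) ↦ x d(t, x)`. -/
def multiplier (d : stepSpace ν) : Lp ℂ ∞ (timeJump ν) :=
  ((memLp_top_of_mem d.2).mul (memLp_snd ν) :
    MemLp (fun z : ℝ × ℝ => (z.2 : ℂ) * (d : OneParticle ν) z) ∞ (timeJump ν)).toLp _

/-- For `d ∈ 𝒟`, the operator `T_d` of multiplication by `x d(t, x)` on the one-particle space. -/
def multOp (d : stepSpace ν) : OneParticle ν →L[ℂ] OneParticle ν :=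
  (ContinuousLinearMap.mul ℂ ℂ).holderL (timeJump ν) ∞ 2 2 (multiplier d)

lemma multOp_coeFn (d : stepSpace ν) (f : OneParticle ν) :
    multOp d f =ᵐ[timeJump ν] fun z => (z.2 : ℂ) * (d : OneParticle ν) z * f z := by
  have h1 := ContinuousLinearMap.coeFn_holder (r := 2) (ContinuousLinearMap.mul ℂ ℂ)
    (multiplier d) f
  have h2 := MemLp.coeFn_toLp ((memLp_top_of_mem d.2).mul (memLp_snd ν) :
    MemLp (fun z : ℝ × ℝ => (z.2 : ℂ) * (d : OneParticle ν) z) ∞ (timeJump ν))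
  filter_upwards [h1, h2] with z h1 h2
  change ContinuousLinearMap.holder 2 (ContinuousLinearMap.mul ℂ ℂ) (multiplier d) f z = _
  rw [h1, ContinuousLinearMap.mul_apply']
  congr 1

lemma multOp_add (d d' : stepSpace ν) : multOp (d + d') = multOp d + multOp d' := by
  ext1 f
  apply Lp.ext
  rw [add_apply]
  filter_upwards [multOp_coeFn (d + d') f, multOp_coeFn d f, multOp_coeFn d' f,
    Lp.coeFn_add (multOp d f) (multOp d' f), Lp.coeFn_add (d : OneParticle ν) d']
    with z h1 h2 h3 h4 h5
  rw [h1, h4, Pi.add_apply, h2, h3, Submodule.coe_add, h5, Pi.add_apply]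
  ring

lemma multOp_smul (c : ℂ) (d : stepSpace ν) : multOp (c • d) = c • multOp d := by
  ext1 f
  apply Lp.ext
  rw [smul_apply]
  filter_upwards [multOp_coeFn (c • d) f, multOp_coeFn d f,
    Lp.coeFn_smul c (multOp d f), Lp.coeFn_smul c (d : OneParticle ν)]
    with z h1 h2 h4 h5
  rw [h1, h4, Pi.smul_apply, h2, Submodule.coe_smul, h5, Pi.smul_apply, smul_eq_mul, smul_eq_mul]
  ring

lemma multOp_stepVec {a b a' b' : ℝ} (ha : 0 ≤ a) (hb : a ≤ b) (k l : ℕ) :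
    multOp ⟨stepVec ν a b k, stepVec_mem ha hb k⟩ (stepVec ν a' b' l) =
      stepVec ν (max a a') (max (max a a') (min b b')) (k + l + 1) := by
  apply Lp.ext
  filter_upwards [multOp_coeFn ⟨stepVec ν a b k, stepVec_mem ha hb k⟩ (stepVec ν a' b' l),
    MemLp.coeFn_toLp (memLp_two_stepMono ν a b k), MemLp.coeFn_toLp (memLp_two_stepMono ν a' b' l),
    MemLp.coeFn_toLp (memLp_two_stepMono ν (max a a') (max (max a a') (min b b')) (k + l + 1))]
    with z h1 h2 h3 h4
  rw [h1]
  refine Eq.trans ?_ h4.symm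
  rw [show stepVec ν a b k z = _ from h2, show stepVec ν a' b' l z = _ from h3]
  simp only [stepMono, Set.indicator_apply, Set.mem_Ico, Pi.one_apply, max_le_iff,
    lt_max_iff, lt_min_iff]
  split_ifs <;> first | (exfalso; grind) | ring

lemma multOp_mem (d : stepSpace ν) {f : OneParticle ν} (hf : f ∈ stepSpace ν) :
    multOp d f ∈ stepSpace ν := by
  obtain ⟨d, hd⟩ := d
  induction hd using Submodule.span_induction with
  | mem d h =>
    obtain ⟨a, b, k, ha, hb, rfl⟩ := h
    induction hf using Submodule.span_induction with
    | mem f h =>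
      obtain ⟨a', b', l, ha', hb', rfl⟩ := h
      rw [multOp_stepVec ha hb]
      exact stepVec_mem (ha.trans (le_max_left _ _)) (le_max_left _ _) _
    | zero => rw [map_zero]; exact zero_mem _
    | add x y _ _ hx hy => rw [map_add]; exact add_mem hx hy
    | smul c x _ hx => rw [map_smul]; exact Submodule.smul_mem _ c hx
  | zero =>
    have := multOp_smul (ν := ν) 0 0
    rw [zero_smul, zero_smul] at this
    change multOp 0 f ∈ _
    rw [this]; exact zero_mem _
  | add x y hx hy h h' =>
    have := multOp_add (ν := ν) ⟨x, hx⟩ ⟨y, hy⟩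
    change multOp (⟨x, hx⟩ + ⟨y, hy⟩) f ∈ _
    rw [this]; exact add_mem h h'
  | smul c x hx h =>
    have := multOp_smul (ν := ν) c ⟨x, hx⟩
    change multOp (c • ⟨x, hx⟩) f ∈ _
    rw [this]; exact Submodule.smul_mem _ c h

/-- The operator `T_d`, restricted to `𝒟`, as a linear function of `d ∈ 𝒟`. -/
def multStep : stepSpace ν →ₗ[ℂ] stepSpace ν →ₗ[ℂ] stepSpace ν where
  toFun d := (multOp d).toLinearMap.restrict fun _ hf => multOp_mem d hf
  map_add' d d' := by
    ext1 f
    apply Subtype.ext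
    simp [multOp_add]
  map_smul' c d := by
    ext1 f
    apply Subtype.ext
    simp [multOp_smul]

lemma star_stepVec (a b : ℝ) (k : ℕ) : star (stepVec ν a b k) = stepVec ν a b k := by
  apply Lp.ext
  filter_upwards [Lp.coeFn_star (stepVec ν a b k), MemLp.coeFn_toLp (memLp_two_stepMono ν a b k)]
    with z h1 h2
  rw [h1, Pi.star_apply, stepVec, h2, stepMono]
  by_cases h : z.1 ∈ Set.Ico a b <;> simp [h]

/-- The bilinear form `(d, d') ↦ ⟨d̄, d'⟩ = ∫ d d'` on `𝒟`: the complex bilinear extension of the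
inner product of real functions. -/
def bilin : stepSpace ν →ₗ[ℂ] stepSpace ν →ₗ[ℂ] ℂ where
  toFun d := (innerₛₗ ℂ (star (d : OneParticle ν))) ∘ₗ (stepSpace ν).subtype
  map_add' d d' := by
    ext f
    simp [star_add_lp]
  map_smul' c d := by
    ext f
    simp [star_smul_lp]

/-! The algebras generated by the process. -/

variable (q : Set.Ioo (-1 : ℝ) 1)

variable (ν) in
/-- The field operators `X(d) = a(d̄) + a*(d) + p(T_d)`, `d ∈ 𝒟`, on the `q`-Fock space. For real
`d` one has `d̄ = d`; the dependence on `d` is complex linear. -/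
def field : stepSpace ν →ₗ[ℂ] QFock q (OneParticle ν) →L[ℂ] QFock q (OneParticle ν) where
  toFun d := annihilation q (star (d : OneParticle ν)) + creation q (d : OneParticle ν) +
    gaugeOp q (multOp d)
  map_add' d d' := by
    rw [multOp_add, gaugeOp_add, Submodule.coe_add, star_add_lp, annihilation_add, creation_add]
    abel
  map_smul' c d := by
    rw [multOp_smul, gaugeOp_smul, Submodule.coe_smul, star_smul_lp, annihilation_smul,
      creation_smul, Complex.conj_conj, RingHom.id_apply, smul_add, smul_add]

variable (ν) in
/-- The `q`-Lévy process `X(t) = a(ξ_t) + a*(ξ_t) + p(T_t)`, where `ξ_t = χ_{[0, t)} ⊗ 1` and `T_t`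
is the operator of multiplication by `χ_{[0, t)} ⊗ x`. -/
def process (t : ℝ≥0) : QFock q (OneParticle ν) →L[ℂ] QFock q (OneParticle ν) :=
  field ν q ⟨stepVec ν 0 t 0, stepVec_mem le_rfl t.2 0⟩

lemma process_eq (t : ℝ≥0) : process ν q t =
    annihilation q (stepVec ν 0 t 0) + creation q (stepVec ν 0 t 0) +
      gaugeOp q (multOp ⟨stepVec ν 0 t 0, stepVec_mem le_rfl t.2 0⟩) := by
  simp [process, field, star_stepVec]

variable (ν) in
/-- The unital complex algebra generated by the operators `X(t)`, `t ≥ 0`. -/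
def algX : Subalgebra ℂ (QFock q (OneParticle ν) →L[ℂ] QFock q (OneParticle ν)) :=
  Algebra.adjoin ℂ (Set.range (process ν q))

variable (ν) in
/-- The unital complex algebra generated by the operators `X(d)`, `d ∈ 𝒟`. -/
def algDelta : Subalgebra ℂ (QFock q (OneParticle ν) →L[ℂ] QFock q (OneParticle ν)) :=
  Algebra.adjoin ℂ (Set.range (field ν q))

lemma algX_le_algDelta : algX ν q ≤ algDelta ν q :=
  Algebra.adjoin_mono (by rintro _ ⟨t, rfl⟩; exact ⟨_, rfl⟩)

/-- The field operators as elements of the algebra they generate. -/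
def fieldDelta : stepSpace ν →ₗ[ℂ] algDelta ν q where
  toFun d := ⟨field ν q d, Algebra.subset_adjoin ⟨d, rfl⟩⟩
  map_add' d d' := Subtype.ext (map_add (field ν q) d d')
  map_smul' c d := Subtype.ext (map_smul (field ν q) c d)

variable (ν) in
/-- The Wick map `W` on the algebraic Fock space of `𝒟`: `W(Ω) = Id`, `W(d) = X(d)` and
`W(d ⊗ w) = X(d) W(w) - W(a(d̄) w) - W(p(T_d) w)`. -/
def wick : AlgFock (stepSpace ν) →ₗ[ℂ] algDelta ν q :=
  wickMap q (fieldDelta q) bilin multStep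

variable (ν) in
/-- The canonical map of the algebraic Fock space of `𝒟` into the `q`-Fock space. -/
def stepToFock : AlgFock (stepSpace ν) →ₗ[ℂ] QFock q (OneParticle ν) :=
  toFock q ∘ₗ DirectSum.lmap fun _ => PiTensorProduct.map fun _ => (stepSpace ν).subtype

lemma wick_vac : wick ν q (vac (stepSpace ν)) = 1 := wickMap_vac _ _ _ _

lemma wick_create (d : stepSpace ν) (w : AlgFock (stepSpace ν)) :
    wick ν q (create d w) = fieldDelta q d * wick ν q w - wick ν q (annih q (bilin d) w) -
      wick ν q (gauge q (multStep d) w) :=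
  wickMap_create _ _ _ _ _ _

end Model

/-! ### Vacuum states, `L²`-spaces and cyclic and separating vectors -/

section GNS

variable {F : Type*} [NormedAddCommGroup F] [InnerProductSpace ℂ F]

/-- `Ω` is cyclic for the algebra `𝒜` of bounded operators: `𝒜 Ω` is dense. -/
def IsCyclicVector (𝒜 : Subalgebra ℂ (F →L[ℂ] F)) (Ω : F) : Prop :=
  Dense {v : F | ∃ A ∈ 𝒜, v = A Ω}

/-- `Ω` is separating for the algebra `𝒜` of bounded operators. -/
def IsSeparatingVector (𝒜 : Subalgebra ℂ (F →L[ℂ] F)) (Ω : F) : Prop :=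
  ∀ A ∈ 𝒜, A Ω = 0 → A = 0

/-- The vector functional `φ(A) = ⟨Ω, A Ω⟩`. -/
def vectorState (Ω : F) (A : F →L[ℂ] F) : ℂ := ⟪Ω, A Ω⟫_ℂ

variable [CompleteSpace F]

/-- The algebra `𝒜`, to be equipped with the inner product `⟨A, B⟩_φ = φ(A* B)` of the vector
functional `φ` of `Ω`. -/
def PreL2 (𝒜 : Subalgebra ℂ (F →L[ℂ] F)) (_Ω : F) : Type _ := 𝒜

variable (𝒜 : Subalgebra ℂ (F →L[ℂ] F)) (Ω : F)

instance : AddCommGroup (PreL2 𝒜 Ω) := inferInstanceAs (AddCommGroup 𝒜)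

instance : Module ℂ (PreL2 𝒜 Ω) := inferInstanceAs (Module ℂ 𝒜)

lemma vectorState_adjoint_mul (A B : F →L[ℂ] F) :
    vectorState Ω (ContinuousLinearMap.adjoint A * B) = ⟪A Ω, B Ω⟫_ℂ := by
  rw [vectorState, ContinuousLinearMap.mul_apply, ContinuousLinearMap.adjoint_inner_right]

/-- The inner product `⟨A, B⟩_φ = φ(A* B)` on `𝒜`. -/
@[reducible]
def preL2Core : PreInnerProductSpace.Core ℂ (PreL2 𝒜 Ω) where
  inner A B := vectorState Ω (ContinuousLinearMap.adjoint (A : 𝒜).1 * (B : 𝒜).1)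
  conj_inner_symm A B := by
    rw [vectorState_adjoint_mul, vectorState_adjoint_mul, inner_conj_symm]
  re_inner_nonneg A := by
    rw [vectorState_adjoint_mul]
    exact inner_self_nonneg
  add_left A B C := by
    rw [vectorState_adjoint_mul, vectorState_adjoint_mul, vectorState_adjoint_mul]
    exact inner_add_left _ _ _
  smul_left A B c := by
    rw [vectorState_adjoint_mul, vectorState_adjoint_mul]
    exact inner_smul_left _ _ _

instance : SeminormedAddCommGroup (PreL2 𝒜 Ω) :=
  @InnerProductSpace.Core.toSeminormedAddCommGroup ℂ _ _ _ _ (preL2Core 𝒜 Ω)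

instance : InnerProductSpace ℂ (PreL2 𝒜 Ω) := InnerProductSpace.ofCore (preL2Core 𝒜 Ω)

/-- The Hilbert space `L²(𝒜, φ)`: the completion of `𝒜` for the inner product `φ(A* B)`. -/
abbrev L2Alg : Type _ := UniformSpace.Completion (PreL2 𝒜 Ω)

/-- The canonical map `𝒜 → L²(𝒜, φ)`. -/
def toL2 : 𝒜 →ₗ[ℂ] L2Alg 𝒜 Ω :=
  (UniformSpace.Completion.toComplL (𝕜 := ℂ) (E := PreL2 𝒜 Ω)).toLinearMap

lemma denseRange_toL2 : DenseRange (toL2 𝒜 Ω) :=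
  UniformSpace.Completion.denseRange_coe (α := PreL2 𝒜 Ω)

lemma inner_toL2 (A B : 𝒜) : ⟪toL2 𝒜 Ω A, toL2 𝒜 Ω B⟫_ℂ = ⟪A.1 Ω, B.1 Ω⟫_ℂ :=
  (UniformSpace.Completion.inner_coe (𝕜 := ℂ) (E := PreL2 𝒜 Ω) A B).trans
    (vectorState_adjoint_mul Ω A.1 B.1)

lemma norm_toL2 (A : 𝒜) : ‖toL2 𝒜 Ω A‖ = ‖A.1 Ω‖ := by
  rw [@norm_eq_sqrt_re_inner ℂ, @norm_eq_sqrt_re_inner ℂ, inner_toL2]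

lemma toL2_mul_bound (A : 𝒜) :
    ∃ C, ∀ B : 𝒜, ‖(toL2 𝒜 Ω ∘ₗ LinearMap.mulLeft ℂ A) B‖ ≤ C * ‖toL2 𝒜 Ω B‖ :=
  ⟨‖A.1‖, fun B => by
    rw [LinearMap.comp_apply, norm_toL2, norm_toL2]
    exact A.1.le_opNorm _⟩

/-- The operator of left multiplication by `A ∈ 𝒜` on `L²(𝒜, φ)`. -/
def leftMul (A : 𝒜) : L2Alg 𝒜 Ω →L[ℂ] L2Alg 𝒜 Ω :=
  (toL2 𝒜 Ω ∘ₗ LinearMap.mulLeft ℂ A).extendOfNorm (toL2 𝒜 Ω)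

lemma leftMul_toL2 (A B : 𝒜) : leftMul 𝒜 Ω A (toL2 𝒜 Ω B) = toL2 𝒜 Ω (A * B) :=
  LinearMap.extendOfNorm_eq (f := toL2 𝒜 Ω ∘ₗ LinearMap.mulLeft ℂ A) (e := toL2 𝒜 Ω)
    (denseRange_toL2 𝒜 Ω) (toL2_mul_bound 𝒜 Ω A) B

lemma clm_ext_toL2 {S T : L2Alg 𝒜 Ω →L[ℂ] L2Alg 𝒜 Ω}
    (h : ∀ B : 𝒜, S (toL2 𝒜 Ω B) = T (toL2 𝒜 Ω B)) : S = T := by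
  apply DFunLike.coe_injective
  exact (denseRange_toL2 𝒜 Ω).equalizer S.continuous T.continuous (funext h)

/-- The GNS representation of `𝒜` on `L²(𝒜, φ)` by left multiplication. -/
def gnsRep : 𝒜 →ₐ[ℂ] (L2Alg 𝒜 Ω →L[ℂ] L2Alg 𝒜 Ω) :=
  AlgHom.ofLinearMap
    { toFun := leftMul 𝒜 Ω
      map_add' := fun A B => clm_ext_toL2 𝒜 Ω fun C => by
        rw [add_apply, leftMul_toL2, leftMul_toL2, leftMul_toL2, add_mul, map_add]
      map_smul' := fun c A => clm_ext_toL2 𝒜 Ω fun C => by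
        rw [RingHom.id_apply, smul_apply, leftMul_toL2, leftMul_toL2, smul_mul_assoc, map_smul] }
    (clm_ext_toL2 𝒜 Ω fun C => by
      change leftMul 𝒜 Ω 1 (toL2 𝒜 Ω C) = toL2 𝒜 Ω C
      rw [leftMul_toL2, one_mul])
    (fun A B => clm_ext_toL2 𝒜 Ω fun C => by
      change leftMul 𝒜 Ω (A * B) (toL2 𝒜 Ω C) = leftMul 𝒜 Ω A (leftMul 𝒜 Ω B (toL2 𝒜 Ω C))
      rw [leftMul_toL2, leftMul_toL2, leftMul_toL2, mul_assoc])

end GNS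

end QLevy
end

noncomputable section

namespace QLevy

/-! end QLevy

end
# Comparison of the `q`-inner product with the free inner product -/

section Comparison

open scoped ComplexOrder

variable {H : Type*} [NormedAddCommGroup H] [InnerProductSpace ℂ H]

/-! The vacuum separates because the Wick map parametrizes the whole algebra by vectors. Its
recursion is the formula for `X(d)` on tensors, solved for the creation term. Hence `W(w) Ω = w`
(`wick_vacuum`); read backwards, it shows that the range of `W` is stable under left multiplication
by every `X(d)`, so `W` is onto the larger algebra (`wick_surjective`). If `A = W(w)` kills the
vacuum, the image of `w` in the `q`-Fock space is zero. Since `|q| < 1`, the `q`-inner product is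
strictly positive on algebraic tensors (`qInner_self_eq_zero`), so `w = 0` and `A = 0`. The smaller
algebra inherits this.

Strict positivity comes from a comparison with the free inner product. The kernel `q ^ inversions (τ
* σ⁻¹)` on permutations is a Schur product, over pairs of indices, of kernels with entries `1` and
`q`. Comparing factor by factor with diagonal-type kernels bounds the degree `n` form below and
above by `(1 - |q|)` and `(1 + |q|)`, raised to the number of pairs, times the free form.

Cyclicity is the harder half, since the process only involves `χ ⊗ 1` while the tensors involve all
`χ ⊗ x^k`. Let `K` be the closure of the orbit of the vacuum. The powers of `x` are produced by
quadratic variation: cut `[a, b)` into `N` cells and form the sum over cells of `X(χ_cell) (χ_cell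
x^k ⊗ z)`. The gauge term acting on the first factor gives exactly `χ_[a,b) x^(k+1) ⊗ z`. The
annihilation terms have lower degree, so they already lie in `K` by induction. All remaining terms
are sums of tensors whose first two factors live on the same cell; the first factors are orthogonal
for different cells, so by the upper comparison the squared norm is of order `N · (1/N)²` and
vanishes in the limit (`tendsto_diagonal`). Induction on the degree and on `k` puts all tensors over
`𝒟` in `K` (`stepToFock_lof_mem`). These are dense because `𝒟` is dense in the one-particle space
(`dense_stepSpace`, by Weierstrass approximation) and elementary tensors depend continuously on
their factors.

The unitaries are then formal: `A ↦ A Ω` is isometric on either algebra by the definition of the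
`L²` norm, and has dense range by cyclicity. `J` is the composite of the two resulting unitaries,
and `W(w) Ω = w` identifies the Wick map with the inverse of `U`. -/

lemma posSemidef_finset_prod_sub {ι κ : Type*} [Finite ι] (s : Finset κ) (A B : κ → Matrix ι ι ℂ)
    (hA : ∀ k, (A k).PosSemidef) (hAB : ∀ k, (B k - A k).PosSemidef) :
    (Matrix.of fun i j => ∏ k ∈ s, B k i j - ∏ k ∈ s, A k i j).PosSemidef := by
  classical
  have hB : ∀ k, (B k).PosSemidef := fun k => by simpa using (hA k).add (hAB k)
  induction s using Finset.induction_on with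
  | empty =>
    convert! Matrix.PosSemidef.zero using 1
    ext i j
    simp
  | insert k s hk ih =>
    -- Telescoping `B_k ∏ B - A_k ∏ A = (B_k - A_k) ∏ B + A_k (∏ B - ∏ A)`: both summands are Schur
    -- products of positive semidefinite matrices.
    convert! ((hAB k).hadamard (posSemidef_finset_prod s B hB)).add ((hA k).hadamard ih) using 1
    ext i j
    simp only [Finset.prod_insert hk, Matrix.of_apply, Matrix.add_apply, Matrix.hadamard_apply,
      Matrix.sub_apply]
    ring

/-- The matrix with entries `α` or `β`, according to whether `s` takes the same value or not. -/
lemma posSemidef_sign' {ι : Type*} [Finite ι] {α β : ℝ} (h : |β| ≤ α) (s : ι → Prop)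
    [DecidablePred s] :
    (Matrix.of fun i j => if (s i ↔ s j) then (α : ℂ) else (β : ℂ)).PosSemidef := by
  obtain ⟨h1, h2⟩ := abs_le.1 h
  let ε : ι → ℂ := fun i => if s i then 1 else -1
  have A : (Matrix.gram ℂ (fun _ : ι => (1 : ℂ))).PosSemidef := Matrix.posSemidef_gram ℂ _
  have B : (Matrix.gram ℂ ε).PosSemidef := Matrix.posSemidef_gram ℂ _
  have h3 : (0 : ℂ) ≤ (((α + β) / 2 : ℝ) : ℂ) := by
    rw [← Complex.ofReal_zero, Complex.real_le_real]; linarith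
  have h4 : (0 : ℂ) ≤ (((α - β) / 2 : ℝ) : ℂ) := by
    rw [← Complex.ofReal_zero, Complex.real_le_real]; linarith
  -- With `ε = ±1` recording the value of `s`, the entries are `(α + β)/2 + (α - β)/2 · ε_i ε_j`;
  -- both coefficients are nonnegative because `|β| ≤ α`.
  convert! (A.smul h3).add (B.smul h4) using 1
  ext i j
  by_cases hi : s i <;> by_cases hj : s j <;> simp [ε, hi, hj] <;> ring

/-- The pairs `i < j` of indices. -/
abbrev pairs (n : ℕ) : Finset (Fin n × Fin n) :=
  Finset.univ.filter fun p : Fin n × Fin n => p.1 < p.2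

lemma inversions_one (n : ℕ) : inversions (1 : Equiv.Perm (Fin n)) = 0 := by
  rw [inversions, Finset.card_eq_zero, Finset.filter_eq_empty_iff]
  rintro ⟨a, b⟩ - ⟨h1, h2⟩
  exact absurd h1 (not_lt.2 (le_of_lt h2))

lemma eq_one_of_inversions_eq_zero {n : ℕ} {σ : Equiv.Perm (Fin n)} (h : inversions σ = 0) :
    σ = 1 := by
  rw [inversions, Finset.card_eq_zero, Finset.filter_eq_empty_iff] at h
  have hmono : StrictMono σ := fun a b hab => by
    have := @h (a, b) (Finset.mem_univ _)
    simp only [not_and, not_lt] at this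
    exact lt_of_le_of_ne (this hab) fun e => hab.ne (σ.injective e)
  ext1 i
  have := hmono.range_inj (g := id) strictMono_id
  rw [σ.surjective.range_eq, Set.range_id] at this
  exact congrFun (this.1 rfl) i

/-- Since `0 ^ 0 = 1` and only the identity has no inversions, the free inner product is the case `q
= 0`. This lets it be compared with the `q`-form as a kernel on the symmetric group. -/
lemma zero_pow_inversions {n : ℕ} (σ : Equiv.Perm (Fin n)) :
    (0 : ℂ) ^ inversions σ = if σ = 1 then 1 else 0 := by
  split_ifs with h
  · rw [h, inversions_one, pow_zero]
  · exact zero_pow fun e => h (eq_one_of_inversions_eq_zero e)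

/-- For each pair of indices, the kernel with entries `1` and `q` minus the one with entries `1 -
|q|` and `0` has entries `|q|` and `q`, hence is positive. Multiplying over all pairs, the second
kernel becomes a multiple of the identity matrix. -/
lemma posSemidef_kernel_lower {q : ℝ} (hq : |q| < 1) (n : ℕ) :
    (Matrix.of fun σ τ : Equiv.Perm (Fin n) => (q : ℂ) ^ inversions (τ * σ⁻¹) -
      ((1 - |q| : ℝ) : ℂ) ^ (pairs n).card * (0 : ℂ) ^ inversions (τ * σ⁻¹)).PosSemidef := by
  convert! posSemidef_finset_prod_sub (pairs n)
    (fun p => Matrix.of fun σ τ : Equiv.Perm (Fin n) =>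
      if (σ p.1 < σ p.2 ↔ τ p.1 < τ p.2) then ((1 - |q| : ℝ) : ℂ) else ((0 : ℝ) : ℂ))
    (fun p => Matrix.of fun σ τ : Equiv.Perm (Fin n) =>
      if (σ p.1 < σ p.2 ↔ τ p.1 < τ p.2) then (1 : ℂ) else (q : ℂ))
    (fun p => posSemidef_sign' (by simpa using hq.le) _) (fun p => ?_) using 1
  · ext σ τ
    simp only [Matrix.of_apply, pow_inversions, ← Finset.prod_const, ← Finset.prod_mul_distrib]
    congr 1
    refine Finset.prod_congr rfl fun p _ => ?_
    split_ifs <;> simp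
  · convert! posSemidef_sign' (α := |q|) (β := q) le_rfl
      (fun σ : Equiv.Perm (Fin n) => σ p.1 < σ p.2) using 1
    ext σ τ
    simp only [Matrix.of_apply, Matrix.sub_apply]
    split_ifs <;> simp

/-- Here the dominating factor for each pair has entries `1 + |q|` and `0`, and the difference has
entries `|q|` and `-q`. -/
lemma posSemidef_kernel_upper {q : ℝ} (hq : |q| < 1) (n : ℕ) :
    (Matrix.of fun σ τ : Equiv.Perm (Fin n) =>
      ((1 + |q| : ℝ) : ℂ) ^ (pairs n).card * (0 : ℂ) ^ inversions (τ * σ⁻¹) -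
        (q : ℂ) ^ inversions (τ * σ⁻¹)).PosSemidef := by
  convert! posSemidef_finset_prod_sub (pairs n)
    (fun p => Matrix.of fun σ τ : Equiv.Perm (Fin n) =>
      if (σ p.1 < σ p.2 ↔ τ p.1 < τ p.2) then (1 : ℂ) else (q : ℂ))
    (fun p => Matrix.of fun σ τ : Equiv.Perm (Fin n) =>
      if (σ p.1 < σ p.2 ↔ τ p.1 < τ p.2) then ((1 + |q| : ℝ) : ℂ) else ((0 : ℝ) : ℂ))
    (fun p => posSemidef_sign hq.le _) (fun p => ?_) using 1
  · ext σ τ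
    simp only [Matrix.of_apply, pow_inversions, ← Finset.prod_const, ← Finset.prod_mul_distrib]
    congr 1
    refine Finset.prod_congr rfl fun p _ => ?_
    split_ifs <;> simp
  · convert! posSemidef_sign' (α := |q|) (β := -q) (by rw [abs_neg])
      (fun σ : Equiv.Perm (Fin n) => σ p.1 < σ p.2) using 1
    ext σ τ
    simp only [Matrix.of_apply, Matrix.sub_apply]
    split_ifs <;> simp

/-- A positive definite function on the symmetric group defines a positive form on tensors. -/
lemma kernel_sum_nonneg {n : ℕ} {f : Equiv.Perm (Fin n) → ℂ}
    (hf : (Matrix.of fun σ τ : Equiv.Perm (Fin n) => f (τ * σ⁻¹)).PosSemidef)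
    {ι : Type*} [Fintype ι] (c : ι → ℂ) (v : ι → Fin n → H) :
    0 ≤ ∑ i, ∑ j, (starRingEnd ℂ) (c i) * c j *
      ∑ ρ : Equiv.Perm (Fin n), f ρ * ∏ k, ⟪v i k, v j (ρ k)⟫_ℂ := by
  -- The Schur product of the kernel with Gram matrices is positive. It is tested on the vector `c`,
  -- constant in the permutation; substituting `ρ = τ σ⁻¹` makes every `σ` contribute the same sum,
  -- so the result is `n!` times the form in question.
  let M : Matrix (ι × Equiv.Perm (Fin n)) (ι × Equiv.Perm (Fin n)) ℂ :=
    Matrix.of fun a b => f (b.2 * a.2⁻¹) * ∏ k, ⟪v a.1 (a.2 k), v b.1 (b.2 k)⟫_ℂ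
  have hM : M.PosSemidef := by
    have h2 := posSemidef_finset_prod (ι := ι × Equiv.Perm (Fin n)) (Finset.univ : Finset (Fin n))
      (fun k => Matrix.gram ℂ fun a => v a.1 (a.2 k)) (fun k => Matrix.posSemidef_gram ℂ _)
    convert! (hf.submatrix fun a : ι × Equiv.Perm (Fin n) => a.2).hadamard h2 using 1
  have h := hM.dotProduct_mulVec_nonneg (fun a => c a.1)
  have key : star (fun a : ι × Equiv.Perm (Fin n) => c a.1) ⬝ᵥ M.mulVec (fun a => c a.1)
      = (Fintype.card (Equiv.Perm (Fin n)) : ℂ) *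
        ∑ i, ∑ j, (starRingEnd ℂ) (c i) * c j *
          ∑ ρ : Equiv.Perm (Fin n), f ρ * ∏ k, ⟪v i k, v j (ρ k)⟫_ℂ := by
    simp only [dotProduct, Matrix.mulVec, Fintype.sum_prod_type, Pi.star_apply, M, Matrix.of_apply]
    rw [Finset.mul_sum]
    refine Finset.sum_congr rfl fun i _ => ?_
    have hσ : ∀ (σ : Equiv.Perm (Fin n)) (j : ι),
        ∑ τ : Equiv.Perm (Fin n), f (τ * σ⁻¹) *
          (∏ k, ⟪v i (σ k), v j (τ k)⟫_ℂ) * c j =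
            c j * ∑ ρ : Equiv.Perm (Fin n), f ρ * ∏ k, ⟪v i k, v j (ρ k)⟫_ℂ := by
      intro σ j
      rw [Finset.mul_sum]
      refine Fintype.sum_equiv (Equiv.mulRight σ⁻¹) _ _ fun τ => ?_
      have : ∏ k, ⟪v i (σ k), v j (τ k)⟫_ℂ = ∏ k, ⟪v i k, v j ((τ * σ⁻¹) k)⟫_ℂ :=
        Fintype.prod_equiv σ _ _ fun k => by simp
      rw [this, Equiv.coe_mulRight]
      ring
    have hi : ∀ σ : Equiv.Perm (Fin n), star (c i) * ∑ j, ∑ τ : Equiv.Perm (Fin n),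
        f (τ * σ⁻¹) * (∏ k, ⟪v i (σ k), v j (τ k)⟫_ℂ) * c j = ∑ j, (starRingEnd ℂ) (c i) * c j *
          ∑ ρ : Equiv.Perm (Fin n), f ρ * ∏ k, ⟪v i k, v j (ρ k)⟫_ℂ := by
      intro σ
      rw [Finset.mul_sum]
      refine Finset.sum_congr rfl fun j _ => ?_
      rw [hσ, mul_assoc, starRingEnd_apply]
    rw [Finset.sum_congr rfl fun σ _ => hi σ, Finset.sum_const, Finset.card_univ, nsmul_eq_mul]
  rw [key] at h
  have hc : (0 : ℝ) < Fintype.card (Equiv.Perm (Fin n)) := by exact_mod_cast Fintype.card_pos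
  have h2 := mul_nonneg (Complex.zero_le_real.2 (inv_nonneg.2 hc.le)) h
  rwa [← mul_assoc, Complex.ofReal_inv, Complex.ofReal_natCast, inv_mul_cancel₀, one_mul] at h2
  exact_mod_cast hc.ne'

lemma inner0_tprod {n : ℕ} (v w : Fin n → H) :
    inner0 n (PiTensorProduct.tprod ℂ w) (PiTensorProduct.tprod ℂ v) = ∏ i, ⟪v i, w i⟫_ℂ := by
  simp [inner0, conjFunctional_tprod]

lemma inner0_sum_self {n : ℕ} {ι : Type*} [Fintype ι] (c : ι → ℂ) (v : ι → Fin n → H) :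
    inner0 n (∑ i, c i • PiTensorProduct.tprod ℂ (v i)) (∑ i, c i • PiTensorProduct.tprod ℂ (v i)) =
      ∑ i, ∑ j, (starRingEnd ℂ) (c i) * c j * ∏ k, ⟪v i k, v j k⟫_ℂ := by
  rw [map_sum]
  refine Finset.sum_congr rfl fun i _ => ?_
  rw [map_sum, LinearMap.sum_apply]
  refine Finset.sum_congr rfl fun j _ => ?_
  rw [LinearMap.map_smulₛₗ, map_smul, LinearMap.smul_apply, inner0_tprod, smul_eq_mul, smul_eq_mul]
  ring

lemma qInner_lof_sum_self (q : ℝ) {n : ℕ} {ι : Type*} [Fintype ι] (c : ι → ℂ)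
    (v : ι → Fin n → H) :
    qInner q (∑ i, c i • pureTensor (v i)) (∑ i, c i • pureTensor (v i)) =
      ∑ i, ∑ j, (starRingEnd ℂ) (c i) * c j * pairing q (v i) (v j) := by
  rw [map_sum]
  refine Finset.sum_congr rfl fun i _ => ?_
  rw [map_sum, LinearMap.sum_apply]
  refine Finset.sum_congr rfl fun j _ => ?_
  rw [LinearMap.map_smulₛₗ, map_smul, LinearMap.smul_apply, qInner_pureTensor, smul_eq_mul,
    smul_eq_mul]
  ring

lemma lof_sum_tprod {n : ℕ} {ι : Type*} [Fintype ι] (c : ι → ℂ) (v : ι → Fin n → H) :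
    DirectSum.lof ℂ ℕ (fun n => ⨂[ℂ]^n H) n (∑ i, c i • PiTensorProduct.tprod ℂ (v i)) =
      ∑ i, c i • pureTensor (v i) := by
  simp [map_sum, pureTensor]

lemma sum_zero_pow_inversions {n : ℕ} (a : ℂ) (v w : Fin n → H) :
    ∑ ρ : Equiv.Perm (Fin n), a * (0 : ℂ) ^ inversions ρ * ∏ k, ⟪v k, w (ρ k)⟫_ℂ =
      a * ∏ k, ⟪v k, w k⟫_ℂ := by
  rw [Finset.sum_eq_single 1]
  · simp [inversions_one]
  · intro ρ _ h
    rw [zero_pow_inversions, if_neg h, mul_zero, zero_mul]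
  · simp

/-- For `|q| < 1`, the `q`-inner product dominates a positive multiple of the free one. -/
lemma mul_inner0_le_qInner {q : ℝ} (hq : |q| < 1) {n : ℕ} (x : ⨂[ℂ]^n H) :
    ((1 - |q| : ℝ) : ℂ) ^ (pairs n).card * inner0 n x x ≤
      qInner q (DirectSum.lof ℂ ℕ (fun n => ⨂[ℂ]^n H) n x)
        (DirectSum.lof ℂ ℕ (fun n => ⨂[ℂ]^n H) n x) := by
  obtain ⟨ι, _, c, v, rfl⟩ := exists_tprod_sum x
  rw [lof_sum_tprod, qInner_lof_sum_self, inner0_sum_self, ← sub_nonneg]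
  have h := kernel_sum_nonneg (f := fun ρ => (q : ℂ) ^ inversions ρ -
    ((1 - |q| : ℝ) : ℂ) ^ (pairs n).card * (0 : ℂ) ^ inversions ρ)
    (posSemidef_kernel_lower hq n) c v
  simp only [sub_mul, Finset.sum_sub_distrib, sum_zero_pow_inversions] at h
  refine h.trans_eq ?_
  simp only [mul_sub, Finset.sum_sub_distrib, pairing, Finset.mul_sum]
  congr 1
  refine Finset.sum_congr rfl fun i _ => Finset.sum_congr rfl fun j _ => ?_
  ring

/-- This allows `q`-norms to be estimated by free norms, where orthogonality in a single tensor slot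
already removes cross terms. For the `q`-form itself it does not, as the permutations mix the slots.
-/
lemma qInner_le_mul_inner0 {q : ℝ} (hq : |q| < 1) {n : ℕ} (x : ⨂[ℂ]^n H) :
    qInner q (DirectSum.lof ℂ ℕ (fun n => ⨂[ℂ]^n H) n x)
        (DirectSum.lof ℂ ℕ (fun n => ⨂[ℂ]^n H) n x) ≤
      ((1 + |q| : ℝ) : ℂ) ^ (pairs n).card * inner0 n x x := by
  obtain ⟨ι, _, c, v, rfl⟩ := exists_tprod_sum x
  rw [lof_sum_tprod, qInner_lof_sum_self, inner0_sum_self, ← sub_nonneg]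
  have h := kernel_sum_nonneg (f := fun ρ =>
    ((1 + |q| : ℝ) : ℂ) ^ (pairs n).card * (0 : ℂ) ^ inversions ρ - (q : ℂ) ^ inversions ρ)
    (posSemidef_kernel_upper hq n) c v
  simp only [sub_mul, Finset.sum_sub_distrib, sum_zero_pow_inversions] at h
  refine h.trans_eq ?_
  simp only [mul_sub, Finset.sum_sub_distrib, pairing, Finset.mul_sum]
  congr 1
  refine Finset.sum_congr rfl fun i _ => Finset.sum_congr rfl fun j _ => ?_
  ring

/-- Every tensor is a combination of elementary tensors of an orthonormal system. -/
lemma exists_orthonormal_expansion {n : ℕ} (x : ⨂[ℂ]^n H) :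
    ∃ (κ : Type) (_ : Fintype κ) (b : κ → H), Orthonormal ℂ b ∧ ∃ a : (Fin n → κ) → ℂ,
      x = ∑ f, a f • PiTensorProduct.tprod ℂ fun k => b (f k) := by
  classical
  obtain ⟨ι, _, c, v, rfl⟩ := exists_tprod_sum x
  -- Only finitely many vectors occur as factors, so an orthonormal basis of their
  -- finite-dimensional span suffices, and `H` need not be complete.
  let F : Submodule ℂ H := Submodule.span ℂ (Set.range fun p : ι × Fin n => v p.1 p.2)
  have : FiniteDimensional ℂ F := FiniteDimensional.span_of_finite ℂ (Set.finite_range _)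
  let b := stdOrthonormalBasis ℂ F
  have hv : ∀ i k, v i k = ∑ m, b.repr ⟨v i k, Submodule.subset_span ⟨(i, k), rfl⟩⟩ m • (b m : H) := by
    intro i k
    have := congrArg F.subtype
      (b.sum_repr ⟨v i k, Submodule.subset_span ⟨(i, k), rfl⟩⟩)
    rw [map_sum] at this
    exact this.symm
  refine ⟨_, inferInstance, fun m => (b m : H),
    b.orthonormal.comp_linearIsometry F.subtypeₗᵢ, fun f => ∑ i, c i *
      ∏ k, b.repr ⟨v i k, Submodule.subset_span ⟨(i, k), rfl⟩⟩ (f k), ?_⟩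
  simp only [Finset.sum_smul]
  rw [Finset.sum_comm]
  refine Finset.sum_congr rfl fun i _ => ?_
  simp only [mul_smul, ← Finset.smul_sum]
  congr 1
  have : v i = fun k => ∑ m, b.repr ⟨v i k, Submodule.subset_span ⟨(i, k), rfl⟩⟩ m • (b m : H) :=
    funext (hv i)
  conv_lhs => rw [this]
  rw [MultilinearMap.map_sum]
  refine Finset.sum_congr rfl fun f _ => ?_
  rw [MultilinearMap.map_smul_univ]

/-- Elementary tensors of an orthonormal system are orthonormal for the free inner product, so in
such an expansion the form is the sum of `|a_f|²`. -/
lemma inner0_self_eq_zero {n : ℕ} {x : ⨂[ℂ]^n H} (h : inner0 n x x = 0) : x = 0 := by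
  classical
  obtain ⟨κ, _, b, hb, a, rfl⟩ := exists_orthonormal_expansion x
  rw [inner0_sum_self] at h
  have hprod : ∀ f g : Fin n → κ, ∏ k, ⟪b (f k), b (g k)⟫_ℂ = if f = g then 1 else 0 := by
    intro f g
    split_ifs with e
    · subst e
      exact Finset.prod_eq_one fun k _ => by rw [orthonormal_iff_ite.1 hb, if_pos rfl]
    · obtain ⟨k, hk⟩ := Function.ne_iff.1 e
      exact Finset.prod_eq_zero (Finset.mem_univ k) (hb.2 hk)
  simp only [hprod, mul_ite, mul_one, mul_zero, Finset.sum_ite_eq, Finset.mem_univ, if_true,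
    ← Complex.normSq_eq_conj_mul_self] at h
  norm_cast at h
  rw [Finset.sum_eq_zero_iff_of_nonneg fun f _ => Complex.normSq_nonneg _] at h
  refine Finset.sum_eq_zero fun f hf => ?_
  rw [Complex.normSq_eq_zero.1 (h f hf), zero_smul]

/-- For `|q| < 1`, the `q`-inner product is strictly positive. -/
lemma qInner_self_eq_zero {q : ℝ} (hq : |q| < 1) {x : AlgFock H} (h : qInner q x x = 0) :
    x = 0 := by
  classical
  have hx : x = ∑ n ∈ DFinsupp.support x, DirectSum.lof ℂ ℕ (fun n => ⨂[ℂ]^n H) n (x n) :=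
    (DirectSum.sum_support_of x).symm
  have hlevel : ∀ n : ℕ, 0 ≤ qInner q (DirectSum.lof ℂ ℕ (fun n => ⨂[ℂ]^n H) n (x n))
      (DirectSum.lof ℂ ℕ (fun n => ⨂[ℂ]^n H) n (x n)) := fun n => qInner_self_nonneg hq.le _
  have hsum : qInner q x x = ∑ n ∈ DFinsupp.support x,
      qInner q (DirectSum.lof ℂ ℕ (fun n => ⨂[ℂ]^n H) n (x n))
        (DirectSum.lof ℂ ℕ (fun n => ⨂[ℂ]^n H) n (x n)) := by
    conv_lhs => rw [hx]
    rw [map_sum]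
    refine Finset.sum_congr rfl fun n hn => ?_
    rw [map_sum, LinearMap.sum_apply, Finset.sum_eq_single_of_mem n hn]
    intro m _ hm
    exact qInner_lof_ne q hm.symm _ _
  rw [hsum, Finset.sum_eq_zero_iff_of_nonneg fun n _ => hlevel n] at h
  rw [hx]
  refine Finset.sum_eq_zero fun n hn => ?_
  -- Different degrees are orthogonal, so each homogeneous part has zero `q`-norm. The lower
  -- comparison transfers this to its free norm.
  have h1 := mul_inner0_le_qInner hq (x n)
  rw [h n hn] at h1
  have hpos : (0 : ℂ) < ((1 - |q| : ℝ) : ℂ) ^ (pairs n).card := by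
    rw [← Complex.ofReal_pow, Complex.zero_lt_real]
    exact pow_pos (sub_pos.2 hq) _
  have h2 : 0 ≤ inner0 n (x n) (x n) := by
    obtain ⟨ι, _, c, v, hv⟩ := exists_tprod_sum (x n)
    rw [hv, inner0_sum_self]
    -- Nonnegativity of the free form is the case of the identity matrix as kernel.
    have h := kernel_sum_nonneg (f := fun ρ => (1 : ℂ) * (0 : ℂ) ^ inversions ρ)
      (by
        convert! (Matrix.PosSemidef.one (n := Equiv.Perm (Fin n)) (R := ℂ)) using 1
        ext σ τ
        simp [zero_pow_inversions, Matrix.one_apply, mul_inv_eq_one, eq_comm]) c v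
    simp only [sum_zero_pow_inversions] at h
    simpa only [one_mul] using h
  have h3 : inner0 n (x n) (x n) = 0 :=
    le_antisymm (by by_contra! hc; exact absurd (mul_pos hpos (lt_of_le_of_ne h2 fun e => hc e.ge)) (not_lt_of_ge h1)) h2
  rw [inner0_self_eq_zero h3, map_zero]

lemma norm_sq_toFock_lof_le (q : Set.Ioo (-1 : ℝ) 1) {n : ℕ} (x : ⨂[ℂ]^n H) :
    ‖toFock q (DirectSum.lof ℂ ℕ (fun n => ⨂[ℂ]^n H) n x)‖ ^ 2 ≤
      (1 + |(q : ℝ)|) ^ (pairs n).card * (inner0 n x x).re := by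
  have h := (Complex.le_def.1 (qInner_le_mul_inner0 (abs_lt_one q) x)).1
  rw [← inner_toFock, inner_self_eq_norm_sq_to_K, ← Complex.ofReal_pow, Complex.re_ofReal_mul] at h
  refine le_of_eq_of_le ?_ h
  norm_cast

/-- Tensors whose first factors are orthogonal. -/
lemma norm_sq_toFock_sum_le (q : Set.Ioo (-1 : ℝ) 1) {n : ℕ} {ι : Type*} [Fintype ι]
    (u v : ι → H) (z : Fin n → H) (hu : Pairwise fun i j => ⟪u i, u j⟫_ℂ = 0) :
    ‖toFock q (∑ i, create (u i) (create (v i) (pureTensor z)))‖ ^ 2 ≤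
      (1 + |(q : ℝ)|) ^ (pairs (n + 2)).card *
        ∑ i, ‖u i‖ ^ 2 * (‖v i‖ ^ 2 * ∏ k, ‖z k‖ ^ 2) := by
  let w : ι → Fin (n + 2) → H := fun i => Fin.cons (u i) (Fin.cons (v i) z : Fin (n + 1) → H)
  have h1 : ∑ i, create (u i) (create (v i) (pureTensor z)) =
      DirectSum.lof ℂ ℕ (fun n => ⨂[ℂ]^n H) (n + 2)
        (∑ i, (1 : ℂ) • PiTensorProduct.tprod ℂ (w i)) := by
    rw [lof_sum_tprod]
    refine Finset.sum_congr rfl fun i _ => ?_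
    rw [create_pureTensor, create_pureTensor, one_smul]
  rw [h1]
  refine (norm_sq_toFock_lof_le q _).trans_eq ?_
  congr 1
  rw [inner0_sum_self, Complex.re_sum]
  refine Finset.sum_congr rfl fun i _ => ?_
  -- Every cross term of the free form contains the factor `⟪u i, u j⟫ = 0`.
  rw [Finset.sum_eq_single i]
  · simp only [w, Fin.prod_univ_succ, Fin.cons_zero, Fin.cons_succ, inner_self_eq_norm_sq_to_K,
      map_one, one_mul]
    norm_cast
  · intro j _ hj
    rw [Fin.prod_univ_succ]
    simp [w, hu hj.symm]
  · simp

end Comparison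

/-! end QLevy

end
# The Wick map and the vacuum -/

section FockMap

variable {V W : Type*} [AddCommGroup V] [Module ℂ V] [AddCommGroup W] [Module ℂ W]

/-- The map of algebraic Fock spaces induced by a linear map. -/
def fockMap (f : V →ₗ[ℂ] W) : AlgFock V →ₗ[ℂ] AlgFock W :=
  DirectSum.lmap fun _ => PiTensorProduct.map fun _ => f

variable (f : V →ₗ[ℂ] W)

lemma fockMap_pureTensor {n : ℕ} (v : Fin n → V) :
    fockMap f (pureTensor v) = pureTensor fun i => f (v i) := by
  rw [fockMap, pureTensor, DirectSum.lmap_lof, PiTensorProduct.map_tprod, pureTensor]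

lemma fockMap_vac : fockMap f (vac V) = vac W := by
  rw [vac, fockMap_pureTensor, vac]
  congr 1
  exact Subsingleton.elim _ _

lemma comp_fin_cons {n : ℕ} (d : V) (v : Fin n → V) :
    (fun i => f ((Fin.cons d v : Fin (n + 1) → V) i)) =
      (Fin.cons (f d) fun i => f (v i) : Fin (n + 1) → W) := by
  ext i
  refine Fin.cases ?_ (fun i => ?_) i <;> simp

lemma fockMap_create (d : V) (x : AlgFock V) :
    fockMap f (create d x) = create (f d) (fockMap f x) := by
  refine LinearMap.congr_fun (f := fockMap f ∘ₗ create d) (g := create (f d) ∘ₗ fockMap f)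
    (algFock_ext fun n v => ?_) x
  rw [LinearMap.comp_apply, LinearMap.comp_apply, create_pureTensor, fockMap_pureTensor,
    fockMap_pureTensor, create_pureTensor, comp_fin_cons]

lemma fockMap_annih (q : ℝ) (φ : W →ₗ[ℂ] ℂ) (x : AlgFock V) :
    fockMap f (annih q (φ ∘ₗ f) x) = annih q φ (fockMap f x) := by
  refine LinearMap.congr_fun (f := fockMap f ∘ₗ annih q (φ ∘ₗ f)) (g := annih q φ ∘ₗ fockMap f)
    (algFock_ext fun n v => ?_) x
  rw [LinearMap.comp_apply, LinearMap.comp_apply, fockMap_pureTensor]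
  cases n with
  | zero => rw [annih_pureTensor_zero, annih_pureTensor_zero, map_zero]
  | succ n =>
    rw [annih_pureTensor_succ, annih_pureTensor_succ, map_sum]
    refine Finset.sum_congr rfl fun k _ => ?_
    rw [map_smul, map_smul, fockMap_pureTensor]
    rfl

lemma fockMap_gauge (q : ℝ) {T : V →ₗ[ℂ] V} {T' : W →ₗ[ℂ] W} (h : ∀ v, f (T v) = T' (f v))
    (x : AlgFock V) : fockMap f (gauge q T x) = gauge q T' (fockMap f x) := by
  refine LinearMap.congr_fun (f := fockMap f ∘ₗ gauge q T) (g := gauge q T' ∘ₗ fockMap f)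
    (algFock_ext fun n v => ?_) x
  rw [LinearMap.comp_apply, LinearMap.comp_apply, fockMap_pureTensor]
  cases n with
  | zero => rw [gauge_pureTensor_zero, gauge_pureTensor_zero, map_zero]
  | succ n =>
    rw [gauge_pureTensor_succ, gauge_pureTensor_succ, map_sum]
    refine Finset.sum_congr rfl fun k _ => ?_
    rw [map_smul, fockMap_pureTensor, comp_fin_cons, h]
    rfl

/-- The pairing involves only inner products of the factors, which an isometry preserves. -/
lemma qInner_fockMap {V H : Type*} [NormedAddCommGroup V] [InnerProductSpace ℂ V]
    [NormedAddCommGroup H] [InnerProductSpace ℂ H] (q : ℝ) (f : V →ₗᵢ[ℂ] H) (x y : AlgFock V) :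
    qInner q (fockMap f.toLinearMap x) (fockMap f.toLinearMap y) = qInner q x y := by
  induction x using algFock_induction with
  | h0 => simp
  | hadd x x' hx hx' => simp only [map_add, LinearMap.add_apply, hx, hx']
  | h c n v =>
    rw [map_smul, map_smul, map_smul, LinearMap.smul_apply, LinearMap.smul_apply]
    congr 1
    induction y using algFock_induction with
    | h0 => simp
    | hadd x x' hx hx' => simp only [map_add, hx, hx']
    | h c m w =>
      rw [map_smul, LinearMap.map_smulₛₗ, LinearMap.map_smulₛₗ]
      congr 1
      rw [fockMap_pureTensor, fockMap_pureTensor]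
      rcases eq_or_ne m n with rfl | h
      · rw [qInner_pureTensor, qInner_pureTensor, pairing, pairing]
        simp
      · rw [qInner_pureTensor_ne _ h, qInner_pureTensor_ne _ h]

end FockMap

/-! ### The range of the Wick map and its evaluation along a linear map -/

section WickMap

variable {V A B : Type*} [AddCommGroup V] [Module ℂ V] [Ring A] [Algebra ℂ A] [Ring B] [Algebra ℂ B]
  (q : ℝ) (X : V →ₗ[ℂ] A) (β : V →ₗ[ℂ] V →ₗ[ℂ] ℂ) (T : V →ₗ[ℂ] V →ₗ[ℂ] V) (f : A →ₐ[ℂ] B)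

/-- The range of the Wick map is stable under left multiplication by the generators. -/
lemma exists_wickMap_eq_mul {b : B} (hb : b ∈ Algebra.adjoin ℂ (Set.range fun d => f (X d))) :
    ∀ w : AlgFock V, ∃ w' : AlgFock V, f (wickMap q X β T w') = b * f (wickMap q X β T w) := by
  induction hb using Algebra.adjoin_induction with
  | mem b hb =>
    obtain ⟨d, rfl⟩ := hb
    intro w
    -- The Wick recursion solved for `X(d) W(w)`.
    refine ⟨create d w + annih q (β d) w + gauge q (T d) w, ?_⟩
    rw [← map_mul]
    congr 1
    rw [map_add, map_add, wickMap_create]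
    abel
  | algebraMap c =>
    intro w
    refine ⟨c • w, ?_⟩
    rw [map_smul, map_smul, Algebra.algebraMap_eq_smul_one, smul_mul_assoc, one_mul]
  | add a b _ _ ha hb =>
    intro w
    obtain ⟨x, hx⟩ := ha w
    obtain ⟨y, hy⟩ := hb w
    exact ⟨x + y, by rw [add_mul, ← hx, ← hy, map_add, map_add]⟩
  | mul a b _ _ ha hb =>
    intro w
    obtain ⟨y, hy⟩ := hb w
    obtain ⟨x, hx⟩ := ha y
    exact ⟨x, by rw [hx, hy, mul_assoc]⟩

variable {F : Type*} [AddCommGroup F] [Module ℂ F] (E : A →ₗ[ℂ] F) (S : AlgFock V →ₗ[ℂ] F)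
  (L : V → F → F)

/-- Both `E ∘ W` and `S` satisfy the recursion that expresses the value at `d ⊗ w` through `L d` and
lower degrees, with the same value at the vacuum. The induction must be strong, since the
annihilation term goes down two degrees from `d ⊗ w`. -/
lemma eval_wickMap_lof (h1 : E 1 = S (vac V)) (hL : ∀ d a, E (X d * a) = L d (E a))
    (hS : ∀ d w, L d (S w) = S (create d w) + S (annih q (β d) w) + S (gauge q (T d) w)) (n : ℕ) :
    ∀ x : ⨂[ℂ]^n V, E (wickMap q X β T (DirectSum.lof ℂ ℕ (fun n => ⨂[ℂ]^n V) n x)) =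
      S (DirectSum.lof ℂ ℕ (fun n => ⨂[ℂ]^n V) n x) := by
  induction n using Nat.strong_induction_on with
  | _ n ih =>
    intro x
    induction x using PiTensorProduct.induction_on with
    | add x y hx hy => rw [map_add, map_add, map_add, map_add, hx, hy]
    | smul_tprod c v =>
      rw [map_smul, map_smul, map_smul, map_smul]
      congr 1
      cases n with
      | zero =>
        have : DirectSum.lof ℂ ℕ (fun n => ⨂[ℂ]^n V) 0 (PiTensorProduct.tprod ℂ v) = vac V := by
          rw [vac, pureTensor, Subsingleton.elim v]
        rw [this, wickMap_vac, h1]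
      | succ n =>
        obtain ⟨d, u, rfl⟩ : ∃ (d : V) (u : Fin n → V), v = Fin.cons d u :=
          ⟨v 0, Fin.tail v, (Fin.cons_self_tail v).symm⟩
        rw [← createN_tprod, ← create_lof, wickMap_create, map_sub, map_sub, hL, ih n (by omega)]
        have hann : E (wickMap q X β T (annih q (β d) (DirectSum.lof ℂ ℕ
            (fun n => ⨂[ℂ]^n V) n (PiTensorProduct.tprod ℂ u)))) = S (annih q (β d)
              (DirectSum.lof ℂ ℕ (fun n => ⨂[ℂ]^n V) n (PiTensorProduct.tprod ℂ u))) := by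
          cases n with
          | zero => rw [annih_lof_zero, map_zero, map_zero, map_zero]
          | succ n => rw [annih_lof_succ, ih n (by omega)]
        have hgauge : E (wickMap q X β T (gauge q (T d) (DirectSum.lof ℂ ℕ
            (fun n => ⨂[ℂ]^n V) n (PiTensorProduct.tprod ℂ u)))) = S (gauge q (T d)
              (DirectSum.lof ℂ ℕ (fun n => ⨂[ℂ]^n V) n (PiTensorProduct.tprod ℂ u))) := by
          cases n with
          | zero => rw [gauge_lof_zero, map_zero, map_zero, map_zero]
          | succ n => rw [gauge_lof_succ, ih (n + 1) (by omega)]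
        rw [hann, hgauge, hS]
        abel

lemma eval_wickMap (h1 : E 1 = S (vac V)) (hL : ∀ d a, E (X d * a) = L d (E a))
    (hS : ∀ d w, L d (S w) = S (create d w) + S (annih q (β d) w) + S (gauge q (T d) w))
    (w : AlgFock V) : E (wickMap q X β T w) = S w := by
  refine DirectSum.induction_on w ?_ (fun n x => eval_wickMap_lof q X β T E S L h1 hL hS n x)
    fun x y hx hy => ?_
  · rw [map_zero, map_zero, map_zero]
  · rw [map_add, map_add, map_add, hx, hy]

end WickMap

section VectorEval

variable {F : Type*} [NormedAddCommGroup F] [InnerProductSpace ℂ F]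

/-- The linear map `A ↦ A Ω`. -/
def vectorEval (𝒜 : Subalgebra ℂ (F →L[ℂ] F)) (Ω : F) : 𝒜 →ₗ[ℂ] F where
  toFun A := A.1 Ω
  map_add' _ _ := rfl
  map_smul' _ _ := rfl

variable (𝒜 : Subalgebra ℂ (F →L[ℂ] F)) (Ω : F)

lemma vectorEval_apply (A : 𝒜) : vectorEval 𝒜 Ω A = A.1 Ω := rfl

lemma vectorEval_one : vectorEval 𝒜 Ω 1 = Ω := rfl

lemma vectorEval_mul (A B : 𝒜) : vectorEval 𝒜 Ω (A * B) = A.1 (vectorEval 𝒜 Ω B) := rfl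

end VectorEval

/-! ### The Wick map at the vacuum; the separating property -/

section WickVacuum

open MeasureTheory

open scoped NNReal ENNReal

variable {ν : Measure ℝ} [HasCompactSupp ν] [IsProbabilityMeasure ν] (q : Set.Ioo (-1 : ℝ) 1)

lemma stepToFock_apply (w : AlgFock (stepSpace ν)) :
    stepToFock ν q w = toFock q (fockMap (stepSpace ν).subtype w) := rfl

/-- The space `𝒟` is an inner product space in its own right, so strict positivity applies directly
to the Fock space over `𝒟`, and the inclusion of `𝒟` preserves the `q`-form. -/
lemma stepToFock_injective : Function.Injective (stepToFock ν q) := by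
  rw [injective_iff_map_eq_zero]
  intro w hw
  refine qInner_self_eq_zero (abs_lt_one q) ?_
  rw [← qInner_fockMap q (stepSpace ν).subtypeₗᵢ, ← inner_toFock]
  change ⟪stepToFock ν q w, stepToFock ν q w⟫_ℂ = 0
  rw [hw, inner_zero_left]

lemma stepToFock_vac : stepToFock ν q (vac (stepSpace ν)) = vacuum q (OneParticle ν) := by
  rw [stepToFock_apply, fockMap_vac, vacuum]

/-- The action of the field operators on tensors of elements of `𝒟`. -/
lemma field_stepToFock (d : stepSpace ν) (w : AlgFock (stepSpace ν)) :
    field ν q d (stepToFock ν q w) = stepToFock ν q (create d w) +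
      stepToFock ν q (annih q (bilin d) w) + stepToFock ν q (gauge q (multStep d) w) := by
  -- By definition `bilin d` and `multStep d` are restrictions to `𝒟` of the functional `⟨d̄, ·⟩`
  -- and of `T_d`, so the inclusion of `𝒟` intertwines the operators built from them.
  have h1 : fockMap (stepSpace ν).subtype (annih q (bilin d) w) =
      annih q (innerₛₗ ℂ (star (d : OneParticle ν))) (fockMap (stepSpace ν).subtype w) :=
    fockMap_annih (stepSpace ν).subtype (q : ℝ) (innerₛₗ ℂ (star (d : OneParticle ν))) w
  have h2 : fockMap (stepSpace ν).subtype (gauge q (multStep d) w) =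
      gauge q (multOp d).toLinearMap (fockMap (stepSpace ν).subtype w) :=
    fockMap_gauge (stepSpace ν).subtype (q : ℝ) (T := multStep d)
      (T' := (multOp d).toLinearMap) (fun _ => rfl) w
  have h3 : field ν q d = annihilation q (star (d : OneParticle ν)) +
    creation q (d : OneParticle ν) + gaugeOp q (multOp d) := rfl
  rw [h3, stepToFock_apply, stepToFock_apply, stepToFock_apply, stepToFock_apply, h1, h2,
    fockMap_create, add_apply, add_apply, annihilation_toFock, creation_toFock, gaugeOp_toFock,
    add_comm (toFock q (annih _ _ _))]
  rfl

/-- `W(w) Ω = w`. -/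
lemma wick_vacuum (w : AlgFock (stepSpace ν)) :
    vectorEval (algDelta ν q) (vacuum q (OneParticle ν)) (wick ν q w) = stepToFock ν q w :=
  eval_wickMap q (fieldDelta (ν := ν) q) bilin multStep
    (vectorEval (algDelta ν q) (vacuum q (OneParticle ν))) (stepToFock ν q) (fun d => field ν q d)
    (stepToFock_vac q).symm (fun _ A => vectorEval_mul _ _ _ A) (field_stepToFock q) w

/-- The Wick map is onto. -/
lemma wick_surjective : Function.Surjective (wick ν q) := by
  intro A
  -- The range of `W` contains `1 = W(Ω)` and is stable under left multiplication by the algebra,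
  -- hence is all of it.
  obtain ⟨w, hw⟩ := exists_wickMap_eq_mul q (fieldDelta (ν := ν) q) bilin multStep
    (algDelta ν q).val (b := A.1) A.2 (vac _)
  refine ⟨w, Subtype.ext ?_⟩
  rw [wickMap_vac, map_one, mul_one] at hw
  exact hw

/-- The vacuum separates the algebra of the field operators. -/
lemma eq_zero_of_apply_vacuum {A : QFock q (OneParticle ν) →L[ℂ] QFock q (OneParticle ν)}
    (hA : A ∈ algDelta ν q) (h : A (vacuum q (OneParticle ν)) = 0) : A = 0 := by
  obtain ⟨w, hw⟩ := wick_surjective q ⟨A, hA⟩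
  have h1 := wick_vacuum q w
  rw [hw, vectorEval_apply, h] at h1
  rw [stepToFock_injective q (h1.symm.trans (map_zero _).symm), map_zero] at hw
  exact (congrArg Subtype.val hw).symm

end WickVacuum

/-! end QLevy

end
# Density of the step functions -/

section Density

open MeasureTheory

open scoped NNReal ENNReal

/-- The points dividing `[a, b]` into `N` equal parts. -/
def node (a b : ℝ) (N j : ℕ) : ℝ := a + (b - a) * (j / N)

lemma node_zero (a b : ℝ) (N : ℕ) : node a b N 0 = a := by simp [node]

lemma node_self (a b : ℝ) {N : ℕ} (hN : N ≠ 0) : node a b N N = b := by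
  rw [node, div_self (Nat.cast_ne_zero.2 hN)]; ring

lemma node_mono {a b : ℝ} (h : a ≤ b) (N : ℕ) : Monotone (node a b N) := by
  intro i j hij
  have : 0 ≤ b - a := sub_nonneg.2 h
  unfold node
  gcongr

lemma le_node {a b : ℝ} (h : a ≤ b) (N j : ℕ) : a ≤ node a b N j := by
  conv_lhs => rw [← node_zero a b N]
  exact node_mono h N (Nat.zero_le j)

lemma node_succ_sub (a b : ℝ) (N j : ℕ) : node a b N (j + 1) - node a b N j = (b - a) / N := by
  unfold node
  push_cast
  ring

lemma sum_indicator_Ico {t : ℕ → ℝ} (ht : Monotone t) (N : ℕ) (x : ℝ) :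
    ∑ j ∈ Finset.range N, (Set.Ico (t j) (t (j + 1))).indicator (1 : ℝ → ℂ) x =
      (Set.Ico (t 0) (t N)).indicator 1 x := by
  induction N with
  | zero => simp
  | succ N ih =>
    rw [Finset.sum_range_succ, ih, ← Set.Ico_union_Ico_eq_Ico (ht (Nat.zero_le N)) (ht N.le_succ),
      Set.indicator_union_of_disjoint]
    exact Set.Ico_disjoint_Ico_same

variable (ν : Measure ℝ)

lemma ae_nonneg_fst [SFinite ν] : ∀ᵐ z ∂(timeJump ν), 0 ≤ z.1 :=
  Measure.quasiMeasurePreserving_fst.ae (ae_restrict_mem measurableSet_Ici)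

variable [IsProbabilityMeasure ν]

instance : IsLocallyFiniteMeasure (timeJump ν) := by unfold timeJump; infer_instance

lemma timeJump_strip_le (a b : ℝ) :
    timeJump ν (Set.Ico a b ×ˢ Set.univ) ≤ ENNReal.ofReal (b - a) := by
  rw [timeJump, Measure.prod_prod, measure_univ, mul_one, ← Real.volume_Ico]
  exact Measure.restrict_apply_le _ _

/-- As `ν` has total mass one, the strip `[a, b) × ℝ` has mass at most the length of the interval.
The bound serves both for the density of `𝒟` and for the smallness of cells in a subdivision. -/
lemma eLpNorm_le_of_strip {f : ℝ × ℝ → ℂ} {a b C : ℝ} (hC : 0 ≤ C)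
    (hf : ∀ᵐ z ∂(timeJump ν), ‖f z‖ ≤ (Set.Ico a b).indicator (fun _ => C) z.1) :
    eLpNorm f 2 (timeJump ν) ≤ ENNReal.ofReal (C * √(b - a)) := by
  have hs : MeasurableSet (Set.Ico a b ×ˢ (Set.univ : Set ℝ)) := measurableSet_Ico.prod .univ
  have h1 : eLpNorm f 2 (timeJump ν) ≤
      eLpNorm ((Set.Ico a b ×ˢ (Set.univ : Set ℝ)).indicator fun _ => C) 2 (timeJump ν) := by
    refine eLpNorm_mono_ae ?_
    filter_upwards [hf] with z hz
    refine hz.trans ((le_abs_self _).trans_eq ?_)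
    rw [Real.norm_eq_abs]
    congr 1
    by_cases h : z.1 ∈ Set.Ico a b
    · rw [Set.indicator_of_mem h, Set.indicator_of_mem (show z ∈ Set.Ico a b ×ˢ Set.univ from ⟨h, trivial⟩)]
    · rw [Set.indicator_of_notMem h, Set.indicator_of_notMem fun h' => h h'.1]
  refine h1.trans ((eLpNorm_indicator_const hs (by norm_num) (by norm_num)).trans_le ?_)
  rw [ENNReal.ofReal_mul hC, Real.enorm_eq_ofReal hC]
  gcongr
  rw [Real.sqrt_eq_rpow]
  by_cases hab : a ≤ b
  · rw [← ENNReal.ofReal_rpow_of_nonneg (sub_nonneg.2 hab) (by norm_num)]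
    norm_num
    gcongr
    exact timeJump_strip_le ν a b
  · rw [Set.Ico_eq_empty (by simpa using (not_le.1 hab).le)]
    simp

variable [HasCompactSupp ν]

/-- The functions representing elements of `𝒟`. -/
def IsStep (f : ℝ × ℝ → ℂ) : Prop := ∃ d ∈ stepSpace ν, (d : OneParticle ν) =ᵐ[timeJump ν] f

variable {ν}

lemma IsStep.add {f g : ℝ × ℝ → ℂ} (hf : IsStep ν f) (hg : IsStep ν g) : IsStep ν (f + g) := by
  obtain ⟨d, hd, h⟩ := hf
  obtain ⟨e, he, h'⟩ := hg
  exact ⟨d + e, add_mem hd he, (Lp.coeFn_add d e).trans (h.add h')⟩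

lemma IsStep.smul {f : ℝ × ℝ → ℂ} (c : ℂ) (hf : IsStep ν f) : IsStep ν (c • f) := by
  obtain ⟨d, hd, h⟩ := hf
  exact ⟨c • d, Submodule.smul_mem _ c hd, (Lp.coeFn_smul c d).trans (h.const_smul c)⟩

lemma IsStep.zero : IsStep ν 0 := ⟨0, zero_mem _, Lp.coeFn_zero _ _ _⟩

lemma IsStep.sum {ι : Type*} (s : Finset ι) {f : ι → ℝ × ℝ → ℂ} (hf : ∀ i ∈ s, IsStep ν (f i)) :
    IsStep ν (∑ i ∈ s, f i) := by
  classical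
  induction s using Finset.induction_on with
  | empty => simpa using IsStep.zero
  | insert i s hi ih =>
    rw [Finset.sum_insert hi]
    exact (hf i (Finset.mem_insert_self i s)).add
      (ih fun j hj => hf j (Finset.mem_insert_of_mem hj))

lemma isStep_stepMono {a b : ℝ} (ha : 0 ≤ a) (hb : a ≤ b) (k : ℕ) : IsStep ν (stepMono a b k) :=
  ⟨stepVec ν a b k, stepVec_mem ha hb k, MemLp.coeFn_toLp _⟩

lemma isStep_polynomial {a b : ℝ} (ha : 0 ≤ a) (hb : a ≤ b) (p : Polynomial ℝ) :
    IsStep ν fun z => (Set.Ico a b).indicator 1 z.1 * ((p.eval z.2 : ℝ) : ℂ) := by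
  convert! IsStep.sum (ν := ν) (Finset.range (p.natDegree + 1)) fun k _ =>
    (isStep_stepMono ha hb k).smul ((p.coeff k : ℝ) : ℂ) using 1
  ext z
  rw [Polynomial.eval_eq_sum_range, Complex.ofReal_sum, Finset.mul_sum, Finset.sum_apply]
  refine Finset.sum_congr rfl fun k _ => ?_
  rw [Pi.smul_apply, stepMono, smul_eq_mul]
  push_cast
  ring

/-- A continuous function with compact support is uniformly close to step functions. -/
lemma exists_isStep_near {φ : ℝ × ℝ → ℂ} (hφ : Continuous φ) (hc : HasCompactSupport φ) {ε : ℝ}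
    (hε : 0 < ε) {M R : ℝ} (hM : 0 ≤ M) (hsupp : ∀ z : ℝ × ℝ, M ≤ z.1 → φ z = 0) :
    ∃ g, IsStep ν g ∧ ∀ z : ℝ × ℝ, 0 ≤ z.1 → ‖z.2‖ ≤ R →
      ‖φ z - g z‖ ≤ (Set.Ico 0 M).indicator (fun _ => ε) z.1 := by
  -- One third of `ε` is for freezing the time at the left end of a cell; the other two are for
  -- polynomial approximation of the real and the imaginary part.
  obtain ⟨δ, hδ, hu⟩ := Metric.uniformContinuous_iff.1 (hc.uniformContinuous_of_continuous hφ)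
    (ε / 3) (by positivity)
  obtain ⟨N, hN⟩ := exists_nat_gt (M / δ)
  have hN0 : 0 < N := by
    have : (0 : ℝ) < N := lt_of_le_of_lt (by positivity) hN
    exact_mod_cast this
  have hw : M / N < δ := by
    rw [div_lt_iff₀ hδ] at hN
    rw [div_lt_iff₀ (by exact_mod_cast hN0)]
    linarith
  -- On each cell `φ(t, x)` is replaced by a polynomial in `x` close to `φ(t_j, x)` on `[-R, R]`,
  -- which carries almost all of `ν` in the application.
  set t := node 0 M N with ht
  have htm : Monotone t := node_mono hM N
  have hp : ∀ j : ℕ, ∃ p : Polynomial ℝ, ∀ x ∈ Set.Icc (-R) R,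
      |p.eval x - (φ (t j, x)).re| < ε / 3 := fun j =>
    exists_polynomial_near_of_continuousOn _ _ (fun x => (φ (t j, x)).re)
      (by fun_prop) _ (by positivity)
  have hr : ∀ j : ℕ, ∃ p : Polynomial ℝ, ∀ x ∈ Set.Icc (-R) R,
      |p.eval x - (φ (t j, x)).im| < ε / 3 := fun j =>
    exists_polynomial_near_of_continuousOn _ _ (fun x => (φ (t j, x)).im)
      (by fun_prop) _ (by positivity)
  choose p hp using hp
  choose r hr using hr
  let P : ℕ → ℝ → ℂ := fun j x =>
    (((p j).eval x : ℝ) : ℂ) + Complex.I * (((r j).eval x : ℝ) : ℂ)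
  have hP : ∀ j, ∀ x ∈ Set.Icc (-R) R, ‖φ (t j, x) - P j x‖ ≤ 2 * (ε / 3) := by
    intro j x hx
    have e : φ (t j, x) - P j x = (((φ (t j, x)).re - (p j).eval x : ℝ) : ℂ) +
        (((φ (t j, x)).im - (r j).eval x : ℝ) : ℂ) * Complex.I := by
      conv_lhs => rw [← Complex.re_add_im (φ (t j, x))]
      simp only [P]
      push_cast
      ring
    rw [e]
    refine (norm_add_le _ _).trans ?_
    rw [norm_mul, Complex.norm_I, mul_one, Complex.norm_real, Complex.norm_real, Real.norm_eq_abs,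
      Real.norm_eq_abs, abs_sub_comm, abs_sub_comm (φ (t j, x)).im]
    linarith [hp j x hx, hr j x hx]
  refine ⟨∑ j ∈ Finset.range N, fun z =>
    (Set.Ico (t j) (t (j + 1))).indicator 1 z.1 * P j z.2, IsStep.sum _ fun j _ => ?_,
    fun z h0 hR => ?_⟩
  · have h1 := isStep_polynomial (ν := ν) (le_node hM N j) (htm j.le_succ) (p j)
    have h2 := isStep_polynomial (ν := ν) (le_node hM N j) (htm j.le_succ) (r j)
    convert! h1.add (h2.smul Complex.I) using 1
    ext z
    simp only [P, Pi.add_apply, Pi.smul_apply, smul_eq_mul]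
    ring
  · have hx : z.2 ∈ Set.Icc (-R) R := abs_le.1 hR
    have h1 : φ z = ∑ j ∈ Finset.range N, (Set.Ico (t j) (t (j + 1))).indicator 1 z.1 * φ z := by
      rw [← Finset.sum_mul, sum_indicator_Ico htm, ht, node_zero, node_self _ _ hN0.ne']
      by_cases h : z.1 < M
      · rw [Set.indicator_of_mem (show z.1 ∈ Set.Ico 0 M from ⟨h0, h⟩), Pi.one_apply, one_mul]
      · rw [hsupp z (not_lt.1 h), mul_zero]
    -- The cells partition `[0, M)`, so the desired bound splits into a bound by `ε` on each cell.
    have h2 : (Set.Ico 0 M).indicator (fun _ => ε) z.1 =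
        ∑ j ∈ Finset.range N, ‖(Set.Ico (t j) (t (j + 1))).indicator (1 : ℝ → ℂ) z.1‖ * ε := by
      rw [← Finset.sum_mul]
      have := congrArg Complex.re (sum_indicator_Ico htm N z.1)
      rw [ht, node_zero, node_self _ _ hN0.ne', Complex.re_sum] at this
      have h3 : ∀ s : Set ℝ, ‖s.indicator (1 : ℝ → ℂ) z.1‖ = (s.indicator (1 : ℝ → ℂ) z.1).re := by
        intro s
        by_cases h : z.1 ∈ s <;> simp [h]
      simp only [h3]
      rw [this]
      by_cases h : z.1 ∈ Set.Ico 0 M <;> simp [h]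
    rw [h2]
    conv_lhs => rw [h1]
    rw [Finset.sum_apply, ← Finset.sum_sub_distrib]
    refine (norm_sum_le _ _).trans (Finset.sum_le_sum fun j _ => ?_)
    rw [← mul_sub, norm_mul]
    by_cases h : z.1 ∈ Set.Ico (t j) (t (j + 1))
    · gcongr
      have hd : dist z (t j, z.2) < δ := by
        rw [Prod.dist_eq, dist_self, max_lt_iff, Real.dist_eq, abs_of_nonneg (sub_nonneg.2 h.1)]
        refine ⟨?_, hδ⟩
        have := node_succ_sub 0 M N j
        rw [sub_zero] at this
        rw [← ht] at this
        linarith [h.2]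
      have := hu hd
      rw [dist_eq_norm] at this
      calc ‖φ z - P j z.2‖ = ‖(φ z - φ (t j, z.2)) + (φ (t j, z.2) - P j z.2)‖ := by
            rw [sub_add_sub_cancel]
        _ ≤ _ := norm_add_le _ _
        _ ≤ ε := by linarith [hP j z.2 hx]
    · simp [h]

variable (ν) in
/-- `𝒟` is dense in the one-particle space. -/
lemma dense_stepSpace : Dense (stepSpace ν : Set (OneParticle ν)) := by
  intro f
  rw [Metric.mem_closure_iff]
  intro ε hε
  have hε' : ENNReal.ofReal (ε / 3) ≠ 0 := (ENNReal.ofReal_pos.2 (by positivity)).ne'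
  obtain ⟨φ, hc, hle, hφ, hφm⟩ := (Lp.memLp f).exists_hasCompactSupport_eLpNorm_sub_le
    (by norm_num) hε'
  obtain ⟨R, -, hR⟩ := exists_ae_bound ν
  obtain ⟨M₀, hM₀⟩ := (hc.isBounded.image_fst).exists_norm_le
  -- The summand `1` makes `M` exceed every time in the support strictly, and makes it positive.
  set M := max M₀ 0 + 1 with hM
  have hMpos : 0 < M := by positivity
  have hsupp : ∀ z : ℝ × ℝ, M ≤ z.1 → φ z = 0 := by
    intro z hz
    by_contra h
    have h1 := hM₀ z.1 ⟨z, subset_tsupport _ h, rfl⟩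
    have h2 := (le_abs_self z.1).trans h1
    have := le_max_left M₀ 0
    linarith
  -- A uniform error `η` on a strip of length `M` costs at most `η √M` in `L²`. With `ε / 3` for
  -- this and `ε / 3` for replacing `f` by `φ`, the total stays below `ε`.
  obtain ⟨η, hη, hηε⟩ : ∃ η : ℝ, 0 < η ∧ η * √(M - 0) ≤ ε / 3 := by
    refine ⟨ε / 3 / (√(M - 0) + 1), by positivity, ?_⟩
    rw [div_mul_eq_mul_div, div_le_iff₀ (by positivity)]
    gcongr
    linarith
  obtain ⟨g, ⟨d, hd, hdg⟩, hg⟩ := exists_isStep_near (ν := ν) hφ hc hη (R := R) hMpos.le hsupp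
  refine ⟨d, hd, ?_⟩
  rw [← edist_lt_ofReal, Lp.edist_def]
  have h2 : eLpNorm (φ - (d : ℝ × ℝ → ℂ)) 2 (timeJump ν) ≤ ENNReal.ofReal (ε / 3) := by
    refine (eLpNorm_le_of_strip ν hη.le ?_).trans (ENNReal.ofReal_le_ofReal hηε)
    filter_upwards [hR, ae_nonneg_fst ν, hdg] with z h1 h2 h3
    rw [Pi.sub_apply, h3]
    refine hg z h2 ?_
    rwa [Complex.norm_real] at h1
  have h3 : (f : ℝ × ℝ → ℂ) - (d : ℝ × ℝ → ℂ) = ((f : ℝ × ℝ → ℂ) - φ) + (φ - (d : ℝ × ℝ → ℂ)) := by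
    rw [sub_add_sub_cancel]
  rw [h3]
  calc _ ≤ _ := eLpNorm_add_le ((Lp.memLp f).sub hφm).1 (hφm.sub (Lp.memLp d)).1 (by norm_num)
    _ ≤ ENNReal.ofReal (ε / 3) + ENNReal.ofReal (ε / 3) := add_le_add hle h2
    _ = ENNReal.ofReal (ε / 3 + ε / 3) := (ENNReal.ofReal_add (by positivity) (by positivity)).symm
    _ < ENNReal.ofReal ε := (ENNReal.ofReal_lt_ofReal_iff hε).2 (by linarith)

end Density

/-! end QLevy

end
# Cyclicity of the vacuum -/

section Commutation

variable {V : Type*} [AddCommGroup V] [Module ℂ V]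

lemma removeNth_succ_cons {V : Type*} {n : ℕ} (e : V) (v : Fin (n + 1) → V) (k : Fin (n + 1)) :
    (k.succ.removeNth (Fin.cons e v : Fin (n + 2) → V) : Fin (n + 1) → V) =
      Fin.cons e (k.removeNth v) := by
  ext i
  refine Fin.cases ?_ (fun i => ?_) i <;> simp [Fin.removeNth]

lemma removeNth_zero_cons {V : Type*} {n : ℕ} (e : V) (v : Fin n → V) :
    ((0 : Fin (n + 1)).removeNth (Fin.cons e v : Fin (n + 1) → V) : Fin n → V) = v := by
  ext i
  simp [Fin.removeNth]

/-- The linear map `d ↦ d ⊗ x`. -/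
def createLin (x : AlgFock V) : V →ₗ[ℂ] AlgFock V where
  toFun d := create d x
  map_add' d e := by rw [create_add]; rfl
  map_smul' c d := by rw [create_smul]; rfl

/-- The `q`-commutation relation. -/
lemma annih_create (q : ℝ) (φ : V →ₗ[ℂ] ℂ) (e : V) (x : AlgFock V) :
    annih q φ (create e x) = φ e • x + (q : ℂ) • create e (annih q φ x) := by
  refine LinearMap.congr_fun (f := annih q φ ∘ₗ create e)
    (g := φ e • LinearMap.id + (q : ℂ) • (create e ∘ₗ annih q φ)) (algFock_ext fun n v => ?_) x
  simp only [LinearMap.comp_apply, LinearMap.add_apply, LinearMap.smul_apply, LinearMap.id_apply]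
  rw [create_pureTensor, annih_pureTensor_succ, Fin.sum_univ_succ, removeNth_zero_cons]
  simp only [Fin.val_zero, pow_zero, one_smul, Fin.cons_zero]
  congr 1
  cases n with
  | zero => simp [annih_pureTensor_zero]
  | succ n =>
    rw [annih_pureTensor_succ, map_sum, Finset.smul_sum]
    refine Finset.sum_congr rfl fun k _ => ?_
    rw [removeNth_succ_cons, map_smul, map_smul, create_pureTensor, Fin.cons_succ, Fin.val_succ,
      pow_succ', mul_smul]

lemma gauge_create_vac (q : ℝ) (T : V →ₗ[ℂ] V) (e : V) (v : Fin 0 → V) :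
    gauge q T (create e (pureTensor v)) = create (T e) (pureTensor v) := by
  rw [create_pureTensor, gauge_pureTensor_succ, Fin.sum_univ_succ, removeNth_zero_cons,
    create_pureTensor]
  simp

/-- The term acting on the new first factor is the one that will raise the power of `x`. In every
other term the image `T (v k)` moves in front of `e`; when `T` and `e` live on a common cell, such a
tensor is of the diagonal type that vanishes in the limit. -/
lemma gauge_create (q : ℝ) (T : V →ₗ[ℂ] V) (e : V) {n : ℕ} (v : Fin (n + 1) → V) :
    gauge q T (create e (pureTensor v)) = create (T e) (pureTensor v) +
      ∑ k : Fin (n + 1), ((q : ℂ) ^ (k + 1 : ℕ)) •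
        create (T (v k)) (create e (pureTensor (k.removeNth v : Fin n → V))) := by
  rw [create_pureTensor, gauge_pureTensor_succ, Fin.sum_univ_succ, removeNth_zero_cons,
    create_pureTensor]
  simp only [Fin.val_zero, pow_zero, one_smul, Fin.cons_zero]
  congr 1
  refine Finset.sum_congr rfl fun k _ => ?_
  rw [removeNth_succ_cons, create_pureTensor, create_pureTensor, Fin.cons_succ, Fin.val_succ]

end Commutation

/-! ### Subdivisions, vanishing of diagonal tensors, and generation of the powers of x -/

section Cyclic

open MeasureTheory Filter Topology

open scoped NNReal ENNReal

variable {ν : Measure ℝ}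

/-- `u` vanishes outside `[a, b) × ℝ` and is bounded by `C`. -/
def InStrip (a b C : ℝ) (u : OneParticle ν) : Prop :=
  ∀ᵐ z ∂(timeJump ν), ‖u z‖ ≤ (Set.Ico a b).indicator (fun _ => C) z.1

lemma InStrip.inner_eq_zero {a b c d C D : ℝ} {u v : OneParticle ν} (hu : InStrip a b C u)
    (hv : InStrip c d D v) (h : Disjoint (Set.Ico a b) (Set.Ico c d)) : ⟪u, v⟫_ℂ = 0 := by
  rw [L2.inner_def]
  refine integral_eq_zero_of_ae ?_
  filter_upwards [hu, hv] with z hu hv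
  by_cases hz : z.1 ∈ Set.Ico a b
  · rw [Set.indicator_of_notMem (Set.disjoint_left.1 h hz), norm_le_zero_iff] at hv
    rw [hv, inner_zero_right]; rfl
  · rw [Set.indicator_of_notMem hz, norm_le_zero_iff] at hu
    rw [hu, inner_zero_left]; rfl

variable [IsProbabilityMeasure ν]

lemma InStrip.norm_sq_le {a b C : ℝ} (hC : 0 ≤ C) (hab : a ≤ b) {u : OneParticle ν}
    (hu : InStrip a b C u) : ‖u‖ ^ 2 ≤ C ^ 2 * (b - a) := by
  have h : ‖u‖ ≤ C * √(b - a) := by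
    rw [Lp.norm_def]
    exact ENNReal.toReal_le_of_le_ofReal (by positivity) (eLpNorm_le_of_strip ν hC hu)
  calc ‖u‖ ^ 2 ≤ (C * √(b - a)) ^ 2 := by gcongr
    _ = _ := by rw [mul_pow, Real.sq_sqrt (sub_nonneg.2 hab)]

variable [HasCompactSupp ν]

variable (ν) in
-- What matters is that the bound does not depend on the interval: one constant, a power of the
-- radius of the support of `ν`, serves all cells of all subdivisions.
lemma exists_inStrip_stepVec (k : ℕ) :
    ∃ C, 0 ≤ C ∧ ∀ a b : ℝ, InStrip a b C (stepVec ν a b k) := by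
  obtain ⟨R, hR0, hR⟩ := exists_ae_bound ν
  refine ⟨R ^ k, by positivity, fun a b => ?_⟩
  filter_upwards [hR, MemLp.coeFn_toLp (memLp_two_stepMono ν a b k)] with z hz h
  rw [show stepVec ν a b k z = _ from h, stepMono, norm_mul, norm_pow]
  by_cases hz' : z.1 ∈ Set.Ico a b
  · rw [Set.indicator_of_mem hz', Set.indicator_of_mem hz', Pi.one_apply, norm_one, one_mul]
    gcongr
  · rw [Set.indicator_of_notMem hz', Set.indicator_of_notMem hz', norm_zero, zero_mul]

/-- The vector `χ_{[a, b)} ⊗ x^k` as an element of `𝒟`. -/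
def stepEl {a b : ℝ} (ha : 0 ≤ a) (hab : a ≤ b) (k : ℕ) : stepSpace ν :=
  ⟨stepVec ν a b k, stepVec_mem ha hab k⟩

lemma mem_of_stepEl_mem {Q : Submodule ℂ (stepSpace ν)}
    (h : ∀ (a b : ℝ) (ha : 0 ≤ a) (hab : a ≤ b) (k : ℕ), stepEl ha hab k ∈ Q) (d : stepSpace ν) :
    d ∈ Q := by
  have hle : stepSpace ν ≤ Q.map (stepSpace ν).subtype := by
    refine Submodule.span_le.2 ?_
    rintro _ ⟨a, b, k, ha, hab, rfl⟩
    exact ⟨_, h a b ha hab k, rfl⟩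
  obtain ⟨e, he, hed⟩ := hle d.2
  rwa [← Subtype.ext hed]

lemma coe_stepEl {a b : ℝ} (ha : 0 ≤ a) (hab : a ≤ b) (k : ℕ) :
    ((stepEl ha hab k : stepSpace ν) : OneParticle ν) = stepVec ν a b k := rfl

lemma coe_multStep (d f : stepSpace ν) :
    ((multStep d f : stepSpace ν) : OneParticle ν) = multOp d (f : OneParticle ν) := rfl

/-- Elements of `𝒟` are essentially bounded, and so is `x` on the support of `ν`; hence `x χ f` has
a bound that is uniform in the interval. -/
lemma exists_inStrip_multStep (f : stepSpace ν) : ∃ C, 0 ≤ C ∧ ∀ (a b : ℝ) (ha : 0 ≤ a)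
    (hab : a ≤ b), InStrip a b C (multOp (stepEl ha hab 0) (f : OneParticle ν)) := by
  obtain ⟨R, hR0, hR⟩ := exists_ae_bound ν
  have hf : ∀ᵐ z ∂(timeJump ν), ‖(f : OneParticle ν) z‖ ≤
      (eLpNormEssSup (f : OneParticle ν) (timeJump ν)).toReal := by
    have hfin : eLpNormEssSup (f : OneParticle ν) (timeJump ν) ≠ ∞ := by
      rw [← eLpNorm_exponent_top]
      exact (memLp_top_of_mem f.2).eLpNorm_ne_top
    filter_upwards [enorm_ae_le_eLpNormEssSup (f : OneParticle ν) (timeJump ν)] with z hz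
    rw [← toReal_enorm]
    exact ENNReal.toReal_mono hfin hz
  obtain ⟨C, hC0, hC⟩ := exists_inStrip_stepVec ν 0
  set D := (eLpNormEssSup (f : OneParticle ν) (timeJump ν)).toReal
  have hD : 0 ≤ D := ENNReal.toReal_nonneg
  refine ⟨R * C * D, by positivity, fun a b ha hab => ?_⟩
  have h3 := hC a b
  rw [← coe_stepEl ha hab] at h3
  filter_upwards [hR, hf, h3, multOp_coeFn (stepEl ha hab 0) (f : OneParticle ν)]
    with z h1 h2 h5 h4
  rw [h4, norm_mul, norm_mul]
  by_cases hz' : z.1 ∈ Set.Ico a b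
  · rw [Set.indicator_of_mem hz'] at h5 ⊢
    gcongr
  · rw [Set.indicator_of_notMem hz'] at h5 ⊢
    rw [le_antisymm h5 (norm_nonneg _), mul_zero, zero_mul]

lemma stepVec_add {a b c : ℝ} (hab : a ≤ b) (hbc : b ≤ c) (k : ℕ) :
    stepVec ν a b k + stepVec ν b c k = stepVec ν a c k := by
  apply Lp.ext
  filter_upwards [Lp.coeFn_add (stepVec ν a b k) (stepVec ν b c k),
    MemLp.coeFn_toLp (memLp_two_stepMono ν a b k), MemLp.coeFn_toLp (memLp_two_stepMono ν b c k),
    MemLp.coeFn_toLp (memLp_two_stepMono ν a c k)] with z h1 h2 h3 h4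
  rw [h1, Pi.add_apply, show stepVec ν a b k z = _ from h2, show stepVec ν b c k z = _ from h3,
    show stepVec ν a c k z = _ from h4, stepMono, stepMono, stepMono, ← add_mul,
    ← Set.Ico_union_Ico_eq_Ico hab hbc,
    Set.indicator_union_of_disjoint Set.Ico_disjoint_Ico_same]

lemma stepVec_self (a : ℝ) (k : ℕ) : stepVec ν a a k = 0 := by
  have := stepVec_add (ν := ν) (le_refl a) (le_refl a) k
  simpa using this

/-- The restriction of `1 ⊗ x^k` to the `j`-th of `N` equal parts of `[a, b)`. -/
def cell {a b : ℝ} (ha : 0 ≤ a) (hab : a ≤ b) (k N j : ℕ) : stepSpace ν :=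
  stepEl (ha.trans (le_node hab N j)) (node_mono hab N j.le_succ) k

variable {a b : ℝ} (ha : 0 ≤ a) (hab : a ≤ b)

lemma sum_cell (k : ℕ) {N : ℕ} (hN : N ≠ 0) :
    ∑ j ∈ Finset.range N, cell (ν := ν) ha hab k N j = stepEl ha hab k := by
  apply Subtype.ext
  have h : ∀ m : ℕ, ∑ j ∈ Finset.range m, stepVec ν (node a b N j) (node a b N (j + 1)) k =
      stepVec ν a (node a b N m) k := by
    intro m
    induction m with
    | zero => rw [Finset.sum_range_zero, node_zero, stepVec_self]
    | succ m ih => rw [Finset.sum_range_succ, ih, stepVec_add (le_node hab N m)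
        (node_mono hab N m.le_succ)]
  have := h N
  rw [node_self a b hN] at this
  rw [Submodule.coe_sum]
  exact this

/-- The indicator of a cell is idempotent, while `T_d` contributes one extra factor `x`. This is how
higher powers of `x` arise from a process that only contains `χ ⊗ 1`. -/
lemma multStep_cell (k N j : ℕ) :
    multStep (cell (ν := ν) ha hab 0 N j) (cell ha hab k N j) = cell ha hab (k + 1) N j := by
  apply Subtype.ext
  refine (multOp_stepVec (ha.trans (le_node hab N j)) (node_mono hab N j.le_succ) 0 k).trans ?_
  rw [max_self, min_self, max_eq_right (node_mono hab N j.le_succ), zero_add]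
  rfl

variable (ν) in
lemma exists_inStrip_cell (k : ℕ) : ∃ C, 0 ≤ C ∧ ∀ N j, InStrip (node a b N j)
    (node a b N (j + 1)) C (cell ha hab k N j : stepSpace ν).1 := by
  obtain ⟨C, hC, h⟩ := exists_inStrip_stepVec ν k
  refine ⟨C, hC, fun N j => ?_⟩
  rw [cell, coe_stepEl]
  exact h _ _

lemma exists_inStrip_multStep_cell (f : stepSpace ν) : ∃ C, 0 ≤ C ∧ ∀ N j, InStrip (node a b N j)
    (node a b N (j + 1)) C (multStep (cell ha hab 0 N j) f : stepSpace ν).1 := by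
  obtain ⟨C, hC, h⟩ := exists_inStrip_multStep f
  refine ⟨C, hC, fun N j => ?_⟩
  rw [coe_multStep, cell]
  exact h _ _ _ _

variable (q : Set.Ioo (-1 : ℝ) 1)

/-- Tensors concentrated near the diagonal in the first two factors are small. -/
lemma tendsto_diagonal {u v : ℕ → ℕ → stepSpace ν} {C D : ℝ} (hC : 0 ≤ C) (hD : 0 ≤ D)
    (hu : ∀ N j, InStrip (node a b N j) (node a b N (j + 1)) C (u N j : OneParticle ν))
    (hv : ∀ N j, InStrip (node a b N j) (node a b N (j + 1)) D (v N j : OneParticle ν))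
    (hab : a ≤ b) {n : ℕ} (z : Fin n → stepSpace ν) :
    Tendsto (fun N => ∑ j ∈ Finset.range N,
      stepToFock ν q (create (u N j) (create (v N j) (pureTensor z)))) atTop (𝓝 0) := by
  set P := (1 + |(q : ℝ)|) ^ (pairs (n + 2)).card with hP
  set Z := ∏ k, ‖(z k : OneParticle ν)‖ ^ 2 with hZ
  have hP0 : 0 ≤ P := by positivity
  have hZ0 : 0 ≤ Z := by positivity
  -- There are `N` orthogonal terms, each with squared norm at most a constant times `(1/N)²`, since
  -- both cell factors have squared norm of order `1/N`. This leaves `L / N`.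
  set L := P * (C ^ 2 * (b - a) * (D ^ 2 * (b - a) * Z)) with hL
  have hlim : Tendsto (fun N : ℕ => √(L / N)) atTop (𝓝 0) := by
    have := (tendsto_const_div_atTop_nhds_zero_nat L).sqrt
    rwa [Real.sqrt_zero] at this
  refine squeeze_zero_norm' ?_ hlim
  filter_upwards [eventually_ne_atTop 0] with N hN
  refine Real.le_sqrt_of_sq_le ?_
  have h1 : ∑ j ∈ Finset.range N, stepToFock ν q (create (u N j) (create (v N j) (pureTensor z))) =
      toFock q (∑ j : Fin N, create (u N j : OneParticle ν) (create (v N j : OneParticle ν)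
        (pureTensor fun k => (z k : OneParticle ν)))) := by
    rw [Finset.sum_range, map_sum]
    refine Finset.sum_congr rfl fun j _ => ?_
    rw [stepToFock_apply, fockMap_create, fockMap_create, fockMap_pureTensor]
    rfl
  rw [h1]
  refine (norm_sq_toFock_sum_le q _ _ _ fun i j hij => ?_).trans ?_
  · refine (hu N i).inner_eq_zero (hu N j) ?_
    -- Different cells are disjoint, so the first factors are orthogonal.
    have := (node_mono hab N).pairwise_disjoint_on_Ico_succ
      (show (i : ℕ) ≠ j from fun h => hij (Fin.ext h))
    simpa using this
  · have hbound : ∀ j : Fin N, ‖(u N j : OneParticle ν)‖ ^ 2 * (‖(v N j : OneParticle ν)‖ ^ 2 * Z) ≤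
        C ^ 2 * ((b - a) / N) * (D ^ 2 * ((b - a) / N) * Z) := by
      intro j
      have e1 := (hu N j).norm_sq_le hC (node_mono hab N (Nat.le_succ _))
      have e2 := (hv N j).norm_sq_le hD (node_mono hab N (Nat.le_succ _))
      rw [node_succ_sub] at e1 e2
      gcongr
    calc _ ≤ P * ∑ _j : Fin N, C ^ 2 * ((b - a) / N) * (D ^ 2 * ((b - a) / N) * Z) :=
          mul_le_mul_of_nonneg_left (Finset.sum_le_sum fun j _ => hbound j) hP0
      _ = L / N := by
          rw [Finset.sum_const, Finset.card_univ, Fintype.card_fin, nsmul_eq_mul, hL]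
          have : (N : ℝ) ≠ 0 := Nat.cast_ne_zero.2 hN
          field_simp

lemma tendsto_create_create (k : ℕ) {n : ℕ} (z : Fin n → stepSpace ν) :
    Tendsto (fun N => ∑ j ∈ Finset.range N, stepToFock ν q
      (create (cell ha hab 0 N j) (create (cell ha hab k N j) (pureTensor z)))) atTop (𝓝 0) := by
  obtain ⟨C, hC, hC'⟩ := exists_inStrip_cell ν ha hab 0
  obtain ⟨D, hD, hD'⟩ := exists_inStrip_cell ν ha hab k
  exact tendsto_diagonal q hC hD hC' hD' hab z

/-- The action on the first factor sums exactly to the limit for every `N ≠ 0`, as the cells add up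
to `[a, b)`. The action on a factor of `z` brings a second vector supported in the same cell to the
front, so `tendsto_diagonal` applies. -/
lemma tendsto_gauge_create (k : ℕ) {n : ℕ} (z : Fin n → stepSpace ν) :
    Tendsto (fun N => ∑ j ∈ Finset.range N, stepToFock ν q
      (gauge q (multStep (cell ha hab 0 N j)) (create (cell ha hab k N j) (pureTensor z)))) atTop
      (𝓝 (stepToFock ν q (create (stepEl ha hab (k + 1)) (pureTensor z)))) := by
  have hmain : ∀ N : ℕ, N ≠ 0 → ∑ j ∈ Finset.range N, stepToFock ν q
      (create (cell ha hab (k + 1) N j) (pureTensor z)) =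
        stepToFock ν q (create (stepEl ha hab (k + 1)) (pureTensor z)) := by
    intro N hN
    rw [← sum_cell ha hab (k + 1) hN, ← map_sum]
    have : ∀ s : Finset ℕ, create (∑ j ∈ s, cell (ν := ν) ha hab (k + 1) N j) (pureTensor z) =
        ∑ j ∈ s, create (cell ha hab (k + 1) N j) (pureTensor z) := by
      intro s
      exact map_sum (createLin (pureTensor z)) _ s
    rw [this]
  cases n with
  -- Without factors in `z` there are no error terms, and the sequence is eventually constant.
  | zero =>
    refine tendsto_const_nhds.congr' ?_
    filter_upwards [eventually_ne_atTop 0] with N hN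
    rw [← hmain N hN]
    refine Finset.sum_congr rfl fun j _ => ?_
    rw [gauge_create_vac, multStep_cell]
  | succ n =>
    obtain ⟨D, hD, hD'⟩ := exists_inStrip_cell ν ha hab k
    have herr : Tendsto (fun N => ∑ m : Fin (n + 1), ((q : ℂ) ^ (m + 1 : ℕ)) •
        ∑ j ∈ Finset.range N, stepToFock ν q (create (multStep (cell ha hab 0 N j) (z m))
          (create (cell ha hab k N j) (pureTensor (m.removeNth z : Fin n → stepSpace ν)))))
        atTop (𝓝 0) := by
      have : Tendsto (fun N => ∑ m : Fin (n + 1), ((q : ℂ) ^ (m + 1 : ℕ)) •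
          ∑ j ∈ Finset.range N, stepToFock ν q (create (multStep (cell ha hab 0 N j) (z m))
            (create (cell ha hab k N j) (pureTensor (m.removeNth z : Fin n → stepSpace ν)))))
          atTop (𝓝 (∑ m : Fin (n + 1), ((q : ℂ) ^ (m + 1 : ℕ)) • 0)) := by
        refine tendsto_finsetSum _ fun m _ => Tendsto.const_smul ?_ _
        obtain ⟨C, hC, hC'⟩ := exists_inStrip_multStep_cell ha hab (z m)
        exact tendsto_diagonal q hC hD hC' hD' hab _
      simpa using this
    have h := (tendsto_const_nhds (x := stepToFock ν q
      (create (stepEl ha hab (k + 1)) (pureTensor z)))).add herr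
    rw [add_zero] at h
    refine h.congr' ?_
    filter_upwards [eventually_ne_atTop 0] with N hN
    rw [← hmain N hN]
    simp only [Finset.smul_sum]
    rw [Finset.sum_comm, ← Finset.sum_add_distrib]
    refine Finset.sum_congr rfl fun j _ => ?_
    rw [gauge_create, multStep_cell, map_add, map_sum]
    simp only [map_smul]

/-- A closed subspace which contains the vacuum and is invariant under the increments of the
process contains all tensors of elements of `𝒟`. -/
lemma stepToFock_lof_mem {K : Submodule ℂ (QFock q (OneParticle ν))} (hK : IsClosed (K : Set (QFock q (OneParticle ν))))
    (hvac : vacuum q (OneParticle ν) ∈ K)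
    (hinv : ∀ (a b : ℝ) (ha : 0 ≤ a) (hab : a ≤ b), ∀ x ∈ K, field ν q (stepEl ha hab 0) x ∈ K)
    (n : ℕ) : ∀ x : ⨂[ℂ]^n (stepSpace ν),
      stepToFock ν q (DirectSum.lof ℂ ℕ (fun n => ⨂[ℂ]^n (stepSpace ν)) n x) ∈ K := by
  induction n using Nat.strong_induction_on with
  | _ n ih =>
    intro x
    induction x using PiTensorProduct.induction_on with
    | add x y hx hy => rw [map_add, map_add]; exact add_mem hx hy
    | smul_tprod c v =>
      rw [map_smul, map_smul]
      refine Submodule.smul_mem _ c ?_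
      cases n with
      | zero =>
        have : DirectSum.lof ℂ ℕ (fun n => ⨂[ℂ]^n (stepSpace ν)) 0 (PiTensorProduct.tprod ℂ v) =
            vac (stepSpace ν) := by
          rw [vac, pureTensor, Subsingleton.elim v]
        rw [this, stepToFock_vac]
        exact hvac
      | succ n =>
        obtain ⟨d, z, rfl⟩ : ∃ (d : stepSpace ν) (z : Fin n → stepSpace ν), v = Fin.cons d z :=
          ⟨v 0, Fin.tail v, (Fin.cons_self_tail v).symm⟩
        rw [← createN_tprod, ← create_lof]
        change stepToFock ν q (create d (pureTensor z)) ∈ K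
        have hz : stepToFock ν q (pureTensor z) ∈ K := ih n (by omega) _
        have hann : ∀ φ : stepSpace ν →ₗ[ℂ] ℂ, stepToFock ν q (annih q φ (pureTensor z)) ∈ K := by
          intro φ
          rw [pureTensor]
          cases n with
          | zero => rw [annih_lof_zero, map_zero]; exact zero_mem K
          | succ n => rw [annih_lof_succ]; exact ih n (by omega) _
        -- The annihilation lowers the degree and the creation restores it, so this tensor has the
        -- degree of `z`, already covered by the induction hypothesis.
        have hca : ∀ (φ : stepSpace ν →ₗ[ℂ] ℂ) (e : stepSpace ν),
            stepToFock ν q (create e (annih q φ (pureTensor z))) ∈ K := by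
          intro φ e
          rw [pureTensor]
          cases n with
          | zero => rw [annih_lof_zero, map_zero, map_zero]; exact zero_mem K
          | succ n => rw [annih_lof_succ, create_lof]; exact ih (n + 1) (by omega) _
        have hgauge : ∀ T : stepSpace ν →ₗ[ℂ] stepSpace ν,
            stepToFock ν q (gauge q T (pureTensor z)) ∈ K := by
          intro T
          rw [pureTensor]
          cases n with
          | zero => rw [gauge_lof_zero, map_zero]; exact zero_mem K
          | succ n => rw [gauge_lof_succ]; exact ih (n + 1) (by omega) _
        -- Inner induction on the power of `x`, with `z` fixed and the interval arbitrary: the step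
        -- applies the hypothesis to each cell of a subdivision.
        have key : ∀ (k : ℕ) (a b : ℝ) (ha : 0 ≤ a) (hab : a ≤ b),
            stepToFock ν q (create (stepEl ha hab k) (pureTensor z)) ∈ K := by
          intro k
          induction k with
          | zero =>
            intro a b ha hab
            -- For `k = 0` the creation term is `X(χ)` applied to `z`, minus gauge and annihilation
            -- terms of degree at most that of `z`.
            have h := hinv a b ha hab _ hz
            rw [field_stepToFock] at h
            have h' := sub_mem (sub_mem h (hgauge (multStep (stepEl ha hab 0))))
              (hann (bilin (stepEl ha hab 0)))
            rwa [add_sub_cancel_right, add_sub_cancel_right] at h'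
          | succ k ihk =>
            intro a b ha hab
            have hlim := (tendsto_create_create ha hab q k z).add (tendsto_gauge_create ha hab q k z)
            rw [zero_add] at hlim
            -- The approximants consist of the creation and gauge parts of the increment applied on
            -- each cell. They lie in `K` for every `N`: the full action does, and the annihilation
            -- part removed from it is in `K` as well, so no estimate of that part is needed.
            refine hK.mem_of_tendsto hlim (Eventually.of_forall fun N => ?_)
            rw [SetLike.mem_coe, ← Finset.sum_add_distrib]
            refine sum_mem fun j _ => ?_
            have h1 := hinv _ _ (ha.trans (le_node hab N j)) (node_mono hab N j.le_succ) _
              (ihk _ _ (ha.trans (le_node hab N j)) (node_mono hab N j.le_succ))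
            change field ν q (cell ha hab 0 N j)
              (stepToFock ν q (create (cell ha hab k N j) (pureTensor z))) ∈ K at h1
            rw [field_stepToFock, annih_create, map_add, map_smul, map_smul] at h1
            -- By the `q`-commutation relation the annihilation part is a multiple of `z` plus `q`
            -- times a tensor covered by `hca`.
            have h2 := sub_mem h1 (add_mem
              (Submodule.smul_mem K (bilin (cell (ν := ν) ha hab 0 N j) (cell ha hab k N j)) hz)
              (Submodule.smul_mem K (q : ℂ) (hca (bilin (cell (ν := ν) ha hab 0 N j)) (cell ha hab k N j))))
            rwa [add_right_comm, add_sub_cancel_right] at h2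
        -- The set of admissible first factors `d` is a subspace, so the spanning vectors `χ ⊗ x^k`
        -- suffice.
        exact mem_of_stepEl_mem (Q := K.comap (stepToFock ν q ∘ₗ createLin (pureTensor z)))
          (fun a b ha hab k => key k a b ha hab) d

end Cyclic

/-! end QLevy

end
# Density of the tensors of step functions, and the isomorphisms -/

section Extension

variable {F : Type*} [NormedAddCommGroup F] [InnerProductSpace ℂ F] [CompleteSpace F]
  (𝒜 : Subalgebra ℂ (F →L[ℂ] F)) (Ω : F)

/-- An isometric map of `𝒜` with dense range extends to a unitary map of `L²(𝒜, φ)`. -/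
lemma exists_unitary_extension {E : Type*} [NormedAddCommGroup E] [InnerProductSpace ℂ E]
    [CompleteSpace E] (f : 𝒜 →ₗ[ℂ] E) (hf : ∀ A, ‖f A‖ = ‖A.1 Ω‖) (hd : DenseRange f) :
    ∃ U : L2Alg 𝒜 Ω ≃ₗᵢ[ℂ] E, ∀ A, U (toL2 𝒜 Ω A) = f A := by
  have hnorm : ∀ A, ‖f A‖ = ‖toL2 𝒜 Ω A‖ := fun A => by rw [hf, norm_toL2]
  let T : L2Alg 𝒜 Ω →L[ℂ] E := f.extendOfNorm (toL2 𝒜 Ω)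
  have hT : ∀ A, T (toL2 𝒜 Ω A) = f A := fun A =>
    LinearMap.extendOfNorm_eq (denseRange_toL2 𝒜 Ω) ⟨1, fun A => by rw [hnorm, one_mul]⟩ A
  have hTn : ∀ x, ‖T x‖ = ‖x‖ := by
    intro x
    refine (denseRange_toL2 𝒜 Ω).induction_on (p := fun x => ‖T x‖ = ‖x‖) x
      (isClosed_eq T.continuous.norm continuous_norm) fun A => ?_
    rw [hT, hnorm]
  let T' : L2Alg 𝒜 Ω →ₗᵢ[ℂ] E := ⟨T.toLinearMap, hTn⟩
  -- An isometry on a complete space has closed range, and this range contains the dense range of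
  -- `f`.
  have hsurj : Function.Surjective T' := by
    rw [← Set.range_eq_univ, ← T'.isometry.isClosedEmbedding.isClosed_range.closure_eq]
    refine Set.eq_univ_of_univ_subset ?_
    rw [← hd.closure_range]
    refine closure_mono ?_
    rintro _ ⟨A, rfl⟩
    exact ⟨toL2 𝒜 Ω A, hT A⟩
  exact ⟨LinearIsometryEquiv.ofSurjective T' hsurj, hT⟩

end Extension

/-! ### Density of tensors over the step space, cyclicity, and the unitaries -/

section Main

open MeasureTheory

open scoped NNReal ENNReal

variable (ν : Measure ℝ) [IsProbabilityMeasure ν] [HasCompactSupp ν] (q : Set.Ioo (-1 : ℝ) 1)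

/-- The elementary tensor is multilinear in its factors and its `q`-norm is at most a constant times
the product of their norms. Through this, density of `𝒟` passes to tensors of every degree. -/
lemma continuous_toFock_pureTensor {H : Type*} [NormedAddCommGroup H] [InnerProductSpace ℂ H]
    (n : ℕ) : Continuous fun v : Fin n → H => toFock q (pureTensor v) := by
  obtain ⟨C, -, hC⟩ := levelBound_qSeminorm (q := q) (H := H) n
  exact MultilinearMap.continuous_of_bound
    ((toFock q ∘ₗ DirectSum.lof ℂ ℕ (fun n => ⨂[ℂ]^n H) n).compMultilinearMap
      (PiTensorProduct.tprod ℂ)) C hC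

/-- The tensors of elements of `𝒟` are dense in the `q`-Fock space. -/
lemma denseRange_stepToFock : DenseRange (stepToFock ν q) := by
  set S := (LinearMap.range (stepToFock ν q)).topologicalClosure with hS
  have hpure : ∀ (n : ℕ) (v : Fin n → OneParticle ν), toFock q (pureTensor v) ∈ S := by
    intro n v
    have hd : DenseRange fun (u : Fin n → stepSpace ν) (i : Fin n) => (u i : OneParticle ν) :=
      DenseRange.piMap fun _ => (dense_stepSpace ν).denseRange_val
    refine hd.induction_on v ?_ fun u => ?_
    · exact (Submodule.isClosed_topologicalClosure _).preimage (continuous_toFock_pureTensor q n)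
    · refine Submodule.le_topologicalClosure _ ⟨pureTensor u, ?_⟩
      rw [stepToFock_apply, fockMap_pureTensor]
      rfl
  have hall : ∀ x : AlgFock (OneParticle ν), toFock q x ∈ S := by
    intro x
    induction x using algFock_induction with
    | h0 => rw [map_zero]; exact zero_mem _
    | hadd x y hx hy => rw [map_add]; exact add_mem hx hy
    | h c n v => rw [map_smul]; exact Submodule.smul_mem _ c (hpure n v)
  intro y
  refine closure_minimal (s := Set.range (toFock q)) (t := (S : Set (QFock q (OneParticle ν)))) ?_
    (Submodule.isClosed_topologicalClosure _) (denseRange_toFock y)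
  rintro _ ⟨x, rfl⟩
  exact hall x

/-- By linearity `X(χ_[a,b))` is the increment `X(b) - X(a)`. This is where the process itself,
rather than the larger family of fields, enters the proof of cyclicity. -/
lemma field_stepEl_mem_algX {a b : ℝ} (ha : 0 ≤ a) (hab : a ≤ b) :
    field ν q (stepEl ha hab 0) ∈ algX ν q := by
  have h : stepEl ha hab 0 = stepEl le_rfl (ha.trans hab) 0 - stepEl (ν := ν) le_rfl ha 0 := by
    rw [eq_sub_iff_add_eq]
    apply Subtype.ext
    rw [Submodule.coe_add, coe_stepEl, coe_stepEl, coe_stepEl, add_comm]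
    exact stepVec_add ha hab 0
  rw [h, map_sub]
  exact sub_mem (Algebra.subset_adjoin ⟨⟨b, ha.trans hab⟩, rfl⟩)
    (Algebra.subset_adjoin ⟨⟨a, ha⟩, rfl⟩)

/-- The vacuum is cyclic for the algebra of the process. -/
lemma denseRange_vectorEval : DenseRange (vectorEval (algX ν q) (vacuum q (OneParticle ν))) := by
  set Φ := vectorEval (algX ν q) (vacuum q (OneParticle ν)) with hΦ
  set K := (LinearMap.range Φ).topologicalClosure with hK
  -- The orbit of the vacuum is invariant under the algebra, hence so is its closure by continuity
  -- of the operators.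
  have hinv : ∀ A : algX ν q, ∀ x ∈ K, A.1 x ∈ K := by
    intro A x hx
    refine map_mem_closure A.1.continuous hx ?_
    rintro _ ⟨B, rfl⟩
    exact ⟨A * B, vectorEval_mul _ _ A B⟩
  have hvac : vacuum q (OneParticle ν) ∈ K :=
    Submodule.le_topologicalClosure _ ⟨1, vectorEval_one _ _⟩
  have hmem : ∀ w : AlgFock (stepSpace ν), stepToFock ν q w ∈ K := by
    intro w
    refine DirectSum.induction_on w ?_ (fun n x => ?_) fun x y hx hy => ?_
    · rw [map_zero]; exact zero_mem K
    · exact stepToFock_lof_mem q (Submodule.isClosed_topologicalClosure _) hvac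
        (fun a b ha hab x hx => hinv ⟨_, field_stepEl_mem_algX ν q ha hab⟩ x hx) n x
    · rw [map_add]; exact add_mem hx hy
  intro y
  refine closure_minimal (s := Set.range (stepToFock ν q))
    (t := (K : Set (QFock q (OneParticle ν)))) ?_
    (Submodule.isClosed_topologicalClosure _) (denseRange_stepToFock ν q y)
  rintro _ ⟨x, rfl⟩
  exact hmem x

lemma injective_vectorEval :
    Function.Injective (vectorEval (algX ν q) (vacuum q (OneParticle ν))) := by
  rw [injective_iff_map_eq_zero]
  intro A hA
  exact Subtype.ext (eq_zero_of_apply_vacuum q (algX_le_algDelta q A.2) hA)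

/-- Left multiplication by `A` sends the class of `1` to that of `A`, whose `L²` norm is the norm of
`A Ω`; so faithfulness reduces to the separating property. -/
lemma injective_gnsRep :
    Function.Injective (gnsRep (algX ν q) (vacuum q (OneParticle ν))) := by
  rw [injective_iff_map_eq_zero]
  intro A hA
  have h : toL2 (algX ν q) (vacuum q (OneParticle ν)) (A * 1) = 0 := by
    rw [← leftMul_toL2]
    exact DFunLike.congr_fun hA _
  rw [mul_one] at h
  have h' := norm_toL2 (algX ν q) (vacuum q (OneParticle ν)) A
  rw [h, norm_zero] at h'
  exact injective_vectorEval ν q ((norm_eq_zero.1 h'.symm).trans (map_zero _).symm)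

/-- The unitary maps between the `L²`-spaces of the two algebras and the `q`-Fock space. -/
lemma exists_unitaries :
    ∃ (U : L2Alg (algX ν q) (vacuum q (OneParticle ν)) ≃ₗᵢ[ℂ] QFock q (OneParticle ν))
      (J : L2Alg (algX ν q) (vacuum q (OneParticle ν)) ≃ₗᵢ[ℂ]
        L2Alg (algDelta ν q) (vacuum q (OneParticle ν))),
      (∀ A : algX ν q, U (toL2 _ _ A) = A.1 (vacuum q (OneParticle ν))) ∧
      (∀ A : algX ν q,
        J (toL2 _ _ A) = toL2 _ _ (Subalgebra.inclusion (algX_le_algDelta q) A)) ∧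
      (∀ w : AlgFock (stepSpace ν),
        U.symm (stepToFock ν q w) = J.symm (toL2 _ _ (wick ν q w))) := by
  set Ω := vacuum q (OneParticle ν) with hΩ
  obtain ⟨U, hU⟩ := exists_unitary_extension (algX ν q) Ω (vectorEval (algX ν q) Ω)
    (fun _ => rfl) (denseRange_vectorEval ν q)
  -- The orbit under the larger algebra contains the orbit under the smaller one, which is already
  -- dense.
  have hdense : DenseRange (vectorEval (algDelta ν q) Ω) := by
    refine (denseRange_vectorEval ν q).mono ?_
    rintro _ ⟨A, rfl⟩
    exact ⟨Subalgebra.inclusion (algX_le_algDelta q) A, rfl⟩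
  obtain ⟨U', hU'⟩ := exists_unitary_extension (algDelta ν q) Ω (vectorEval (algDelta ν q) Ω)
    (fun _ => rfl) hdense
  -- Both unitaries send the class of an operator to its value at the vacuum, so `J = U'⁻¹ U`
  -- extends the inclusion. The last identity amounts to `U' W(w) = W(w) Ω = w`.
  refine ⟨U, U.trans U'.symm, hU, fun A => ?_, fun w => ?_⟩
  · rw [LinearIsometryEquiv.trans_apply, LinearIsometryEquiv.symm_apply_eq, hU, hU']
    rfl
  · rw [LinearIsometryEquiv.symm_apply_eq]
    change _ = U (U.symm (U' _))
    rw [LinearIsometryEquiv.apply_symm_apply, hU', wick_vacuum]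

end Main

end QLevy

end

theorem mainTheorem4 (q : Set.Ioo (-1 : ℝ) 1) (ν : MeasureTheory.Measure ℝ)
    [MeasureTheory.IsProbabilityMeasure ν] [QLevy.HasCompactSupp ν] :
    -- the vacuum is cyclic and separating for the algebra of the process
    QLevy.IsCyclicVector (QLevy.algX ν q) (QLevy.vacuum q (QLevy.OneParticle ν)) ∧
    QLevy.IsSeparatingVector (QLevy.algX ν q) (QLevy.vacuum q (QLevy.OneParticle ν)) ∧
    -- the representation `A ↦ A Ω` and the GNS representation are faithful
    Function.Injective
      (fun A : QLevy.algX ν q => A.1 (QLevy.vacuum q (QLevy.OneParticle ν))) ∧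
    Function.Injective
      (QLevy.gnsRep (QLevy.algX ν q) (QLevy.vacuum q (QLevy.OneParticle ν))) ∧
    -- the domain of the Wick map is dense in the `q`-Fock space
    DenseRange (QLevy.stepToFock ν q) ∧
    -- `U` extends `A ↦ A Ω`; `J` extends the inclusion of the two algebras, and identifies their
    -- `L²`-spaces; under this identification the Wick map extends to the inverse of `U`
    ∃ (U : QLevy.L2Alg (QLevy.algX ν q) (QLevy.vacuum q (QLevy.OneParticle ν)) ≃ₗᵢ[ℂ]
          QLevy.QFock q (QLevy.OneParticle ν))
      (J : QLevy.L2Alg (QLevy.algX ν q) (QLevy.vacuum q (QLevy.OneParticle ν)) ≃ₗᵢ[ℂ]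
          QLevy.L2Alg (QLevy.algDelta ν q) (QLevy.vacuum q (QLevy.OneParticle ν))),
      (∀ A : QLevy.algX ν q,
        U (QLevy.toL2 _ _ A) = A.1 (QLevy.vacuum q (QLevy.OneParticle ν))) ∧
      (∀ A : QLevy.algX ν q,
        J (QLevy.toL2 _ _ A) =
          QLevy.toL2 _ _ (Subalgebra.inclusion (QLevy.algX_le_algDelta q) A)) ∧
      (∀ w : QLevy.AlgFock (QLevy.stepSpace ν),
        U.symm (QLevy.stepToFock ν q w) = J.symm (QLevy.toL2 _ _ (QLevy.wick ν q w))) := by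
  refine ⟨?_, fun A hA h => QLevy.eq_zero_of_apply_vacuum q (QLevy.algX_le_algDelta q hA) h,
    QLevy.injective_vectorEval ν q, QLevy.injective_gnsRep ν q, QLevy.denseRange_stepToFock ν q,
    QLevy.exists_unitaries ν q⟩
  refine (QLevy.denseRange_vectorEval ν q).mono ?_
  rintro _ ⟨A, rfl⟩
  exact ⟨A.1, A.2, rfl⟩
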